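/- Let $n\ge 1$ and let $S^{2n-1}\subset\mathbb R^{2n}$ be the unit sphere with its round metric. A Clifford–Killing space $CK_l$ on $S^{2n-1}$ is a real vector space of dimension $l\ge 1$ consisting of (smooth) Killing vector fields each of which has constant length; two such spaces $V,W$ are equivalent if $df(V)=W$ for some isometry $f$ of $S^{2n-1}$ onto itself. Let $\rho$ be the Radon–Hurwitz function: $\rho(m)=8\alpha+2^\beta$ if $m=2^{4\alpha+\beta}m'$ with $\alpha\ge 0$, $0\le\beta\le 3$ and $m'$ odd. For $l\ge1$ let $n_0(l)=2^{4\alpha+\beta}$ if $8\alpha+2^{\beta-1}-1<l\le 8\alpha+2^\beta-1$ with $\alpha\ge 0$, $0\le\beta\le3$; this is the real dimension of every irreducible module over the Clifford algebra $Cl_l$ of a negative definite quadratic form on $\mathbb R^l$ (this equality is part of the claim). (1) $S^{2n-1}$ admits a Clifford–Killing space $CK_l$ if and only if $1\le l\le\rho(2n)-1$; in this case $n_0(l)$ divides $2n$. (2) Two Clifford–Killing spaces $CK_l$ on $S^{2n-1}$ are equivalent if and only if some element of $O(2n)$ carries one to the other. (3) Let $1\le l\le\rho(2n)-1$. If $l\not\equiv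 3\pmod 4$, all Clifford–Killing spaces $CK_l$ on $S^{2n-1}$ are pairwise equivalent. If $l\equiv 3\pmod 4$, there are exactly $[n/n_0(l)]+1$ equivalence classes of them. Hence all the spaces $CK_l$ on $S^{2n-1}$ are pairwise equivalent if and only if $l\not\equiv3\pmod 4$ or $n_0(l)=2n$. (4) Write $2n=2^{4\alpha+\beta}n'$ with $\alpha\ge0$, $0\le\beta\le3$ and $n'$ odd. All Clifford–Killing spaces $CK_{\rho(2n)-1}$ on $S^{2n-1}$ are pairwise equivalent if and only if $\beta\in\{0,1\}$ or $n'=1$. If $\beta\in\{2,3\}$, there are exactly $[n'/2]+1$ equivalence classes of spaces $CK_{\rho(2n)-1}$ on $S^{2n-1}$. -/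

import Mathlib

open scoped Manifold ContDiff

noncomputable section

namespace CliffordKilling

/-- The Euclidean space `ℝ^(d+1)`. -/
abbrev Amb (d : ℕ) : Type := EuclideanSpace ℝ (Fin (d + 1))

/-- The unit sphere `S^d` in `ℝ^(d+1)`, with Mathlib's smooth structure. -/
abbrev Sph (d : ℕ) : Type := Metric.sphere (0 : Amb d) 1

/-- Arbitrary (not necessarily smooth) tangent vector fields on `S^d`. -/
abbrev Field (d : ℕ) : Type := (x : Sph d) → TangentSpace (𝓡 d) x

/-- The differential at `x` of the inclusion `S^d → ℝ^(d+1)`. -/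
def incl {d : ℕ} (x : Sph d) : TangentSpace (𝓡 d) x →L[ℝ] Amb d :=
  mfderiv (𝓡 d) 𝓘(ℝ, Amb d) (fun y : Sph d => (y : Amb d)) x

/-- The round metric of constant curvature one: the metric induced by the inclusion. -/
def roundMetric {d : ℕ} (x : Sph d) (v w : TangentSpace (𝓡 d) x) : ℝ :=
  inner ℝ (incl x v) (incl x w)

/-- A vector field on `S^d`, viewed as a function with values in `ℝ^(d+1)`. -/
def ambient {d : ℕ} (X : Field d) (x : Sph d) : Amb d := incl x (X x)

/-- The Levi-Civita covariant derivative `∇_v X` of the round sphere, viewed in `ℝ^(d+1)`: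
the orthogonal projection onto the tangent space `x^⊥` of the derivative of `X` along `v`. -/
def covDeriv {d : ℕ} (X : Field d) (x : Sph d) (v : TangentSpace (𝓡 d) x) : Amb d :=
  (Submodule.span ℝ {(x : Amb d)})ᗮ.starProjection
    (mfderiv (𝓡 d) 𝓘(ℝ, Amb d) (ambient X) x v)

/-- Killing vector fields on the round sphere: smooth vector fields `X` that satisfy the Killing
equation `g(∇_v X, w) + g(v, ∇_w X) = 0`. -/
def IsKilling {d : ℕ} (X : Field d) : Prop :=
  ContMDiff (𝓡 d) ((𝓡 d).tangent) ∞ (fun x => (⟨x, X x⟩ : TangentBundle (𝓡 d) (Sph d))) ∧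
  ∀ (x : Sph d) (v w : TangentSpace (𝓡 d) x),
    inner ℝ (covDeriv X x v) (incl x w) + inner ℝ (incl x v) (covDeriv X x w) = 0

/-- Vector fields of constant length. -/
def HasConstantLength {d : ℕ} (X : Field d) : Prop :=
  ∃ c : ℝ, ∀ x : Sph d, Real.sqrt (roundMetric x (X x) (X x)) = c

/-- `V` is a Clifford-Killing space `CK_l` on the round sphere `S^d`: a real vector space of
dimension `l ≥ 1` that consists of Killing vector fields of constant length. -/
def IsCK (d l : ℕ) (V : Submodule ℝ (Field d)) : Prop :=
  1 ≤ l ∧ Module.finrank ℝ V = l ∧ ∀ X ∈ V, IsKilling X ∧ HasConstantLength X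

/-- Riemannian isometries of the round sphere onto itself. -/
def IsRiemannianIsometry {d : ℕ} (f : Diffeomorph (𝓡 d) (𝓡 d) (Sph d) (Sph d) ∞) : Prop :=
  ∀ (x : Sph d) (v w : TangentSpace (𝓡 d) x),
    roundMetric (f x) (mfderiv (𝓡 d) (𝓡 d) f x v) (mfderiv (𝓡 d) (𝓡 d) f x w)
      = roundMetric x v w

/-- `df(V) = W`: the members of `W` are exactly the images of the members of `V` under `df`. -/
def PushesTo {d : ℕ} (f : Diffeomorph (𝓡 d) (𝓡 d) (Sph d) (Sph d) ∞)
    (V W : Submodule ℝ (Field d)) : Prop :=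
  ∀ Y : Field d, Y ∈ W ↔ ∃ X ∈ V, ∀ x : Sph d, Y (f x) = mfderiv (𝓡 d) (𝓡 d) f x (X x)

/-- Equivalence of spaces of vector fields: `df(V) = W` for some isometry `f` of `S^d`. -/
def Equivalent {d : ℕ} (V W : Submodule ℝ (Field d)) : Prop :=
  ∃ f : Diffeomorph (𝓡 d) (𝓡 d) (Sph d) (Sph d) ∞, IsRiemannianIsometry f ∧ PushesTo f V W

/-- Equivalence with respect to the orthogonal group `O(d+1)`: some orthogonal transformation `A`
of `ℝ^(d+1)` carries `V` to `W`, where `A` acts on fields by `X ↦ A ∘ X ∘ A⁻¹`. -/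
def OrthogonallyEquivalent {d : ℕ} (V W : Submodule ℝ (Field d)) : Prop :=
  ∃ A : Amb d ≃ₗᵢ[ℝ] Amb d, ∀ Y : Field d, Y ∈ W ↔
    ∃ X ∈ V, ∀ x y : Sph d, (y : Amb d) = A x → ambient Y y = A (ambient X x)

theorem Equivalent.refl {d : ℕ} (V : Submodule ℝ (Field d)) : Equivalent V V := by
  refine ⟨Diffeomorph.refl (𝓡 d) (Sph d) ∞, ?_, ?_⟩
  · intro x v w
    have h : mfderiv (𝓡 d) (𝓡 d) (Diffeomorph.refl (𝓡 d) (Sph d) ∞) x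
        = ContinuousLinearMap.id ℝ (TangentSpace (𝓡 d) x) := mfderiv_id
    rw [h]
    rfl
  · intro Y
    have h : ∀ x, mfderiv (𝓡 d) (𝓡 d) (Diffeomorph.refl (𝓡 d) (Sph d) ∞) x
        = ContinuousLinearMap.id ℝ (TangentSpace (𝓡 d) x) := fun x => mfderiv_id
    constructor
    · intro hY
      refine ⟨Y, hY, fun x => ?_⟩
      rw [h]
      rfl
    · rintro ⟨X, hX, hXY⟩
      have : Y = X := by
        funext x
        have := hXY x
        rw [h] at this
        exact this
      rwa [this]

theorem mfderiv_symm_apply {d : ℕ} (f : Diffeomorph (𝓡 d) (𝓡 d) (Sph d) (Sph d) ∞) (x : Sph d)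
    (v : TangentSpace (𝓡 d) x) :
    mfderiv (𝓡 d) (𝓡 d) f.symm (f x) (mfderiv (𝓡 d) (𝓡 d) f x v) = v := by
  have h1 : MDifferentiableAt (𝓡 d) (𝓡 d) f x := f.mdifferentiable (by simp) x
  have h2 : MDifferentiableAt (𝓡 d) (𝓡 d) f.symm (f x) := f.symm.mdifferentiable (by simp) _
  have h3 := mfderiv_comp x h2 h1
  have h4 : (f.symm ∘ f : Sph d → Sph d) = id := by
    funext y
    simp
  rw [h4, mfderiv_id] at h3
  exact (DFunLike.congr_fun h3 v).symm

theorem mfderiv_apply_symm {d : ℕ} (f : Diffeomorph (𝓡 d) (𝓡 d) (Sph d) (Sph d) ∞) (y : Sph d)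
    (v : TangentSpace (𝓡 d) y) :
    mfderiv (𝓡 d) (𝓡 d) f (f.symm y) (mfderiv (𝓡 d) (𝓡 d) f.symm y v) = v :=
  mfderiv_symm_apply f.symm y v

theorem roundMetric_congr {d : ℕ} {x y : Sph d} (h : x = y) (v w : EuclideanSpace ℝ (Fin d)) :
    roundMetric x v w = roundMetric y v w := by
  subst h
  rfl

theorem field_congr {d : ℕ} (X : Field d) {x y : Sph d} (h : x = y) :
    (X x : EuclideanSpace ℝ (Fin d)) = X y := by
  subst h
  rfl

theorem exists_push {d : ℕ} (f : Diffeomorph (𝓡 d) (𝓡 d) (Sph d) (Sph d) ∞) (X : Field d) :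
    ∃ Y : Field d, ∀ x, Y (f x) = mfderiv (𝓡 d) (𝓡 d) f x (X x) := by
  let Y : Field d := fun y => mfderiv (𝓡 d) (𝓡 d) f (f.symm y) (X (f.symm y))
  refine ⟨Y, fun x => ?_⟩
  have h : ∀ a : Sph d, a = x → (mfderiv (𝓡 d) (𝓡 d) f a (X a) : EuclideanSpace ℝ (Fin d))
      = mfderiv (𝓡 d) (𝓡 d) f x (X x) := by
    intro a ha
    subst ha
    rfl
  exact h _ (f.symm_apply_apply x)

theorem Equivalent.symm {d : ℕ} {V W : Submodule ℝ (Field d)} (h : Equivalent V W) :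
    Equivalent W V := by
  obtain ⟨f, hf, hVW⟩ := h
  refine ⟨f.symm, ?_, ?_⟩
  · intro y v w
    have h := hf (f.symm y) (mfderiv (𝓡 d) (𝓡 d) f.symm y v) (mfderiv (𝓡 d) (𝓡 d) f.symm y w)
    rw [mfderiv_apply_symm, mfderiv_apply_symm] at h
    exact h.symm.trans (roundMetric_congr (f.apply_symm_apply y) v w)
  · intro X
    constructor
    · intro hX
      obtain ⟨Y, hY⟩ := exists_push f X
      refine ⟨Y, (hVW Y).2 ⟨X, hX, hY⟩, fun y => ?_⟩
      obtain ⟨x, rfl⟩ : ∃ x, f x = y := ⟨f.symm y, f.apply_symm_apply y⟩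
      rw [hY, mfderiv_symm_apply]
      exact field_congr X (f.symm_apply_apply x)
    · rintro ⟨Y, hY, hXY⟩
      obtain ⟨Z, hZ, hYZ⟩ := (hVW Y).1 hY
      have : X = Z := by
        funext x
        have h := hXY (f x)
        rw [hYZ, mfderiv_symm_apply] at h
        exact (field_congr X (f.symm_apply_apply x)).symm.trans h
      rwa [this]

theorem Equivalent.trans {d : ℕ} {U V W : Submodule ℝ (Field d)} (h : Equivalent U V)
    (h' : Equivalent V W) : Equivalent U W := by
  obtain ⟨f, hf, hUV⟩ := h
  obtain ⟨g, hg, hVW⟩ := h'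
  have hd : ∀ x v, mfderiv (𝓡 d) (𝓡 d) (f.trans g) x v
      = mfderiv (𝓡 d) (𝓡 d) g (f x) (mfderiv (𝓡 d) (𝓡 d) f x v) := by
    intro x v
    have h1 : MDifferentiableAt (𝓡 d) (𝓡 d) f x := f.mdifferentiable (by simp) x
    have h2 : MDifferentiableAt (𝓡 d) (𝓡 d) g (f x) := g.mdifferentiable (by simp) _
    exact DFunLike.congr_fun (mfderiv_comp x h2 h1) v
  refine ⟨f.trans g, ?_, ?_⟩
  · intro x v w
    rw [hd, hd]
    exact (hg (f x) _ _).trans (hf x v w)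
  · intro Z
    rw [hVW]
    constructor
    · rintro ⟨Y, hY, hZ⟩
      obtain ⟨X, hX, hXY⟩ := (hUV Y).1 hY
      refine ⟨X, hX, fun x => ?_⟩
      rw [hd, ← hXY]
      exact hZ (f x)
    · rintro ⟨X, hX, hXZ⟩
      obtain ⟨Y, hY⟩ := exists_push f X
      refine ⟨Y, (hUV Y).2 ⟨X, hX, hY⟩, fun y => ?_⟩
      obtain ⟨x, rfl⟩ : ∃ x, f x = y := ⟨f.symm y, f.apply_symm_apply y⟩
      rw [hY, ← hd]
      exact hXZ x

/-- Equivalence, as an equivalence relation on the set of Clifford-Killing spaces `CK_l`. -/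
def ckSetoid (d l : ℕ) : Setoid {V : Submodule ℝ (Field d) // IsCK d l V} where
  r V W := Equivalent V.1 W.1
  iseqv := ⟨fun V => Equivalent.refl V.1, fun h => h.symm, fun h h' => h.trans h'⟩

/-- The set of equivalence classes of Clifford-Killing spaces `CK_l` on `S^d`. -/
abbrev CKClasses (d l : ℕ) : Type := Quotient (ckSetoid d l)

/-- All Clifford-Killing spaces `CK_l` on `S^d` are pairwise equivalent. -/
def AllEquivalent (d l : ℕ) : Prop :=
  ∀ V W : Submodule ℝ (Field d), IsCK d l V → IsCK d l W → Equivalent V W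

/-- The Radon-Hurwitz function: `ρ(m) = 8α + 2^β` for `m = 2^(4α+β) m'`, `0 ≤ β ≤ 3`, `m'` odd. -/
def radonHurwitz (m : ℕ) : ℕ := 8 * (padicValNat 2 m / 4) + 2 ^ (padicValNat 2 m % 4)

/-- `n₀(l) = 2^(4α+β)` for `8α + 2^(β-1) - 1 < l ≤ 8α + 2^β - 1`, `0 ≤ β ≤ 3`; that is,
`α = ⌊l/8⌋`, and `β = 0, 1, 2, 3` for `l` congruent modulo 8 to `0`; `1`; `2, 3`; `4, 5, 6, 7`. -/
def n₀ (l : ℕ) : ℕ :=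
  2 ^ (4 * (l / 8) +
    (if l % 8 = 0 then 0 else if l % 8 = 1 then 1 else if l % 8 ≤ 3 then 2 else 3))

/-- The Clifford algebra `Cl_l` of the negative definite form `-(y, y)` on `ℝ^l`, generated by
`e_1, …, e_l` with `e_i ^ 2 = -1` and `e_i e_j + e_j e_i = 0` for `i ≠ j`. -/
abbrev Cl (l : ℕ) : Type :=
  CliffordAlgebra (QuadraticMap.weightedSumSquares ℝ (fun _ : Fin l => (-1 : ℝ)))

end CliffordKilling

end

/-!
A Killing field on the sphere is the restriction of a skew-adjoint operator
(`IsKilling.exists_isSkew`): along a great circle `γ` the function `⟨X(γ), γ'⟩` is constant, which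
makes `⟨X(x), z⟩` skew in `x` and `z`. A Riemannian isometry of the sphere is the restriction of an
orthogonal transformation (`IsRiemannianIsometry.exists_linear`): its extension that is homogeneous
of degree one preserves distances, so that the Mazur-Ulam theorem applies. Hence Clifford-Killing
spaces up to equivalence are spaces of skew-adjoint multiples of isometries up to orthogonal
conjugacy, and such a space is spanned by a skew-adjoint Clifford family `J 0, …, J (l - 1)`, that
is, by anticommuting square roots of `-1` (`IsCliffordSpace.exists_isSkewClifford`).

Clifford families are studied through the traces of the words in the `J i`, without the structure
theory of Clifford algebras. Averaging over the words gives the dimension of the space of operators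
that intertwine two families (`finrank_intertwiners`), exactly as characters do for a finite group.
A nonzero intertwining operator is, on an eigenspace of `T* T`, a multiple of an isometry, so that
skew-adjoint families with the same traces are orthogonally equivalent
(`exists_linearIsometry_of_trace_eq`). Every nonempty word has trace zero, except for the volume
element, the product of all the generators, when `l ≡ 3` modulo `4`. In that case the volume element
is a central involution, with eigenspaces of dimensions `p * n₀ l` and `q * n₀ l`; its trace is
determined by the space that the `J i` span only up to sign, as the dimension of the commutant of
this space shows. So the classes correspond to unordered pairs `{p, q}` of sum `(d + 1) / n₀ l`
(`card_ckClasses`), and there is one class if `l` is not `3` modulo `4`.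

It remains to see that the dimensions of the Clifford modules are the multiples of `n₀ l`. A pair of
anticommuting generators whose squares are `-1` and `1` halves the dimension, and multiplication of
four generators by their product changes the signs of their squares; therefore eight generators
contribute a factor `16` (`n₀_dvd_finrank`). Conversely, models of dimension `n₀ l` are built from
the complex numbers and the quaternions by tensor products (`exists_model`). The numbers `l` for
which `n₀ l` divides `m` are those up to `radonHurwitz m - 1` (`n₀_dvd_iff`).
-/

noncomputable section

namespace CliffordKilling

/-! ### Killing fields are linear -/

section

variable {d : ℕ}

/-- Skew-adjoint endomorphisms of a real inner product space. -/
def IsSkew {E : Type*} [NormedAddCommGroup E] [InnerProductSpace ℝ E] (A : Module.End ℝ E) : Prop :=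
  ∀ x y, inner ℝ (A x) y = -inner ℝ x (A y)

theorem IsSkew.inner_self {E : Type*} [NormedAddCommGroup E] [InnerProductSpace ℝ E]
    {A : Module.End ℝ E} (hA : IsSkew A) (x : E) : inner ℝ x (A x) = 0 := by
  have h := hA x x
  rw [real_inner_comm] at h
  linarith

theorem isSkew_of_inner_self {E : Type*} [NormedAddCommGroup E] [InnerProductSpace ℝ E]
    {A : Module.End ℝ E} (hA : ∀ x, inner ℝ x (A x) = 0) : IsSkew A := by
  intro x y
  have h := hA (x + y)
  rw [map_add, inner_add_left, inner_add_right, inner_add_right, hA x, hA y,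
    real_inner_comm (A x) y] at h
  linarith

instance factFinrankAmb (d : ℕ) : Fact (Module.finrank ℝ (Amb d) = d + 1) :=
  ⟨finrank_euclideanSpace_fin⟩

theorem norm_coe_sph (x : Sph d) : ‖(x : Amb d)‖ = 1 := norm_eq_of_mem_sphere x

theorem inner_self_sph (x : Sph d) : inner ℝ (x : Amb d) (x : Amb d) = 1 := by
  rw [real_inner_self_eq_norm_sq, norm_coe_sph, one_pow]

theorem contMDiff_coe {m : ℕ∞ω} :
    ContMDiff (𝓡 d) 𝓘(ℝ, Amb d) m (fun y : Sph d => (y : Amb d)) :=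
  contMDiff_coe_sphere

theorem hasMFDerivAt_coe (x : Sph d) :
    HasMFDerivAt (𝓡 d) 𝓘(ℝ, Amb d) (fun y : Sph d => (y : Amb d)) x (incl x) :=
  ((contMDiff_coe (m := 1)).mdifferentiable one_ne_zero x).hasMFDerivAt

theorem incl_injective (x : Sph d) : Function.Injective (incl x) := by
  convert! injective_mvfderiv_subtypeVal_sphere (E := Amb d) (n := d) x

theorem range_incl (x : Sph d) : (incl x).range = (Submodule.span ℝ {(x : Amb d)})ᗮ := by
  convert! range_mvfderiv_subtypeVal (E := Amb d) (n := d) x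

theorem mem_range_incl {x : Sph d} {v : Amb d} :
    (∃ u, incl x u = v) ↔ inner ℝ (x : Amb d) v = 0 := by
  rw [← Submodule.mem_orthogonal_singleton_iff_inner_right, ← range_incl]
  rfl

theorem inner_incl (x : Sph d) (v : TangentSpace (𝓡 d) x) :
    inner ℝ (x : Amb d) (incl x v) = 0 := mem_range_incl.1 ⟨v, rfl⟩

/-- Points of the tangent bundle of the sphere are determined by their base points and by their
vectors in `ℝ^(d+1)`. -/
theorem tangentBundle_ext {p q : TangentBundle (𝓡 d) (Sph d)} (h : p.1 = q.1)
    (h' : incl p.1 p.2 = incl q.1 q.2) : p = q := by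
  obtain ⟨p, v⟩ := p
  obtain ⟨q, w⟩ := q
  dsimp only at h
  subst h
  exact congrArg _ (incl_injective p h')

theorem field_ext {X Y : Field d} (h : ambient X = ambient Y) : X = Y := by
  funext x
  exact incl_injective x (congrFun h x)

theorem inner_ambient (X : Field d) (x : Sph d) : inner ℝ (x : Amb d) (ambient X x) = 0 :=
  inner_incl x _

theorem IsKilling.contMDiff_ambient {X : Field d} (hX : IsKilling X) :
    ContMDiff (𝓡 d) 𝓘(ℝ, Amb d) ∞ (ambient X) := by
  have h1 : ContMDiff (𝓡 d).tangent 𝓘(ℝ, Amb d).tangent ∞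
      (tangentMap (𝓡 d) 𝓘(ℝ, Amb d) (fun y : Sph d => (y : Amb d))) :=
    (contMDiff_coe (m := ∞)).contMDiff_tangentMap (by simp)
  exact (contMDiff_snd_tangentBundle_modelSpace (Amb d) 𝓘(ℝ, Amb d)).comp (h1.comp hX.1)

/-- The differential at `x` of a vector field viewed as a function with values in `ℝ^(d+1)`. -/
def dAmbient (X : Field d) (x : Sph d) : TangentSpace (𝓡 d) x →L[ℝ] Amb d :=
  mfderiv (𝓡 d) 𝓘(ℝ, Amb d) (ambient X) x

theorem inner_covDeriv (X : Field d) (x : Sph d) (v w : TangentSpace (𝓡 d) x) :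
    inner ℝ (covDeriv X x v) (incl x w)
      = inner ℝ (dAmbient X x v) (incl x w) := by
  have hw : incl x w ∈ (Submodule.span ℝ {(x : Amb d)})ᗮ := by
    rw [Submodule.mem_orthogonal_singleton_iff_inner_right]
    exact inner_incl x w
  have h : covDeriv X x v = (Submodule.span ℝ {(x : Amb d)})ᗮ.starProjection (dAmbient X x v) :=
    rfl
  rw [h, Submodule.inner_starProjection_left_eq_right,
    Submodule.starProjection_eq_self_iff.2 hw]

/-- Along a curve `γ` on the sphere, the derivative of a Killing field is orthogonal to `γ'`: this
is the Killing equation for `v = w = γ'`. -/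
theorem IsKilling.inner_deriv_along {X : Field d} (hX : IsKilling X) {γ : ℝ → Amb d}
    (hγ : ContDiff ℝ ∞ γ) (hs : ∀ t, γ t ∈ Metric.sphere (0 : Amb d) 1) (t : ℝ) :
    ∃ D : Amb d, HasDerivAt (fun s => ambient X ⟨γ s, hs s⟩) D t ∧
      inner ℝ D (deriv γ t) = 0 := by
  have hc : ContMDiff 𝓘(ℝ, ℝ) (𝓡 d) ∞ (Set.codRestrict γ _ hs : ℝ → Sph d) :=
    ContMDiff.codRestrict_sphere hγ.contMDiff hs
  set c : ℝ → Sph d := Set.codRestrict γ _ hs with hcdef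
  have h1 := (hc.mdifferentiable (by simp) t).hasMFDerivAt
  have h2 := (hX.contMDiff_ambient.mdifferentiable (by simp) (c t)).hasMFDerivAt
  let c' : ℝ →L[ℝ] TangentSpace (𝓡 d) (c t) := mfderiv 𝓘(ℝ, ℝ) (𝓡 d) c t
  have h3' : HasFDerivAt (𝕜 := ℝ) (fun s => ambient X (c s)) (dAmbient X (c t) ∘L c') t :=
    (h2.comp t h1).hasFDerivAt
  have h4' : HasFDerivAt (𝕜 := ℝ) γ (incl (c t) ∘L c') t :=
    ((hasMFDerivAt_coe (c t)).comp t h1).hasFDerivAt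
  have h3 := h3'.hasDerivAt
  have h4 := h4'.hasDerivAt
  have h5 : deriv γ t = incl (c t) (c' 1) := h4.deriv
  refine ⟨_, h3, ?_⟩
  rw [h5]
  have h6 := hX.2 (c t) (c' 1) (c' 1)
  rw [real_inner_comm (covDeriv _ _ _) (incl _ _), inner_covDeriv] at h6
  have h7 : ∀ a : ℝ, a + a = 0 → a = 0 := fun a h => by linarith
  exact h7 _ h6

/-- A Killing field is skew: `⟨X(z), x⟩ = -⟨X(x), z⟩`. Along the great circle `γ` through `x` and
`z` the function `⟨X(γ), γ'⟩` is constant. -/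
theorem IsKilling.skew {X : Field d} (hX : IsKilling X) (x z : Sph d) :
    inner ℝ (ambient X z) (x : Amb d) = -inner ℝ (ambient X x) (z : Amb d) := by
  have hxx : inner ℝ (ambient X x) (x : Amb d) = 0 := by
    rw [real_inner_comm]; exact inner_ambient X x
  have hzz : inner ℝ (ambient X z) (z : Amb d) = 0 := by
    rw [real_inner_comm]; exact inner_ambient X z
  obtain ⟨a, ha⟩ : ∃ a : ℝ, a = inner ℝ (x : Amb d) (z : Amb d) := ⟨_, rfl⟩
  obtain ⟨w, hw⟩ : ∃ w : Amb d, w = z - a • (x : Amb d) := ⟨_, rfl⟩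
  have hz : (z : Amb d) = a • (x : Amb d) + w := by rw [hw]; abel
  have hxw : inner ℝ (x : Amb d) w = 0 := by
    rw [hw, inner_sub_right, inner_smul_right, inner_self_sph, ← ha]; ring
  have hnorm : a ^ 2 + ‖w‖ ^ 2 = 1 := by
    have h := inner_self_sph z
    rw [hz, inner_add_left, inner_add_right, inner_add_right, inner_smul_left, inner_smul_left,
      inner_smul_right, inner_smul_right, inner_self_sph, real_inner_comm (x : Amb d) w, hxw,
      real_inner_self_eq_norm_sq] at h
    simp only [RCLike.conj_to_real] at h
    linarith
  -- If `z = ±x`, there is no distinguished great circle, and both sides vanish.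
  by_cases hw0 : w = 0
  · rw [hw0, norm_zero] at hnorm
    rw [hw0, add_zero] at hz
    have ha0 : a ≠ 0 := fun h => by rw [h] at hnorm; norm_num at hnorm
    rw [hz, inner_smul_right, hxx, mul_zero, neg_zero]
    rw [hz, inner_smul_right] at hzz
    exact (mul_eq_zero.1 hzz).resolve_left ha0
  have hb : ‖w‖ ≠ 0 := norm_ne_zero_iff.2 hw0
  obtain ⟨y, hy⟩ : ∃ y : Amb d, y = ‖w‖⁻¹ • w := ⟨_, rfl⟩
  have hwy : w = ‖w‖ • y := by rw [hy, smul_smul, mul_inv_cancel₀ hb, one_smul]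
  have hyy : inner ℝ y y = 1 := by
    rw [hy, inner_smul_left, inner_smul_right, real_inner_self_eq_norm_sq]
    simp only [RCLike.conj_to_real]
    field_simp
  have hxy : inner ℝ (x : Amb d) y = 0 := by rw [hy, inner_smul_right, hxw, mul_zero]
  obtain ⟨t, hct, hst⟩ : ∃ t : ℝ, Real.cos t = a ∧ Real.sin t = ‖w‖ := by
    refine ⟨Real.arccos a, Real.cos_arccos ?_ ?_, ?_⟩
    · nlinarith [sq_nonneg ‖w‖]
    · nlinarith [sq_nonneg ‖w‖]
    · rw [Real.sin_arccos, ← Real.sqrt_sq (norm_nonneg w)]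
      congr 1
      linarith
  let γ : ℝ → Amb d := fun s => Real.cos s • (x : Amb d) + Real.sin s • y
  have hγ : ContDiff ℝ ∞ γ :=
    (Real.contDiff_cos.smul contDiff_const).add (Real.contDiff_sin.smul contDiff_const)
  have hs : ∀ s, γ s ∈ Metric.sphere (0 : Amb d) 1 := by
    intro s
    rw [mem_sphere_zero_iff_norm, ← sq_eq_sq₀ (norm_nonneg _) zero_le_one,
      ← real_inner_self_eq_norm_sq]
    simp only [γ, inner_add_left, inner_add_right, inner_smul_left, inner_smul_right,
      inner_self_sph, hyy, hxy, real_inner_comm (x : Amb d) y, RCLike.conj_to_real]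
    linear_combination Real.sin_sq_add_cos_sq s
  let γ' : ℝ → Amb d := fun s => (-Real.sin s) • (x : Amb d) + Real.cos s • y
  have hγ' : ∀ s, HasDerivAt γ (γ' s) s := fun s =>
    ((Real.hasDerivAt_cos s).smul_const _).add ((Real.hasDerivAt_sin s).smul_const _)
  have hγ'' : ∀ s, HasDerivAt γ' (-γ s) s := by
    intro s
    have h := ((Real.hasDerivAt_sin s).neg.smul_const (x : Amb d)).add
      ((Real.hasDerivAt_cos s).smul_const y)
    refine h.congr_deriv ?_
    simp only [γ]
    module
  -- `⟨X(γ), γ'⟩' = ⟨X(γ)', γ'⟩ - ⟨X(γ), γ⟩`: the first term vanishes by the Killing equation, the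
  -- second because `X` is tangent to the sphere.
  have hconst : ∀ s, HasDerivAt (fun s => inner ℝ (ambient X ⟨γ s, hs s⟩) (γ' s)) 0 s := by
    intro s
    obtain ⟨D, hD, hD0⟩ := hX.inner_deriv_along hγ hs s
    rw [(hγ' s).deriv] at hD0
    have h := hD.inner ℝ (hγ'' s)
    rw [hD0, inner_neg_right, real_inner_comm, inner_ambient X ⟨γ s, hs s⟩] at h
    simpa using h
  have hγt : (⟨γ t, hs t⟩ : Sph d) = z := by
    apply Subtype.ext
    rw [hz, hwy]
    simp only [γ]
    rw [hct, hst]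
  have hγ0 : (⟨γ 0, hs 0⟩ : Sph d) = x := by
    apply Subtype.ext
    simp [γ]
  have hfin := is_const_of_deriv_eq_zero (fun s => (hconst s).differentiableAt)
    (fun s => (hconst s).deriv) t 0
  rw [hγt, hγ0] at hfin
  simp only [γ', inner_add_right, inner_smul_right, hct, hst, Real.sin_zero, Real.cos_zero] at hfin
  have hz' : (z : Amb d) = a • (x : Amb d) + ‖w‖ • y := by rw [← hwy]; exact hz
  rw [hz', inner_add_right, inner_smul_right, inner_smul_right] at hzz
  rw [hz', inner_add_right, inner_smul_right, inner_smul_right, hxx]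
  rw [hxx] at hfin
  linear_combination (-‖w‖) * hfin + a * hzz -
    (inner ℝ (ambient X z) (x : Amb d)) * hnorm

theorem exists_sph_smul {x : Amb d} (hx : x ≠ 0) : ∃ u : Sph d, x = ‖x‖ • (u : Amb d) := by
  refine ⟨⟨‖x‖⁻¹ • x, ?_⟩, ?_⟩
  · rw [mem_sphere_zero_iff_norm, norm_smul, norm_inv, norm_norm,
      inv_mul_cancel₀ (norm_ne_zero_iff.2 hx)]
  · rw [smul_smul, mul_inv_cancel₀ (norm_ne_zero_iff.2 hx), one_smul]

theorem linearMap_eq_of_sph {A B : Module.End ℝ (Amb d)} (h : ∀ x : Sph d, A x = B x) : A = B := by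
  ext1 x
  by_cases hx : x = 0
  · rw [hx, map_zero, map_zero]
  · obtain ⟨u, hu⟩ := exists_sph_smul hx
    rw [hu, map_smul, map_smul, h]

/-- Killing fields are linear: by skewness, `⟨X(x), e_i⟩ = -⟨X(e_i), x⟩` for the standard basis
vectors `e_i`, and the right side is linear in `x`. -/
theorem IsKilling.exists_isSkew {X : Field d} (hX : IsKilling X) :
    ∃ A : Module.End ℝ (Amb d), IsSkew A ∧ ∀ x : Sph d, ambient X x = A x := by
  let b := EuclideanSpace.basisFun (Fin (d + 1)) ℝ
  let e : Fin (d + 1) → Sph d := fun i => ⟨b i, by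
    rw [mem_sphere_zero_iff_norm]; exact b.orthonormal.1 i⟩
  let A : Module.End ℝ (Amb d) :=
    ∑ i, (-(innerₛₗ ℝ (ambient X (e i)))).smulRight (b i)
  have hA : ∀ x : Sph d, ambient X x = A x := by
    intro x
    rw [← b.sum_repr' (ambient X x)]
    simp only [A, LinearMap.sum_apply, LinearMap.smulRight_apply, LinearMap.neg_apply]
    refine Finset.sum_congr rfl fun i _ => ?_
    rw [real_inner_comm]
    congr 1
    exact hX.skew (e i) x
  refine ⟨A, isSkew_of_inner_self fun x => ?_, hA⟩
  by_cases hx : x = 0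
  · rw [hx, inner_zero_left]
  · obtain ⟨u, hu⟩ := exists_sph_smul hx
    rw [hu, map_smul, inner_smul_left, inner_smul_right, ← hA, inner_ambient, mul_zero, mul_zero]

end

/-! ### Linear fields of constant length are Killing fields -/

section

variable {d : ℕ}

/-- Every skew-adjoint endomorphism restricts to a tangent vector field on the sphere. -/
theorem IsSkew.exists_field {A : Module.End ℝ (Amb d)} (hA : IsSkew A) :
    ∃ X : Field d, ∀ x : Sph d, ambient X x = A x := by
  choose X hX using fun x : Sph d => mem_range_incl.2 (hA.inner_self (x : Amb d))
  exact ⟨X, hX⟩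

/-- The flow lines of a constant length linear field are great circles; `cayleyFlow` follows them
in the rational parametrization, which has the same velocity at time `0`. -/
def cayleyFlow (A : Module.End ℝ (Amb d)) (c : ℝ) (p : Sph d × ℝ) : Amb d :=
  (4 + (p.2 * c) ^ 2)⁻¹ • ((4 - (p.2 * c) ^ 2) • (p.1 : Amb d) + (4 * p.2) • A p.1)

theorem cayleyFlow_mem {A : Module.End ℝ (Amb d)} (hA : IsSkew A) {c : ℝ}
    (hc : ∀ x, ‖A x‖ = c * ‖x‖) (p : Sph d × ℝ) :
    cayleyFlow A c p ∈ Metric.sphere (0 : Amb d) 1 := by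
  have h0 : (0 : ℝ) < 4 + (p.2 * c) ^ 2 := by positivity
  have h1 : inner ℝ (A (p.1 : Amb d)) (A p.1) = c ^ 2 := by
    rw [real_inner_self_eq_norm_sq, hc, norm_coe_sph, mul_one]
  rw [mem_sphere_zero_iff_norm, cayleyFlow, norm_smul, Real.norm_of_nonneg (inv_nonneg.2 h0.le),
    inv_mul_eq_one₀ h0.ne', eq_comm, ← sq_eq_sq₀ (norm_nonneg _) h0.le,
    ← real_inner_self_eq_norm_sq]
  simp only [inner_add_left, inner_add_right, inner_smul_left, inner_smul_right, inner_self_sph,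
    h1, hA.inner_self, real_inner_comm (p.1 : Amb d) (A _), RCLike.conj_to_real]
  ring

theorem contMDiff_cayleyFlow (A : Module.End ℝ (Amb d)) (c : ℝ) :
    ContMDiff ((𝓡 d).prod 𝓘(ℝ, ℝ)) 𝓘(ℝ, Amb d) ∞ (cayleyFlow (d := d) A c) := by
  have h1 : ContDiff ℝ ∞ (fun q : Amb d × ℝ =>
      (4 + (q.2 * c) ^ 2)⁻¹ • ((4 - (q.2 * c) ^ 2) • q.1 + (4 * q.2) • A q.1)) := by
    have hA : ContDiff ℝ ∞ (fun q : Amb d × ℝ => A q.1) :=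
      (LinearMap.toContinuousLinearMap A).contDiff.comp contDiff_fst
    have h2 : ContDiff ℝ ∞ (fun q : Amb d × ℝ => (4 + (q.2 * c) ^ 2)) := by fun_prop
    have h3 : ContDiff ℝ ∞ (fun q : Amb d × ℝ => (4 + (q.2 * c) ^ 2)⁻¹) :=
      h2.inv fun q => by positivity
    have h4 : ContDiff ℝ ∞ (fun q : Amb d × ℝ => (4 - (q.2 * c) ^ 2)) := by fun_prop
    have h5 : ContDiff ℝ ∞ (fun q : Amb d × ℝ => 4 * q.2) := by fun_prop
    exact h3.smul ((h4.smul contDiff_fst).add (h5.smul hA))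
  have h2 : ContMDiff ((𝓡 d).prod 𝓘(ℝ, ℝ)) 𝓘(ℝ, Amb d × ℝ) ∞
      (fun p : Sph d × ℝ => ((p.1 : Amb d), p.2)) :=
    (contMDiff_coe.comp contMDiff_fst).prodMk_space contMDiff_snd
  exact h1.contMDiff.comp h2

theorem hasDerivAt_cayleyFlow (A : Module.End ℝ (Amb d)) (c : ℝ) (x : Sph d) :
    HasDerivAt (fun t => cayleyFlow A c (x, t)) (A x) 0 := by
  have h0 : HasDerivAt (fun t : ℝ => (t * c) ^ 2) 0 0 := by
    exact (((hasDerivAt_id (0 : ℝ)).mul_const c).pow 2).congr_deriv (by simp)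
  have h1 : HasDerivAt (fun t : ℝ => (4 + (t * c) ^ 2)⁻¹) 0 0 := by
    exact ((h0.const_add 4).inv (by norm_num)).congr_deriv (by simp)
  have h2 : HasDerivAt (fun t : ℝ => (4 - (t * c) ^ 2) • (x : Amb d) + (4 * t) • A x)
      ((4 : ℝ) • A x) 0 := by
    exact (((h0.const_sub 4).smul_const (x : Amb d)).add
      (((hasDerivAt_id (0 : ℝ)).const_mul 4).smul_const (A x))).congr_deriv (by simp)
  have h := h1.smul h2
  refine h.congr_deriv ?_
  simp [smul_smul]

/-- A linear field of constant length is smooth as a section of the tangent bundle: it is the image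
of the constant field `(0, 1)` on `S^d × ℝ` under the tangent map of the smooth map `cayleyFlow`
into the sphere. -/
theorem contMDiff_of_ambient_linear {A : Module.End ℝ (Amb d)} (hA : IsSkew A) {c : ℝ}
    (hc : ∀ x, ‖A x‖ = c * ‖x‖) {X : Field d} (hX : ∀ x : Sph d, ambient X x = A x) :
    ContMDiff (𝓡 d) ((𝓡 d).tangent) ∞ (fun x => (⟨x, X x⟩ : TangentBundle (𝓡 d) (Sph d))) := by
  let Φ : Sph d × ℝ → Sph d := Set.codRestrict (cayleyFlow A c) _ (cayleyFlow_mem hA hc)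
  have hΦ : ContMDiff ((𝓡 d).prod 𝓘(ℝ, ℝ)) (𝓡 d) ∞ Φ :=
    ContMDiff.codRestrict_sphere (contMDiff_cayleyFlow A c) _
  let F₁ : Sph d → TangentBundle (𝓡 d) (Sph d) × TangentBundle 𝓘(ℝ, ℝ) ℝ :=
    fun x => (⟨x, 0⟩, ⟨0, (1 : ℝ)⟩)
  have h1 : ContMDiff (𝓡 d) ((𝓡 d).tangent.prod 𝓘(ℝ, ℝ).tangent) ∞ F₁ :=
    (Bundle.contMDiff_zeroSection ℝ (TangentSpace (𝓡 d))).prodMk contMDiff_const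
  have h2 : ContMDiff ((𝓡 d).tangent.prod 𝓘(ℝ, ℝ).tangent) ((𝓡 d).prod 𝓘(ℝ, ℝ)).tangent ∞
      (equivTangentBundleProd (𝓡 d) (Sph d) 𝓘(ℝ, ℝ) ℝ).symm :=
    contMDiff_equivTangentBundleProd_symm
  have h3 : ContMDiff ((𝓡 d).prod 𝓘(ℝ, ℝ)).tangent (𝓡 d).tangent ∞
      (tangentMap ((𝓡 d).prod 𝓘(ℝ, ℝ)) (𝓡 d) Φ) := hΦ.contMDiff_tangentMap (by simp)
  convert (h3.comp h2).comp h1 using 1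
  funext x
  have hx0 : Φ (x, 0) = x := by
    apply Subtype.ext
    simp [Φ, cayleyFlow]
  refine tangentBundle_ext hx0.symm ?_
  have hM := ((contMDiff_cayleyFlow A c).mdifferentiable (by simp) (x, 0))
  have hcurve : HasMFDerivAt 𝓘(ℝ, ℝ) ((𝓡 d).prod 𝓘(ℝ, ℝ)) (fun t : ℝ => (x, t)) 0
      (ContinuousLinearMap.prod (0 : ℝ →L[ℝ] TangentSpace (𝓡 d) x)
        (ContinuousLinearMap.id ℝ ℝ)) :=
    (hasMFDerivAt_const x (0 : ℝ)).prodMk (hasMFDerivAt_id (0 : ℝ))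
  let L : TangentSpace (𝓡 d) x × ℝ →L[ℝ] Amb d :=
    mfderiv ((𝓡 d).prod 𝓘(ℝ, ℝ)) 𝓘(ℝ, Amb d) (cayleyFlow (d := d) A c) (x, 0)
  have h4 : HasFDerivAt (𝕜 := ℝ) (fun t => cayleyFlow A c (x, t))
      (L ∘L ContinuousLinearMap.prod (0 : ℝ →L[ℝ] TangentSpace (𝓡 d) x)
        (ContinuousLinearMap.id ℝ ℝ)) 0 :=
    (hM.hasMFDerivAt.comp (0 : ℝ) hcurve).hasFDerivAt
  have h5 : L (0, 1) = A x :=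
    (DFunLike.congr_fun (h4.unique (hasDerivAt_cayleyFlow A c x).hasFDerivAt) (1 : ℝ)).trans
      (one_smul ℝ (A x))
  have h7 := (hasMFDerivAt_coe (Φ (x, 0))).comp (x, 0)
    (hΦ.mdifferentiable (by simp) (x, 0)).hasMFDerivAt
  have h8 := h7.mfderiv
  have h9 := DFunLike.congr_fun h8 ((0 : TangentSpace (𝓡 d) x), (1 : ℝ))
  have h10 : ambient X x = A x := hX x
  exact h10.trans (h5.symm.trans h9)

theorem isKilling_of_linear {A : Module.End ℝ (Amb d)} (hA : IsSkew A) {c : ℝ}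
    (hc : ∀ x, ‖A x‖ = c * ‖x‖) {X : Field d} (hX : ∀ x : Sph d, ambient X x = A x) :
    IsKilling X := by
  refine ⟨contMDiff_of_ambient_linear hA hc hX, fun x v w => ?_⟩
  have h : ∀ v, dAmbient X x v = A (incl x v) := by
    intro v
    have h1 : ambient X = fun y : Sph d => LinearMap.toContinuousLinearMap A (y : Amb d) :=
      funext hX
    have h2 : HasMFDerivAt (𝓡 d) 𝓘(ℝ, Amb d) (ambient X) x
        ((LinearMap.toContinuousLinearMap A) ∘L incl x) := by
      rw [h1]
      exact (LinearMap.toContinuousLinearMap A).hasFDerivAt.hasMFDerivAt.comp x (hasMFDerivAt_coe x)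
    exact DFunLike.congr_fun h2.mfderiv v
  rw [inner_covDeriv, real_inner_comm (covDeriv X x w), inner_covDeriv, h, h, hA,
    real_inner_comm (A _) (incl x v)]
  ring

theorem hasConstantLength_iff {A : Module.End ℝ (Amb d)} {X : Field d}
    (hX : ∀ x : Sph d, ambient X x = A x) :
    HasConstantLength X ↔ ∃ c : ℝ, ∀ x, ‖A x‖ = c * ‖x‖ := by
  have h : ∀ x : Sph d, Real.sqrt (roundMetric x (X x) (X x)) = ‖A x‖ := by
    intro x
    rw [← hX x]
    exact (norm_eq_sqrt_real_inner (ambient X x)).symm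
  constructor
  · rintro ⟨c, hc⟩
    refine ⟨c, fun x => ?_⟩
    by_cases hx : x = 0
    · rw [hx, map_zero, norm_zero, mul_zero]
    · obtain ⟨u, hu⟩ := exists_sph_smul hx
      conv_lhs => rw [hu]
      rw [map_smul, norm_smul, ← h, hc, norm_norm, mul_comm]
  · rintro ⟨c, hc⟩
    exact ⟨c, fun x => by rw [h, hc, norm_coe_sph, mul_one]⟩

end

/-! ### Isometries of the sphere are orthogonal transformations -/

section

variable {d : ℕ}

theorem incl_mfderiv_of_linear (f : Diffeomorph (𝓡 d) (𝓡 d) (Sph d) (Sph d) ∞)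
    (A : Amb d ≃ₗᵢ[ℝ] Amb d) (h : ∀ x, (f x : Amb d) = A x) (x : Sph d)
    (v : TangentSpace (𝓡 d) x) :
    incl (f x) (mfderiv (𝓡 d) (𝓡 d) f x v) = A (incl x v) := by
  have h1 := (hasMFDerivAt_coe (f x)).comp x (f.mdifferentiable (by simp) x).hasMFDerivAt
  have h2 : HasMFDerivAt (𝓡 d) 𝓘(ℝ, Amb d) (fun y : Sph d => A (y : Amb d)) x
      ((A.toContinuousLinearEquiv : Amb d →L[ℝ] Amb d) ∘L incl x) :=
    (A.toContinuousLinearEquiv : Amb d →L[ℝ] Amb d).hasFDerivAt.hasMFDerivAt.comp x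
      (hasMFDerivAt_coe x)
  have h3 : (fun y : Sph d => A (y : Amb d)) = (fun y : Sph d => (y : Amb d)) ∘ f :=
    funext fun y => (h y).symm
  rw [h3] at h2
  exact DFunLike.congr_fun (hasMFDerivAt_unique h1 h2) v

theorem isRiemannianIsometry_of_linear (f : Diffeomorph (𝓡 d) (𝓡 d) (Sph d) (Sph d) ∞)
    (A : Amb d ≃ₗᵢ[ℝ] Amb d) (h : ∀ x, (f x : Amb d) = A x) : IsRiemannianIsometry f := by
  intro x v w
  unfold roundMetric
  rw [incl_mfderiv_of_linear f A h, incl_mfderiv_of_linear f A h, A.inner_map_map]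

theorem pushesTo_iff_of_linear (f : Diffeomorph (𝓡 d) (𝓡 d) (Sph d) (Sph d) ∞)
    (A : Amb d ≃ₗᵢ[ℝ] Amb d) (h : ∀ x, (f x : Amb d) = A x) (V W : Submodule ℝ (Field d)) :
    PushesTo f V W ↔ ∀ Y : Field d, Y ∈ W ↔
      ∃ X ∈ V, ∀ x y : Sph d, (y : Amb d) = A x → ambient Y y = A (ambient X x) := by
  refine forall_congr' fun Y => iff_congr Iff.rfl (exists_congr fun X => and_congr Iff.rfl ?_)
  constructor
  · intro hXY x y hy
    obtain rfl : y = f x := Subtype.ext (hy.trans (h x).symm)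
    unfold ambient
    rw [hXY x, incl_mfderiv_of_linear f A h]
  · intro hXY x
    apply incl_injective
    rw [incl_mfderiv_of_linear f A h]
    exact hXY x (f x) (h x)

theorem map_mem_sphere (A : Amb d ≃ₗᵢ[ℝ] Amb d) (x : Sph d) :
    A (x : Amb d) ∈ Metric.sphere (0 : Amb d) 1 := by
  rw [mem_sphere_zero_iff_norm, A.norm_map, norm_coe_sph]

theorem contMDiff_codRestrict_linear (A : Amb d ≃ₗᵢ[ℝ] Amb d) :
    ContMDiff (𝓡 d) (𝓡 d) ∞
      (Set.codRestrict (fun x : Sph d => A (x : Amb d)) _ (map_mem_sphere A) : Sph d → Sph d) := by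
  have h : ContMDiff (𝓡 d) 𝓘(ℝ, Amb d) ∞ (fun x : Sph d => A (x : Amb d)) :=
    A.toContinuousLinearEquiv.contDiff.contMDiff.comp contMDiff_coe
  exact ContMDiff.codRestrict_sphere h _

/-- An orthogonal transformation, restricted to the sphere. -/
def sphereDiffeomorph (A : Amb d ≃ₗᵢ[ℝ] Amb d) :
    Diffeomorph (𝓡 d) (𝓡 d) (Sph d) (Sph d) ∞ where
  toFun := Set.codRestrict (fun x : Sph d => A (x : Amb d)) _ (map_mem_sphere A)
  invFun := Set.codRestrict (fun x : Sph d => A.symm (x : Amb d)) _ (map_mem_sphere A.symm)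
  left_inv x := Subtype.ext (A.symm_apply_apply x)
  right_inv x := Subtype.ext (A.apply_symm_apply x)
  contMDiff_toFun := contMDiff_codRestrict_linear A
  contMDiff_invFun := contMDiff_codRestrict_linear A.symm

theorem IsRiemannianIsometry.symm {f : Diffeomorph (𝓡 d) (𝓡 d) (Sph d) (Sph d) ∞}
    (hf : IsRiemannianIsometry f) : IsRiemannianIsometry f.symm := by
  intro y v w
  have h := hf (f.symm y) (mfderiv (𝓡 d) (𝓡 d) f.symm y v) (mfderiv (𝓡 d) (𝓡 d) f.symm y w)
  rw [mfderiv_apply_symm, mfderiv_apply_symm] at h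
  exact h.symm.trans (roundMetric_congr (f.apply_symm_apply y) v w)

/-- The radial projection to the sphere of a nonzero vector. -/
def radial (x : Amb d) (hx : x ≠ 0) : Sph d :=
  ⟨‖x‖⁻¹ • x, by
    rw [mem_sphere_zero_iff_norm, norm_smul, norm_inv, norm_norm,
      inv_mul_cancel₀ (norm_ne_zero_iff.2 hx)]⟩

open Classical in
/-- The extension of a self-map of the sphere that is homogeneous of degree one. -/
def homogExt (f : Sph d → Sph d) (x : Amb d) : Amb d :=
  if hx : x = 0 then 0 else ‖x‖ • (f (radial x hx) : Amb d)

theorem homogExt_zero (f : Sph d → Sph d) : homogExt f 0 = 0 := by simp [homogExt]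

theorem homogExt_of_ne (f : Sph d → Sph d) {x : Amb d} (hx : x ≠ 0) :
    homogExt f x = ‖x‖ • (f (radial x hx) : Amb d) := by simp [homogExt, hx]

theorem homogExt_smul_sph (f : Sph d → Sph d) {r : ℝ} (hr : 0 ≤ r) (x : Sph d) :
    homogExt f (r • (x : Amb d)) = r • (f x : Amb d) := by
  rcases hr.eq_or_lt with rfl | hr
  · rw [zero_smul, zero_smul, homogExt_zero]
  · have hn : ‖r • (x : Amb d)‖ = r := by
      rw [norm_smul, norm_coe_sph, mul_one, Real.norm_of_nonneg hr.le]
    have h0 : r • (x : Amb d) ≠ 0 := by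
      rw [← norm_ne_zero_iff, hn]; exact hr.ne'
    have h1 : radial _ h0 = x := by
      apply Subtype.ext
      simp only [radial]
      rw [hn, smul_smul, inv_mul_cancel₀ hr.ne', one_smul]
    rw [homogExt_of_ne f h0, h1, hn]

theorem norm_homogExt (f : Sph d → Sph d) (x : Amb d) : ‖homogExt f x‖ = ‖x‖ := by
  by_cases hx : x = 0
  · rw [hx, homogExt_zero, norm_zero]
  · rw [homogExt_of_ne f hx, norm_smul, norm_norm, norm_coe_sph, mul_one]

theorem homogExt_homogExt {f g : Sph d → Sph d} (h : ∀ x, g (f x) = x) (x : Amb d) :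
    homogExt g (homogExt f x) = x := by
  by_cases hx : x = 0
  · rw [hx, homogExt_zero, homogExt_zero]
  · obtain ⟨u, hu⟩ := exists_sph_smul hx
    rw [hu, homogExt_smul_sph f (norm_nonneg _), homogExt_smul_sph g (norm_nonneg _), h]

/-- Along a straight line that avoids the origin, the homogeneous extension of a Riemannian
isometry preserves speed. -/
theorem IsRiemannianIsometry.hasDerivAt_homogExt
    {f : Diffeomorph (𝓡 d) (𝓡 d) (Sph d) (Sph d) ∞} (hf : IsRiemannianIsometry f)
    {x v : Amb d} (h0 : ∀ s : ℝ, x + s • v ≠ 0) (s : ℝ) :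
    ∃ D, HasDerivAt (fun s : ℝ => homogExt f (x + s • v)) D s ∧ ‖D‖ = ‖v‖ := by
  let γ : ℝ → Amb d := fun s => x + s • v
  have hγ : ContDiff ℝ ∞ γ := contDiff_const.add (contDiff_id.smul contDiff_const)
  have hr : ContDiff ℝ ∞ (fun s => ‖γ s‖) := hγ.norm ℝ h0
  have hu : ContDiff ℝ ∞ (fun s => ‖γ s‖⁻¹ • γ s) :=
    (hr.inv fun s => norm_ne_zero_iff.2 (h0 s)).smul hγ
  have hs : ∀ s, ‖γ s‖⁻¹ • γ s ∈ Metric.sphere (0 : Amb d) 1 := fun s => (radial _ (h0 s)).2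
  have hc : ContMDiff 𝓘(ℝ, ℝ) (𝓡 d) ∞
      (Set.codRestrict (fun s => ‖γ s‖⁻¹ • γ s) _ hs : ℝ → Sph d) :=
    ContMDiff.codRestrict_sphere hu.contMDiff hs
  set c : ℝ → Sph d := Set.codRestrict (fun s => ‖γ s‖⁻¹ • γ s) _ hs with hcdef
  have h1 := (hc.mdifferentiable (by simp) s).hasMFDerivAt
  have h2 := (f.mdifferentiable (by simp) (c s)).hasMFDerivAt
  let c' : ℝ →L[ℝ] TangentSpace (𝓡 d) (c s) := mfderiv 𝓘(ℝ, ℝ) (𝓡 d) c s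
  let f' : TangentSpace (𝓡 d) (c s) →L[ℝ] TangentSpace (𝓡 d) (f (c s)) :=
    mfderiv (𝓡 d) (𝓡 d) f (c s)
  have h3' : HasFDerivAt (𝕜 := ℝ) (fun s => (f (c s) : Amb d)) (incl (f (c s)) ∘L (f' ∘L c')) s :=
    ((hasMFDerivAt_coe (f (c s))).comp s (h2.comp s h1)).hasFDerivAt
  have h4' : HasFDerivAt (𝕜 := ℝ) (fun s => (c s : Amb d)) (incl (c s) ∘L c') s :=
    ((hasMFDerivAt_coe (c s)).comp s h1).hasFDerivAt
  have h3 : HasDerivAt (fun s => (f (c s) : Amb d)) (incl (f (c s)) (f' (c' 1))) s :=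
    h3'.hasDerivAt
  have h4 : HasDerivAt (fun s => (c s : Amb d)) (incl (c s) (c' 1)) s := h4'.hasDerivAt
  obtain ⟨r', hr'⟩ : ∃ r', HasDerivAt (fun s => ‖γ s‖) r' s :=
    ⟨_, (hr.differentiable (by simp) s).hasDerivAt⟩
  have h5 := hr'.smul h3
  have h6 := hr'.smul h4
  have h7 : (fun s => ‖γ s‖) • (fun s => (c s : Amb d)) = γ := by
    funext s
    change ‖γ s‖ • (‖γ s‖⁻¹ • γ s) = γ s
    rw [smul_smul, mul_inv_cancel₀ (norm_ne_zero_iff.2 (h0 s)), one_smul]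
  have h8 : (fun s => ‖γ s‖) • (fun s => (f (c s) : Amb d)) = fun s => homogExt f (γ s) := by
    funext s
    rw [homogExt_of_ne f (h0 s)]
    rfl
  have h9 : HasDerivAt γ v s := by
    have h := ((hasDerivAt_id s).smul_const v).const_add x
    rw [one_smul] at h
    exact h
  rw [h7] at h6
  rw [h8] at h5
  refine ⟨_, h5, ?_⟩
  rw [h9.unique h6, ← sq_eq_sq₀ (norm_nonneg _) (norm_nonneg _), ← real_inner_self_eq_norm_sq,
    ← real_inner_self_eq_norm_sq]
  -- Radial and tangential velocities are orthogonal, and `f` preserves the length of both.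
  have h10 : inner ℝ (incl (f (c s)) (f' (c' 1))) (incl (f (c s)) (f' (c' 1)))
      = inner ℝ (incl (c s) (c' 1)) (incl (c s) (c' 1)) := hf (c s) (c' 1) (c' 1)
  simp only [inner_add_left, inner_add_right, inner_smul_left, inner_smul_right, inner_self_sph,
    inner_incl, h10, real_inner_comm (_ : Amb d) (incl _ _), RCLike.conj_to_real]

/-- The homogeneous extension of a Riemannian isometry does not increase distances. -/
theorem IsRiemannianIsometry.dist_homogExt_le
    {f : Diffeomorph (𝓡 d) (𝓡 d) (Sph d) (Sph d) ∞} (hf : IsRiemannianIsometry f)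
    (x y : Amb d) : ‖homogExt f y - homogExt f x‖ ≤ ‖y - x‖ := by
  by_cases h0 : ∀ s : ℝ, x + s • (y - x) ≠ 0
  · choose D hD hDn using hf.hasDerivAt_homogExt h0
    have h := norm_image_sub_le_of_norm_deriv_le_segment' (a := 0) (b := 1)
      (fun s _ => (hD s).hasDerivWithinAt) (fun s _ => (hDn s).le) 1 (by simp)
    simpa using h
  push Not at h0
  obtain ⟨s, hs⟩ := h0
  -- The line through `x` and `y` meets the origin, so `y` is a multiple of `x`.
  by_cases hx : x = 0
  · rw [hx, homogExt_zero, sub_zero, sub_zero, norm_homogExt]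
  have hs0 : s ≠ 0 := fun h => hx (by rw [h, zero_smul, add_zero] at hs; exact hs)
  obtain ⟨k, hk⟩ : ∃ k : ℝ, y = k • x := by
    refine ⟨1 - s⁻¹, ?_⟩
    have h : s • y = (s - 1) • x := by
      rw [smul_sub] at hs
      rw [sub_smul, one_smul, ← sub_eq_zero, ← hs]
      abel
    rw [← one_smul ℝ y, ← inv_mul_cancel₀ hs0, mul_smul, h, smul_smul, mul_sub,
      inv_mul_cancel₀ hs0, mul_one]
  rcases le_or_gt 0 k with hk0 | hk0
  · obtain ⟨u, hu⟩ := exists_sph_smul hx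
    have hy : y = (k * ‖x‖) • (u : Amb d) := by rw [mul_smul, ← hu, hk]
    have h1 : homogExt f x = ‖x‖ • (f u : Amb d) := by
      conv_lhs => rw [hu]
      rw [homogExt_smul_sph f (norm_nonneg _)]
    have h2 : homogExt f y = (k * ‖x‖) • (f u : Amb d) := by
      rw [hy, homogExt_smul_sph f (by positivity)]
    have h3 : y - x = (k * ‖x‖ - ‖x‖) • (u : Amb d) := by
      rw [sub_smul, ← hy, ← hu]
    rw [h1, h2, h3, ← sub_smul, norm_smul, norm_smul, norm_coe_sph, norm_coe_sph]
  · refine (norm_sub_le _ _).trans ?_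
    rw [norm_homogExt, norm_homogExt]
    have h1 : y - x = (k - 1) • x := by rw [sub_smul, one_smul, hk]
    rw [h1, hk, norm_smul, norm_smul, Real.norm_of_nonpos hk0.le,
      Real.norm_of_nonpos (by linarith)]
    apply le_of_eq
    ring

/-- Riemannian isometries of the round sphere are restrictions of orthogonal transformations. -/
theorem IsRiemannianIsometry.exists_linear
    {f : Diffeomorph (𝓡 d) (𝓡 d) (Sph d) (Sph d) ∞} (hf : IsRiemannianIsometry f) :
    ∃ A : Amb d ≃ₗᵢ[ℝ] Amb d, ∀ x, (f x : Amb d) = A x := by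
  have h1 : ∀ x, homogExt f.symm (homogExt f x) = x :=
    homogExt_homogExt fun x => f.symm_apply_apply x
  have h2 : ∀ x, homogExt f (homogExt f.symm x) = x :=
    homogExt_homogExt fun x => f.apply_symm_apply x
  -- A surjective isometry that fixes the origin is linear, by the Mazur-Ulam theorem.
  let F : Amb d ≃ᵢ Amb d :=
    { toFun := homogExt f
      invFun := homogExt f.symm
      left_inv := h1
      right_inv := h2
      isometry_toFun := by
        refine Isometry.of_dist_eq fun x y => ?_
        rw [dist_eq_norm, dist_eq_norm]
        refine le_antisymm (hf.dist_homogExt_le y x) ?_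
        have h := hf.symm.dist_homogExt_le (homogExt f y) (homogExt f x)
        rwa [h1, h1] at h }
  refine ⟨F.toRealLinearIsometryEquivOfMapZero (homogExt_zero _), fun x => ?_⟩
  have h := homogExt_smul_sph f zero_le_one x
  rw [one_smul, one_smul] at h
  exact h.symm

theorem equivalent_iff_orthogonallyEquivalent (V W : Submodule ℝ (Field d)) :
    Equivalent V W ↔ OrthogonallyEquivalent V W := by
  constructor
  · rintro ⟨f, hf, hVW⟩
    obtain ⟨A, hA⟩ := hf.exists_linear
    exact ⟨A, (pushesTo_iff_of_linear f A hA V W).1 hVW⟩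
  · rintro ⟨A, hA⟩
    have h : ∀ x, (sphereDiffeomorph A x : Amb d) = A x := fun x => rfl
    exact ⟨sphereDiffeomorph A, isRiemannianIsometry_of_linear _ A h,
      (pushesTo_iff_of_linear _ A h V W).2 hA⟩

end

/-! ### Clifford-Killing spaces as spaces of operators -/

section

variable {d : ℕ}

/-- Linear spaces of skew-adjoint endomorphisms that are multiples of isometries: the algebraic
counterpart of Clifford-Killing spaces. -/
def IsCliffordSpace {E : Type*} [NormedAddCommGroup E] [InnerProductSpace ℝ E] (l : ℕ)
    (U : Submodule ℝ (Module.End ℝ E)) : Prop :=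
  Module.finrank ℝ U = l ∧ ∀ A ∈ U, IsSkew A ∧ ∃ c : ℝ, ∀ x, ‖A x‖ = c * ‖x‖

/-- The spaces `U` and `U'` are conjugate under the orthogonal group. -/
def IsOrthConj {E : Type*} [NormedAddCommGroup E] [InnerProductSpace ℝ E]
    (U U' : Submodule ℝ (Module.End ℝ E)) : Prop :=
  ∃ A : E ≃ₗᵢ[ℝ] E, ∀ B : Module.End ℝ E, B ∈ U' ↔
    (A.symm.toLinearEquiv : E →ₗ[ℝ] E) ∘ₗ B ∘ₗ (A.toLinearEquiv : E →ₗ[ℝ] E) ∈ U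

/-- `ambient` as a linear map. -/
def ambientL (d : ℕ) : Field d →ₗ[ℝ] (Sph d → Amb d) where
  toFun := ambient
  map_add' X Y := funext fun x => map_add (incl x) (X x) (Y x)
  map_smul' c X := funext fun x => map_smul (incl x) c (X x)

theorem ambientL_injective : Function.Injective (ambientL d) := fun _ _ h => field_ext h

/-- Restriction of endomorphisms to the sphere. -/
def restrictSph (d : ℕ) : Module.End ℝ (Amb d) →ₗ[ℝ] (Sph d → Amb d) where
  toFun A x := A x
  map_add' _ _ := rfl
  map_smul' _ _ := rfl

theorem restrictSph_injective : Function.Injective (restrictSph d) := fun _ _ h =>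
  linearMap_eq_of_sph fun x => congrFun h x

/-- The space of endomorphisms whose restrictions to the sphere are the members of `V`. -/
def opSpace (V : Submodule ℝ (Field d)) : Submodule ℝ (Module.End ℝ (Amb d)) :=
  (V.map (ambientL d)).comap (restrictSph d)

/-- The space of vector fields that are restrictions of the members of `U`. -/
def fieldSpace (U : Submodule ℝ (Module.End ℝ (Amb d))) : Submodule ℝ (Field d) :=
  (U.map (restrictSph d)).comap (ambientL d)

theorem mem_opSpace {V : Submodule ℝ (Field d)} {A : Module.End ℝ (Amb d)} :
    A ∈ opSpace V ↔ ∃ X ∈ V, ∀ x : Sph d, ambient X x = A x := by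
  simp only [opSpace, Submodule.mem_comap, Submodule.mem_map]
  exact exists_congr fun X => and_congr Iff.rfl funext_iff

theorem mem_fieldSpace {U : Submodule ℝ (Module.End ℝ (Amb d))} {X : Field d} :
    X ∈ fieldSpace U ↔ ∃ A ∈ U, ∀ x : Sph d, ambient X x = A x := by
  simp only [fieldSpace, Submodule.mem_comap, Submodule.mem_map]
  refine exists_congr fun A => and_congr Iff.rfl ?_
  rw [eq_comm]
  exact funext_iff

theorem IsCK.exists_mem_opSpace {l : ℕ} {V : Submodule ℝ (Field d)} (hV : IsCK d l V)
    {X : Field d} (hX : X ∈ V) :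
    ∃ A ∈ opSpace V, ∀ x : Sph d, ambient X x = A x := by
  obtain ⟨A, -, hA⟩ := (hV.2.2 X hX).1.exists_isSkew
  exact ⟨A, mem_opSpace.2 ⟨X, hX, hA⟩, hA⟩

theorem IsCK.isSkew {l : ℕ} {V : Submodule ℝ (Field d)} (hV : IsCK d l V)
    {A : Module.End ℝ (Amb d)} (hA : A ∈ opSpace V) : IsSkew A := by
  obtain ⟨X, hX, hXA⟩ := mem_opSpace.1 hA
  obtain ⟨B, hB, hXB⟩ := (hV.2.2 X hX).1.exists_isSkew
  rwa [linearMap_eq_of_sph fun x => (hXA x).symm.trans (hXB x)]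

theorem IsCK.isCliffordSpace {l : ℕ} {V : Submodule ℝ (Field d)} (hV : IsCK d l V) :
    IsCliffordSpace l (opSpace V) := by
  constructor
  · have h : (opSpace V).map (restrictSph d) = V.map (ambientL d) := by
      rw [opSpace, Submodule.map_comap_eq, inf_eq_right]
      rintro _ ⟨X, hX, rfl⟩
      obtain ⟨A, -, hA⟩ := hV.exists_mem_opSpace hX
      exact ⟨A, (funext hA).symm⟩
    rw [(Submodule.equivMapOfInjective _ restrictSph_injective (opSpace V)).finrank_eq, h,
      ← LinearEquiv.finrank_eq (Submodule.equivMapOfInjective _ ambientL_injective V), hV.2.1]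
  · intro A hA
    refine ⟨hV.isSkew hA, ?_⟩
    obtain ⟨X, hX, hXA⟩ := mem_opSpace.1 hA
    exact (hasConstantLength_iff hXA).1 (hV.2.2 X hX).2

theorem opSpace_fieldSpace {U : Submodule ℝ (Module.End ℝ (Amb d))} (hU : ∀ A ∈ U, IsSkew A) :
    opSpace (fieldSpace U) = U := by
  ext A
  rw [mem_opSpace]
  constructor
  · rintro ⟨X, hX, hXA⟩
    obtain ⟨B, hB, hXB⟩ := mem_fieldSpace.1 hX
    rwa [linearMap_eq_of_sph fun x => (hXA x).symm.trans (hXB x)]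
  · intro hA
    obtain ⟨X, hX⟩ := (hU A hA).exists_field
    exact ⟨X, mem_fieldSpace.2 ⟨A, hA, hX⟩, hX⟩

/-- Every Clifford space of operators restricts to a Clifford-Killing space. -/
theorem IsCliffordSpace.isCK {l : ℕ} (hl : 1 ≤ l) {U : Submodule ℝ (Module.End ℝ (Amb d))}
    (hU : IsCliffordSpace l U) : IsCK d l (fieldSpace U) := by
  refine ⟨hl, ?_, fun X hX => ?_⟩
  · have h : (fieldSpace U).map (ambientL d) = U.map (restrictSph d) := by
      rw [fieldSpace, Submodule.map_comap_eq, inf_eq_right]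
      rintro _ ⟨A, hA, rfl⟩
      obtain ⟨X, hX⟩ := (hU.2 A hA).1.exists_field
      exact ⟨X, funext hX⟩
    rw [LinearEquiv.finrank_eq (Submodule.equivMapOfInjective _ ambientL_injective (fieldSpace U)),
      h, ← (Submodule.equivMapOfInjective _ restrictSph_injective U).finrank_eq, hU.1]
  · obtain ⟨A, hA, hXA⟩ := mem_fieldSpace.1 hX
    obtain ⟨hs, c, hc⟩ := hU.2 A hA
    exact ⟨isKilling_of_linear hs hc hXA, (hasConstantLength_iff hXA).2 ⟨c, hc⟩⟩

/-- Equivalence of Clifford-Killing spaces is orthogonal conjugacy of the spaces of operators. -/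
theorem IsCK.equivalent_iff {l m : ℕ} {V W : Submodule ℝ (Field d)} (hV : IsCK d l V)
    (hW : IsCK d m W) : Equivalent V W ↔ IsOrthConj (opSpace V) (opSpace W) := by
  rw [equivalent_iff_orthogonallyEquivalent]
  refine exists_congr fun A => ?_
  constructor
  · intro h B
    constructor
    · intro hB
      obtain ⟨Y, hY, hYB⟩ := mem_opSpace.1 hB
      obtain ⟨X, hX, hXY⟩ := (h Y).1 hY
      refine mem_opSpace.2 ⟨X, hX, fun x => ?_⟩
      have h1 := hXY x ⟨A x, map_mem_sphere A x⟩ rfl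
      rw [hYB] at h1
      exact A.symm_apply_eq.2 h1 |>.symm
    · intro hB
      have hskew : IsSkew B := by
        intro x y
        have h1 := hV.isSkew hB (A.symm x) (A.symm y)
        have e : ∀ z, ((A.symm.toLinearEquiv : Amb d →ₗ[ℝ] Amb d) ∘ₗ B ∘ₗ
            (A.toLinearEquiv : Amb d →ₗ[ℝ] Amb d)) (A.symm z) = A.symm (B z) := fun z => by simp
        rw [e, e, A.symm.inner_map_map, A.symm.inner_map_map] at h1
        exact h1
      obtain ⟨Y, hY⟩ := hskew.exists_field
      obtain ⟨X, hX, hXB⟩ := mem_opSpace.1 hB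
      refine mem_opSpace.2 ⟨Y, (h Y).2 ⟨X, hX, fun x y hy => ?_⟩, hY⟩
      rw [hY, hXB, hy]
      simp
  · intro h Y
    constructor
    · intro hY
      obtain ⟨B, hB, hYB⟩ := hW.exists_mem_opSpace hY
      obtain ⟨X, hX, hXB⟩ := mem_opSpace.1 ((h B).1 hB)
      refine ⟨X, hX, fun x y hy => ?_⟩
      rw [hYB, hXB, hy]
      simp
    · rintro ⟨X, hX, hXY⟩
      obtain ⟨C, hC, hXC⟩ := hV.exists_mem_opSpace hX
      let B : Module.End ℝ (Amb d) := (A.toLinearEquiv : Amb d →ₗ[ℝ] Amb d) ∘ₗ C ∘ₗ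
        (A.symm.toLinearEquiv : Amb d →ₗ[ℝ] Amb d)
      have hB : B ∈ opSpace W := by
        refine (h B).2 ?_
        convert hC using 1
        ext1 x
        simp [B]
      obtain ⟨Y', hY', hYB⟩ := mem_opSpace.1 hB
      have : Y = Y' := by
        refine field_ext (funext fun y => ?_)
        rw [hYB, hXY ⟨A.symm y, map_mem_sphere A.symm y⟩ y (by simp), hXC]
        rfl
      rwa [this]

end

/-! ### Clifford families, traces of words and intertwining operators -/

/-- A family `J 0, …, J (l - 1)` of anticommuting square roots of `-1` in a ring; the values `J i`
with `l ≤ i` are irrelevant. -/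
structure IsClifford {R : Type*} [Ring R] (l : ℕ) (J : ℕ → R) : Prop where
  sq : ∀ i < l, J i * J i = -1
  anti : ∀ i < l, ∀ j < l, i ≠ j → J i * J j = -(J j * J i)

/-- The product of the `J i`, `i ∈ S`, in decreasing order. -/
def word {R : Type*} [Monoid R] (J : ℕ → R) (S : Finset ℕ) : R :=
  ((S.sort (· ≥ ·)).map J).prod

/-- The inverse of `word J S`: the product of the `-J i`, `i ∈ S`, in increasing order. -/
def wordInv {R : Type*} [Ring R] (J : ℕ → R) (S : Finset ℕ) : R :=
  (word (fun i => MulOpposite.op (-J i)) S).unop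

theorem word_empty {R : Type*} [Monoid R] (J : ℕ → R) : word J ∅ = 1 := by simp [word]

theorem word_insert {R : Type*} [Monoid R] (J : ℕ → R) {S : Finset ℕ} {k : ℕ}
    (h : ∀ b ∈ S, b < k) : word J (insert k S) = J k * word J S := by
  have h2 : (insert k S).sort (· ≥ ·) = k :: S.sort (· ≥ ·) :=
    Finset.sort_insert (· ≥ ·) (fun b hb => (h b hb).le) (fun hk => lt_irrefl _ (h k hk))
  rw [word, h2, List.map_cons, List.prod_cons, word]

section Ring

variable {R : Type*} [Ring R] {l : ℕ} {J : ℕ → R}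

theorem wordInv_empty (J : ℕ → R) : wordInv J ∅ = 1 := by simp [wordInv, word_empty]

theorem wordInv_insert (J : ℕ → R) {S : Finset ℕ} {k : ℕ} (h : ∀ b ∈ S, b < k) :
    wordInv J (insert k S) = wordInv J S * -J k := by
  rw [wordInv, word_insert _ h, MulOpposite.unop_mul]
  rfl

theorem IsClifford.mono (hJ : IsClifford l J) {m : ℕ} (h : m ≤ l) : IsClifford m J :=
  ⟨fun i hi => hJ.sq i (by omega), fun i hi j hj => hJ.anti i (by omega) j (by omega)⟩

theorem IsClifford.neg (hJ : IsClifford l J) : IsClifford l (fun i => -J i) :=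
  ⟨fun i hi => by rw [neg_mul_neg, hJ.sq i hi],
    fun i hi j hj hij => by rw [neg_mul_neg, neg_mul_neg, hJ.anti i hi j hj hij]⟩

theorem IsClifford.map {R' : Type*} [Ring R'] (hJ : IsClifford l J) (f : R →+* R') :
    IsClifford l (fun i => f (J i)) :=
  ⟨fun i hi => by rw [← map_mul, hJ.sq i hi, map_neg, map_one],
    fun i hi j hj hij => by rw [← map_mul, hJ.anti i hi j hj hij, map_neg, map_mul]⟩

theorem map_word {R' : Type*} [Ring R'] (f : R →* R') (J : ℕ → R) (S : Finset ℕ) :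
    f (word J S) = word (fun i => f (J i)) S := by
  rw [word, map_list_prod, List.map_map]
  rfl

theorem word_neg (J : ℕ → R) (S : Finset ℕ) :
    word (fun i => -J i) S = (-1 : ℤ) ^ S.card • word J S := by
  induction S using Finset.induction_on_max with
  | empty => simp [word_empty]
  | insert k S hk ih =>
    rw [word_insert _ hk, word_insert _ hk, ih,
      Finset.card_insert_of_notMem fun h => lt_irrefl _ (hk k h), pow_succ,
      mul_smul_comm, neg_mul, mul_neg_one, neg_smul, smul_neg]

theorem IsClifford.word_mul_wordInv (hJ : IsClifford l J) {S : Finset ℕ}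
    (hS : S ⊆ Finset.range l) : word J S * wordInv J S = 1 := by
  induction S using Finset.induction_on_max with
  | empty => simp [word_empty, wordInv_empty]
  | insert k S hk ih =>
    have hkl : k < l := Finset.mem_range.1 (hS (Finset.mem_insert_self k S))
    rw [word_insert _ hk, wordInv_insert _ hk,
      show J k * word J S * (wordInv J S * -J k) = J k * (word J S * wordInv J S) * -J k by
        simp only [mul_assoc],
      ih ((Finset.subset_insert k S).trans hS), mul_one, mul_neg, hJ.sq k hkl, neg_neg]

/-- Each generator commutes or anticommutes with each word. -/
theorem IsClifford.mul_word (hJ : IsClifford l J) {S : Finset ℕ} (hS : S ⊆ Finset.range l)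
    {i : ℕ} (hi : i < l) :
    J i * word J S = (-1 : ℤ) ^ (S.erase i).card • (word J S * J i) := by
  induction S using Finset.induction_on_max with
  | empty => simp [word_empty]
  | insert k S hk ih =>
    have hkl : k < l := Finset.mem_range.1 (hS (Finset.mem_insert_self k S))
    have ih := ih ((Finset.subset_insert k S).trans hS)
    have hkS : k ∉ S := fun h => lt_irrefl _ (hk k h)
    rw [word_insert _ hk]
    by_cases hik : i = k
    · subst hik
      rw [Finset.erase_eq_of_notMem hkS] at ih
      rw [Finset.erase_insert hkS]
      conv_lhs => rw [ih]
      rw [mul_smul_comm, mul_assoc]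
    · rw [← mul_assoc, hJ.anti i hi k hkl hik, neg_mul, mul_assoc, ih,
        Finset.erase_insert_of_ne (Ne.symm hik), Finset.card_insert_of_notMem (by simp [hkS]),
        pow_succ, mul_smul_comm, mul_assoc]
      simp

end Ring

section Trace

variable {V : Type*} [AddCommGroup V] [Module ℝ V] {l : ℕ} {J : ℕ → Module.End ℝ V}

theorem trace_eq_zero_of_anticommute {A X : Module.End ℝ V} (hA : A * A = -1)
    (h : A * X = -(X * A)) : LinearMap.trace ℝ V X = 0 := by
  have h1 : A * X * A = X := by rw [h, neg_mul, mul_assoc, hA, mul_neg, mul_one, neg_neg]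
  have h2 : LinearMap.trace ℝ V X = -LinearMap.trace ℝ V X := by
    conv_lhs => rw [← h1, mul_assoc, LinearMap.trace_mul_comm, mul_assoc, hA]
    simp
  linarith

/-- The trace of a word vanishes, except for the empty word, and for the full word if `l` is odd. -/
theorem IsClifford.trace_word (hJ : IsClifford l J) {S : Finset ℕ} (hS : S ⊆ Finset.range l)
    (h0 : S ≠ ∅) (h1 : ¬ (Odd l ∧ S = Finset.range l)) : LinearMap.trace ℝ V (word J S) = 0 := by
  -- Some generator anticommutes with the word: any member of `S` if `S` has an even number of
  -- members, and any generator outside `S` otherwise.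
  obtain ⟨i, hi, hodd⟩ : ∃ i < l, Odd (S.erase i).card := by
    rcases Nat.even_or_odd S.card with he | ho
    · obtain ⟨i, hi⟩ := Finset.nonempty_iff_ne_empty.2 h0
      refine ⟨i, Finset.mem_range.1 (hS hi), ?_⟩
      rw [Finset.card_erase_of_mem hi]
      exact Nat.Even.sub_odd (Finset.card_pos.2 ⟨i, hi⟩) he odd_one
    · have hne : S ≠ Finset.range l := by
        rintro rfl
        exact h1 ⟨by simpa using ho, rfl⟩
      obtain ⟨i, hi, hiS⟩ := Finset.exists_of_ssubset (hS.ssubset_of_ne hne)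
      exact ⟨i, Finset.mem_range.1 hi, by rwa [Finset.erase_eq_of_notMem hiS]⟩
  refine trace_eq_zero_of_anticommute (hJ.sq i hi) ?_
  rw [hJ.mul_word hS hi, hodd.neg_one_pow, neg_one_smul]

end Trace

section Averaging

variable {V V' : Type*} [AddCommGroup V] [Module ℝ V] [AddCommGroup V'] [Module ℝ V']
  {l : ℕ} {J : ℕ → Module.End ℝ V} {J' : ℕ → Module.End ℝ V'}

/-- The operator `L ↦ A ∘ L ∘ B` on linear maps. -/
def sandwich (A : Module.End ℝ V') (B : Module.End ℝ V) : Module.End ℝ (V →ₗ[ℝ] V') where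
  toFun L := A ∘ₗ L ∘ₗ B
  map_add' L M := by ext; simp
  map_smul' c L := by ext; simp

/-- Under `V →ₗ V' = V* ⊗ V'` the operator `sandwich A B` is `Bᵗ ⊗ A`. -/
theorem trace_sandwich [FiniteDimensional ℝ V] [FiniteDimensional ℝ V'] (A : Module.End ℝ V')
    (B : Module.End ℝ V) :
    LinearMap.trace ℝ _ (sandwich A B) = LinearMap.trace ℝ V' A * LinearMap.trace ℝ V B := by
  have h : sandwich A B = (dualTensorHomEquiv ℝ V V').conj (TensorProduct.map B.dualMap A) := by
    apply LinearMap.ext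
    intro L
    obtain ⟨t, rfl⟩ := (dualTensorHomEquiv ℝ V V').surjective L
    rw [LinearEquiv.conj_apply_apply, LinearEquiv.symm_apply_apply]
    induction t using TensorProduct.induction_on with
    | zero => simp
    | tmul f v =>
      ext x
      simp [sandwich]
    | add s t hs ht => rw [map_add, map_add, hs, ht, map_add, map_add]
  rw [h]
  refine (LinearMap.trace_conj' (R := ℝ) (M := TensorProduct ℝ (Module.Dual ℝ V) V')
    (N := V →ₗ[ℝ] V') (TensorProduct.map B.dualMap A) (dualTensorHomEquiv ℝ V V')).trans ?_
  rw [LinearMap.trace_tensorProduct', mul_comm]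
  congr 1
  exact LinearMap.trace_transpose' B

/-- The sum over all words `w` of the operators `L ↦ w ∘ L ∘ w⁻¹`. -/
def wordSum (l : ℕ) (J' : ℕ → Module.End ℝ V') (J : ℕ → Module.End ℝ V) :
    Module.End ℝ (V →ₗ[ℝ] V') :=
  ∑ S ∈ (Finset.range l).powerset, sandwich (word J' S) (wordInv J S)

theorem wordSum_zero (L : V →ₗ[ℝ] V') : wordSum 0 J' J L = L := by
  simp [wordSum, sandwich, word_empty, wordInv_empty, Module.End.one_eq_id]

/-- The words in `l + 1` generators are the words `w` in `l` generators and the words `J l * w`. -/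
theorem wordSum_succ (L : V →ₗ[ℝ] V') : wordSum (l + 1) J' J L
    = wordSum l J' J L - J' l ∘ₗ wordSum l J' J L ∘ₗ J l := by
  rw [wordSum, Finset.range_add_one, Finset.sum_powerset_insert Finset.notMem_range_self,
    LinearMap.add_apply, sub_eq_add_neg]
  congr 1
  rw [wordSum, LinearMap.sum_apply, LinearMap.sum_apply]
  ext x
  simp only [LinearMap.sum_apply, LinearMap.neg_apply, LinearMap.comp_apply, map_sum]
  rw [← Finset.sum_neg_distrib]
  refine Finset.sum_congr rfl fun S hS => ?_
  have h : ∀ b ∈ S, b < l := fun b hb => Finset.mem_range.1 (Finset.mem_powerset.1 hS hb)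
  simp [sandwich, word_insert _ h, wordInv_insert _ h]

/-- The values of `wordSum` are intertwining operators. -/
theorem wordSum_intertwines (hJ : IsClifford l J) (hJ' : IsClifford l J') (L : V →ₗ[ℝ] V') {i : ℕ}
    (hi : i < l) : J' i ∘ₗ wordSum l J' J L = wordSum l J' J L ∘ₗ J i := by
  induction l with
  | zero => omega
  | succ l ih =>
    have ih := ih (hJ.mono l.le_succ) (hJ'.mono l.le_succ)
    have e : ∀ a < l + 1, ∀ x, J a (J a x) = -x := fun a ha x => DFunLike.congr_fun (hJ.sq a ha) x
    have e' : ∀ a < l + 1, ∀ x, J' a (J' a x) = -x := fun a ha x =>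
      DFunLike.congr_fun (hJ'.sq a ha) x
    rw [wordSum_succ]
    obtain ⟨M, hM⟩ : ∃ M, M = wordSum l J' J L := ⟨_, rfl⟩
    rw [← hM] at ih ⊢
    ext x
    simp only [LinearMap.comp_apply, LinearMap.sub_apply, map_sub]
    rcases Nat.lt_succ_iff_lt_or_eq.1 hi with h | rfl
    · have ih := fun x => DFunLike.congr_fun (ih h) x
      simp only [LinearMap.comp_apply] at ih
      have a1 : ∀ x, J l (J i x) = -J i (J l x) := fun x =>
        DFunLike.congr_fun (hJ.anti l (by omega) i hi (by omega)) x
      have a2 : ∀ x, J' i (J' l x) = -J' l (J' i x) := fun x =>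
        DFunLike.congr_fun (hJ'.anti i hi l (by omega) (by omega)) x
      rw [a2, ih, ih, a1, map_neg, map_neg]
    · rw [e' i hi, e i hi, map_neg, map_neg]
      abel

theorem wordSum_of_intertwines (hJ : IsClifford l J) {L : V →ₗ[ℝ] V'}
    (hL : ∀ i < l, J' i ∘ₗ L = L ∘ₗ J i) : wordSum l J' J L = (2 : ℝ) ^ l • L := by
  induction l with
  | zero => simp [wordSum_zero]
  | succ l ih =>
    rw [wordSum_succ, ih (hJ.mono l.le_succ) fun i hi => hL i (by omega)]
    ext x
    have h1 : J' l (L (J l x)) = L (J l (J l x)) := DFunLike.congr_fun (hL l (by omega)) (J l x)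
    have h2 : J l (J l x) = -x := DFunLike.congr_fun (hJ.sq l (by omega)) x
    simp only [LinearMap.sub_apply, LinearMap.smul_apply, LinearMap.comp_apply, map_smul]
    rw [h1, h2, map_neg, pow_succ, mul_smul, two_smul, smul_add, smul_neg, sub_neg_eq_add]

theorem trace_wordSum [FiniteDimensional ℝ V] [FiniteDimensional ℝ V'] :
    LinearMap.trace ℝ _ (wordSum l J' J) = ∑ S ∈ (Finset.range l).powerset,
      LinearMap.trace ℝ V' (word J' S) * LinearMap.trace ℝ V (wordInv J S) := by
  simp only [wordSum, map_sum, trace_sandwich]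

/-- The space of intertwining operators. -/
def intertwiners (l : ℕ) (J' : ℕ → Module.End ℝ V') (J : ℕ → Module.End ℝ V) :
    Submodule ℝ (V →ₗ[ℝ] V') where
  carrier := {L | ∀ i < l, J' i ∘ₗ L = L ∘ₗ J i}
  zero_mem' i _ := by simp
  add_mem' {L M} hL hM i hi := by
    rw [LinearMap.comp_add, LinearMap.add_comp, hL i hi, hM i hi]
  smul_mem' c L hL i hi := by
    rw [LinearMap.comp_smul, LinearMap.smul_comp, hL i hi]

/-- The average of `L ↦ w ∘ L ∘ w⁻¹` over the words `w` is a projection onto the intertwining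
operators, so its trace is their dimension. -/
theorem finrank_intertwiners [FiniteDimensional ℝ V] [FiniteDimensional ℝ V']
    (hJ : IsClifford l J) (hJ' : IsClifford l J') :
    (2 : ℝ) ^ l * Module.finrank ℝ (intertwiners l J' J) = ∑ S ∈ (Finset.range l).powerset,
      LinearMap.trace ℝ V' (word J' S) * LinearMap.trace ℝ V (wordInv J S) := by
  have h2 : (2 : ℝ) ^ l ≠ 0 := by positivity
  have hproj : LinearMap.IsProj (intertwiners l J' J) (((2 : ℝ) ^ l)⁻¹ • wordSum l J' J) := by
    constructor
    · intro L i hi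
      rw [LinearMap.smul_apply, LinearMap.comp_smul, LinearMap.smul_comp,
        wordSum_intertwines hJ hJ' L hi]
    · intro L hL
      rw [LinearMap.smul_apply, wordSum_of_intertwines hJ hL, smul_smul, inv_mul_cancel₀ h2,
        one_smul]
  have h := hproj.trace
  rw [map_smul, trace_wordSum, smul_eq_mul] at h
  rw [← h, ← mul_assoc, mul_inv_cancel₀ h2, one_mul]

end Averaging

/-! ### Characters determine skew-adjoint Clifford families -/

section Restriction

variable {V : Type*} [AddCommGroup V] [Module ℝ V] {l : ℕ} {J : ℕ → Module.End ℝ V}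

open Classical in
/-- The restriction of an endomorphism to an invariant subspace; zero if the subspace is not
invariant. -/
def restr (W : Submodule ℝ V) (A : Module.End ℝ V) : Module.End ℝ W :=
  if h : ∀ x ∈ W, A x ∈ W then A.restrict h else 0

theorem coe_restr {W : Submodule ℝ V} {A : Module.End ℝ V} (h : ∀ x ∈ W, A x ∈ W) (x : W) :
    (restr W A x : V) = A x := by
  rw [restr, dif_pos h]
  rfl

theorem IsClifford.restr (hJ : IsClifford l J) {W : Submodule ℝ V}
    (hW : ∀ i < l, ∀ x ∈ W, J i x ∈ W) : IsClifford l (fun i => restr W (J i)) := by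
  refine ⟨fun i hi => ?_, fun i hi j hj hij => ?_⟩
  · ext x
    rw [Module.End.mul_apply, coe_restr (hW i hi), coe_restr (hW i hi), ← Module.End.mul_apply,
      hJ.sq i hi]
    rfl
  · ext x
    rw [Module.End.mul_apply, coe_restr (hW i hi), coe_restr (hW j hj), ← Module.End.mul_apply,
      hJ.anti i hi j hj hij, LinearMap.neg_apply, LinearMap.neg_apply, Module.End.mul_apply,
      Module.End.mul_apply, Submodule.coe_neg, coe_restr (hW j hj), coe_restr (hW i hi)]

theorem word_intertwines {V' : Type*} [AddCommGroup V'] [Module ℝ V'] {J' : ℕ → Module.End ℝ V'}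
    (f : V →ₗ[ℝ] V') (h : ∀ i < l, ∀ x, f (J i x) = J' i (f x)) {S : Finset ℕ}
    (hS : S ⊆ Finset.range l) (x : V) : f (word J S x) = word J' S (f x) := by
  induction S using Finset.induction_on_max generalizing x with
  | empty => simp [word_empty]
  | insert k S hk ih =>
    rw [word_insert _ hk, word_insert _ hk, Module.End.mul_apply, Module.End.mul_apply,
      h k (Finset.mem_range.1 (hS (Finset.mem_insert_self k S))),
      ih ((Finset.subset_insert k S).trans hS)]

theorem trace_eq_of_intertwine {V' : Type*} [AddCommGroup V'] [Module ℝ V']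
    (f : V ≃ₗ[ℝ] V') {A : Module.End ℝ V} {A' : Module.End ℝ V'} (h : ∀ x, f (A x) = A' (f x)) :
    LinearMap.trace ℝ V A = LinearMap.trace ℝ V' A' := by
  rw [← LinearMap.trace_conj' A f]
  congr 1
  ext x
  rw [LinearEquiv.conj_apply_apply, h, LinearEquiv.apply_symm_apply]

theorem trace_eq_add_of_isCompl [FiniteDimensional ℝ V] {W W' : Submodule ℝ V} (hc : IsCompl W W')
    {A : Module.End ℝ V} {B : Module.End ℝ W} {B' : Module.End ℝ W'}
    (hB : ∀ x : W, (B x : V) = A x) (hB' : ∀ x : W', (B' x : V) = A x) :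
    LinearMap.trace ℝ V A = LinearMap.trace ℝ W B + LinearMap.trace ℝ W' B' := by
  rw [← LinearMap.trace_prodMap']
  refine (trace_eq_of_intertwine (Submodule.prodEquivOfIsCompl W W' hc) fun x => ?_).symm
  simp [hB, hB']

theorem trace_word_eq_add [FiniteDimensional ℝ V] {W W' : Submodule ℝ V} (hc : IsCompl W W')
    (hW : ∀ i < l, ∀ x ∈ W, J i x ∈ W) (hW' : ∀ i < l, ∀ x ∈ W', J i x ∈ W') {S : Finset ℕ}
    (hS : S ⊆ Finset.range l) :
    LinearMap.trace ℝ V (word J S) = LinearMap.trace ℝ W (word (fun i => restr W (J i)) S)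
      + LinearMap.trace ℝ W' (word (fun i => restr W' (J i)) S) :=
  trace_eq_add_of_isCompl hc
    (word_intertwines W.subtype (fun i hi x => coe_restr (hW i hi) x) hS)
    (word_intertwines W'.subtype (fun i hi x => coe_restr (hW' i hi) x) hS)

end Restriction

section Orthogonal

variable {l : ℕ}

/-- A Clifford family of skew-adjoint endomorphisms. -/
structure IsSkewClifford {V : Type*} [NormedAddCommGroup V] [InnerProductSpace ℝ V] (l : ℕ)
    (J : ℕ → Module.End ℝ V) : Prop extends IsClifford l J where
  skew : ∀ i < l, IsSkew (J i)

section

variable {V : Type*} [NormedAddCommGroup V] [InnerProductSpace ℝ V] {J : ℕ → Module.End ℝ V}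

theorem IsSkewClifford.restr (hJ : IsSkewClifford l J) {W : Submodule ℝ V}
    (hW : ∀ i < l, ∀ x ∈ W, J i x ∈ W) : IsSkewClifford l (fun i => restr W (J i)) :=
  ⟨hJ.toIsClifford.restr hW, fun i hi x y => by
    rw [Submodule.coe_inner, Submodule.coe_inner, coe_restr (hW i hi), coe_restr (hW i hi),
      hJ.skew i hi]⟩

theorem IsSkewClifford.orthogonal_invariant (hJ : IsSkewClifford l J) {W : Submodule ℝ V}
    (hW : ∀ i < l, ∀ x ∈ W, J i x ∈ W) : ∀ i < l, ∀ x ∈ Wᗮ, J i x ∈ Wᗮ := by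
  intro i hi x hx w hw
  have h := hJ.skew i hi w x
  rw [hx (J i w) (hW i hi w hw)] at h
  linarith

theorem IsSkewClifford.inner_word (hJ : IsSkewClifford l J) {S : Finset ℕ}
    (hS : S ⊆ Finset.range l) (x y : V) :
    inner ℝ (word J S x) y = inner ℝ x (wordInv J S y) := by
  induction S using Finset.induction_on_max generalizing x y with
  | empty => simp [word_empty, wordInv_empty]
  | insert k S hk ih =>
    rw [word_insert _ hk, wordInv_insert _ hk, Module.End.mul_apply, Module.End.mul_apply,
      hJ.skew k (Finset.mem_range.1 (hS (Finset.mem_insert_self k S))),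
      ih ((Finset.subset_insert k S).trans hS), LinearMap.neg_apply, map_neg, inner_neg_right]

theorem IsSkewClifford.trace_wordInv [FiniteDimensional ℝ V] (hJ : IsSkewClifford l J)
    {S : Finset ℕ} (hS : S ⊆ Finset.range l) :
    LinearMap.trace ℝ V (wordInv J S) = LinearMap.trace ℝ V (word J S) := by
  rw [LinearMap.trace_eq_sum_inner _ (stdOrthonormalBasis ℝ V),
    LinearMap.trace_eq_sum_inner _ (stdOrthonormalBasis ℝ V)]
  refine Finset.sum_congr rfl fun i _ => ?_
  rw [← hJ.inner_word hS, real_inner_comm]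

end

/-- A nonzero intertwining operator between two families of skew-adjoint operators restricts to a
multiple of an isometry on some nonzero invariant subspace `E`. -/
theorem exists_isometric_part {V V' : Type*} [NormedAddCommGroup V] [InnerProductSpace ℝ V]
    [FiniteDimensional ℝ V] [NormedAddCommGroup V'] [InnerProductSpace ℝ V']
    [FiniteDimensional ℝ V'] {J : ℕ → Module.End ℝ V} {J' : ℕ → Module.End ℝ V'}
    (hJ : ∀ i < l, IsSkew (J i)) (hJ' : ∀ i < l, IsSkew (J' i)) {T : V →ₗ[ℝ] V'} (hT0 : T ≠ 0)
    (hT : T ∈ intertwiners l J' J) :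
    ∃ E : Submodule ℝ V, E ≠ ⊥ ∧ (∀ i < l, ∀ x ∈ E, J i x ∈ E) ∧
      ∃ f : E →ₗᵢ[ℝ] V', ∀ i < l, ∀ x : E, ∀ y : E, (y : V) = J i x → f y = J' i (f x) := by
  have hTi : ∀ i < l, ∀ x, T (J i x) = J' i (T x) := fun i hi x =>
    (DFunLike.congr_fun (hT i hi) x).symm
  -- `E` is an eigenspace of `T* T` for a nonzero eigenvalue.
  let P : Module.End ℝ V := LinearMap.adjoint T ∘ₗ T
  have hP : ∀ x y, inner ℝ (P x) y = inner ℝ (T x) (T y) := fun x y => by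
    rw [LinearMap.comp_apply, LinearMap.adjoint_inner_left]
  have hPsymm : P.IsSymmetric := fun x y => by
    rw [hP, real_inner_comm (P y) x, hP, real_inner_comm]
  have hPJ : ∀ i < l, ∀ x, P (J i x) = J i (P x) := by
    intro i hi x
    refine ext_inner_right ℝ fun y => ?_
    rw [hP, hTi i hi, hJ i hi, hP, hJ' i hi, hTi i hi]
  obtain ⟨μ, hμ, v, hv0, hv⟩ : ∃ μ : ℝ, μ ≠ 0 ∧ ∃ v, v ≠ 0 ∧ P v = μ • v := by
    by_contra hcon
    push Not at hcon
    apply hT0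
    let b := hPsymm.eigenvectorBasis rfl
    have hb : ∀ i, P (b i) = 0 := by
      intro i
      have h1 := hPsymm.apply_eigenvectorBasis rfl i
      by_cases h0 : hPsymm.eigenvalues rfl i = 0
      · rw [h0] at h1
        rw [RCLike.ofReal_zero, zero_smul] at h1
        exact h1
      · exact absurd h1 (hcon _ h0 _ (b.orthonormal.ne_zero i))
    refine b.toBasis.ext fun i => ?_
    have h2 := hP (b i) (b i)
    rw [hb, inner_zero_left, eq_comm, inner_self_eq_zero] at h2
    simpa using h2
  have hμpos : 0 < μ := by
    have h1 := hP v v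
    rw [hv, inner_smul_left, real_inner_self_eq_norm_sq, real_inner_self_eq_norm_sq] at h1
    simp only [RCLike.conj_to_real] at h1
    have h2 : 0 < ‖v‖ ^ 2 := by positivity
    by_contra hneg
    have h3 : μ < 0 := lt_of_le_of_ne (not_lt.1 hneg) hμ
    nlinarith [sq_nonneg ‖T v‖]
  have hmem : ∀ x, x ∈ Module.End.eigenspace P μ ↔ P x = μ • x := fun x =>
    Module.End.mem_eigenspace_iff
  refine ⟨Module.End.eigenspace P μ, ?_, ?_, ?_⟩
  · intro h
    exact hv0 ((Submodule.mem_bot ℝ).1 (h ▸ (hmem v).2 hv))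
  · intro i hi x hx
    rw [hmem] at hx ⊢
    rw [hPJ i hi, hx, map_smul]
  · let g : Module.End.eigenspace P μ →ₗ[ℝ] V' := (Real.sqrt μ)⁻¹ • T.domRestrict _
    have hg : ∀ x, g x = (Real.sqrt μ)⁻¹ • T x := fun x => rfl
    have hs : 0 < Real.sqrt μ := Real.sqrt_pos.2 hμpos
    refine ⟨⟨g, fun x => ?_⟩, fun i hi x y hy => ?_⟩
    · rw [← sq_eq_sq₀ (norm_nonneg _) (norm_nonneg _), hg, norm_smul, mul_pow, norm_inv,
        Real.norm_of_nonneg hs.le, inv_pow, Real.sq_sqrt hμpos.le, ← real_inner_self_eq_norm_sq,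
        ← hP, (hmem _).1 x.2, inner_smul_left, real_inner_self_eq_norm_sq]
      simp only [RCLike.conj_to_real, Submodule.coe_norm]
      rw [← mul_assoc, inv_mul_cancel₀ hμ, one_mul]
    · change g y = J' i (g x)
      rw [hg, hg, hy, hTi i hi, map_smul]

/-- Characters classify: two skew-adjoint Clifford families whose words have the same traces are
orthogonally equivalent. -/
theorem exists_linearIsometry_of_trace_eq (n : ℕ) : ∀ {V V' : Type} [NormedAddCommGroup V]
    [InnerProductSpace ℝ V] [FiniteDimensional ℝ V] [NormedAddCommGroup V']
    [InnerProductSpace ℝ V'] [FiniteDimensional ℝ V'] {J : ℕ → Module.End ℝ V}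
    {J' : ℕ → Module.End ℝ V'}, Module.finrank ℝ V = n → IsSkewClifford l J →
    IsSkewClifford l J' → (∀ S ⊆ Finset.range l,
      LinearMap.trace ℝ V (word J S) = LinearMap.trace ℝ V' (word J' S)) →
    ∃ f : V →ₗᵢ[ℝ] V', ∀ i < l, ∀ x, f (J i x) = J' i (f x) := by
  induction n using Nat.strong_induction_on with
  | _ n ih =>
  intro V V' _ _ _ _ _ _ J J' hn hJ hJ' htr
  rcases Nat.eq_zero_or_pos n with rfl | hpos
  · have : Subsingleton V := Module.finrank_zero_iff.1 hn
    exact ⟨⟨0, fun x => by simp [Subsingleton.elim x 0]⟩, fun i _ x => by simp [map_zero]⟩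
  -- If there were no intertwining operator, the sum of the squares of the traces would vanish, but
  -- the trace of the empty word is the dimension.
  obtain ⟨T, hT, hT0⟩ : ∃ T ∈ intertwiners l J' J, T ≠ 0 := by
    rw [← Submodule.ne_bot_iff]
    intro hbot
    have h := finrank_intertwiners hJ.toIsClifford hJ'.toIsClifford
    rw [hbot, finrank_bot, Nat.cast_zero, mul_zero] at h
    have h1 : ∀ S ∈ (Finset.range l).powerset, LinearMap.trace ℝ V' (word J' S) *
        LinearMap.trace ℝ V (wordInv J S) = LinearMap.trace ℝ V (word J S) ^ 2 := by
      intro S hS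
      rw [hJ.trace_wordInv (Finset.mem_powerset.1 hS), htr S (Finset.mem_powerset.1 hS), sq]
    rw [Finset.sum_congr rfl h1] at h
    have h2 := (Finset.sum_eq_zero_iff_of_nonneg fun S _ => sq_nonneg _).1 h.symm ∅
      (Finset.empty_mem_powerset _)
    rw [word_empty, LinearMap.trace_one, hn] at h2
    have h3 : (n : ℝ) ≠ 0 := by positivity
    exact h3 (pow_eq_zero_iff two_ne_zero |>.1 h2)
  obtain ⟨E, hE0, hE, f, hf⟩ := exists_isometric_part hJ.skew hJ'.skew hT0 hT
  obtain ⟨E', hE'def⟩ : ∃ E', E' = LinearMap.range f.toLinearMap := ⟨_, rfl⟩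
  have hfE' : ∀ x, f x ∈ E' := fun x => hE'def ▸ ⟨x, rfl⟩
  have hE' : ∀ i < l, ∀ x ∈ E', J' i x ∈ E' := by
    intro i hi y hy
    rw [hE'def] at hy
    obtain ⟨x, rfl⟩ := hy
    have h := hf i hi x ⟨J i x, hE i hi x x.2⟩ rfl
    change J' i (f x) ∈ E'
    rw [← h]
    exact hfE' _
  have hF := hJ.orthogonal_invariant hE
  have hF' := hJ'.orthogonal_invariant hE'
  let e : E ≃ₗ[ℝ] E' :=
    (LinearEquiv.ofInjective f.toLinearMap f.injective).trans (LinearEquiv.ofEq _ _ hE'def.symm)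
  have he : ∀ x, (e x : V') = f x := fun x => rfl
  have htrE : ∀ S ⊆ Finset.range l, LinearMap.trace ℝ E (word (fun i => restr E (J i)) S)
      = LinearMap.trace ℝ E' (word (fun i => restr E' (J' i)) S) := by
    intro S hS
    refine trace_eq_of_intertwine e fun x => word_intertwines e.toLinearMap (fun i hi x => ?_) hS x
    apply Subtype.ext
    rw [coe_restr (hE' i hi)]
    exact hf i hi x _ (coe_restr (hE i hi) x)
  have hdim : Module.finrank ℝ Eᗮ < n := by
    have h1 := Submodule.finrank_add_finrank_orthogonal E
    have h2 : 0 < Module.finrank ℝ E := by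
      rw [Nat.pos_iff_ne_zero]
      exact fun h => hE0 (Submodule.finrank_eq_zero.1 h)
    omega
  obtain ⟨g, hg⟩ := ih _ hdim (V := Eᗮ) (V' := E'ᗮ) rfl (hJ.restr hF) (hJ'.restr hF') fun S hS => by
    have h1 := trace_word_eq_add (Submodule.isCompl_orthogonal E) hE hF hS
    have h2 := trace_word_eq_add (Submodule.isCompl_orthogonal E') hE' hF' hS
    have h3 := htr S hS
    have h4 := htrE S hS
    linarith
  -- Combine the isometry on `E` with the one on its orthogonal complement.
  let F : V →ₗ[ℝ] V' := f.toLinearMap ∘ₗ E.orthogonalProjectionOnto.toLinearMap +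
    E'ᗮ.subtype ∘ₗ g.toLinearMap ∘ₗ Eᗮ.orthogonalProjectionOnto.toLinearMap
  have hFapp : ∀ (a : E) (b : Eᗮ), F ((a : V) + b) = f a + g b := by
    intro a b
    have h1 : E.orthogonalProjectionOnto ((a : V) + b) = a := by
      rw [map_add, Submodule.orthogonalProjectionOnto_mem_subspace_eq_self,
        Submodule.orthogonalProjectionOnto_apply_of_mem_orthogonal b.2, add_zero]
    have h2 : Eᗮ.orthogonalProjectionOnto ((a : V) + b) = b := by
      rw [map_add, Submodule.orthogonalProjectionOnto_mem_subspace_eq_self,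
        Submodule.orthogonalProjectionOnto_apply_of_mem_orthogonal
          (Submodule.le_orthogonal_orthogonal E a.2), zero_add]
    simp [F, h1, h2]
  have hsplit : ∀ x : V, ∃ (a : E) (b : Eᗮ), x = (a : V) + b := fun x => by
    obtain ⟨a, ha, b, hb, h⟩ := E.exists_add_mem_mem_orthogonal x
    exact ⟨⟨a, ha⟩, ⟨b, hb⟩, h⟩
  refine ⟨⟨F, fun x => ?_⟩, fun i hi x => ?_⟩
  · obtain ⟨a, b, rfl⟩ := hsplit x
    rw [hFapp, ← sq_eq_sq₀ (norm_nonneg _) (norm_nonneg _), sq, sq,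
      norm_add_sq_eq_norm_sq_add_norm_sq_of_inner_eq_zero _ _ ((g b).2 _ (hfE' a)),
      norm_add_sq_eq_norm_sq_add_norm_sq_of_inner_eq_zero _ _ (b.2 _ a.2), f.norm_map,
      Submodule.norm_coe, Submodule.norm_coe, Submodule.norm_coe, g.norm_map]
  · obtain ⟨a, b, rfl⟩ := hsplit x
    change F (J i (a + b)) = J' i (F (a + b))
    have h1 : J i (a + b) = (restr E (J i) a : V) + (restr Eᗮ (J i) b : V) := by
      rw [coe_restr (hE i hi), coe_restr (hF i hi), map_add]
    rw [h1, hFapp, hFapp, map_add, hg i hi, coe_restr (hF' i hi),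
      hf i hi a _ (coe_restr (hE i hi) a)]

end Orthogonal

/-! ### Divisibility of the dimensions of Clifford modules -/

section Pairs

variable {R : Type*} [Ring R] {a b c : R}

theorem sq_mul_of_anticommute (ha : a * a = -1) (hb : b * b = -1) (hab : a * b = -(b * a)) :
    a * b * (a * b) = -1 := by
  have h : a * b * (a * b) = -(a * a * (b * b)) := by
    rw [show a * b * (a * b) = a * (b * a) * b by simp only [mul_assoc], ← neg_eq_iff_eq_neg.2 hab]
    simp only [mul_neg, neg_mul, mul_assoc]
  rw [h, ha, hb]
  simp

theorem mul_pair_comm (hca : c * a = -(a * c)) (hcb : c * b = -(b * c)) :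
    c * (a * b) = a * b * c := by
  rw [← mul_assoc, hca, neg_mul, mul_assoc, hcb, mul_neg, neg_neg, mul_assoc]

end Pairs

section Divisibility

variable {V : Type*} [AddCommGroup V] [Module ℝ V]

/-- The two eigenspaces of an involution `s` that anticommutes with an invertible operator have the
same dimension, since `s` has trace zero. -/
theorem finrank_eq_two_mul_of_anticommute [FiniteDimensional ℝ V] {s K : Module.End ℝ V}
    (hs : s * s = 1) (hK : K * K = -1) (h : K * s = -(s * K)) :
    Module.finrank ℝ V = 2 * Module.finrank ℝ (LinearMap.ker (s - 1)) := by
  have hproj : LinearMap.IsProj (LinearMap.ker (s - 1)) ((2 : ℝ)⁻¹ • (1 + s)) := by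
    constructor
    · intro x
      have h1 : s (s x) = x := DFunLike.congr_fun hs x
      rw [LinearMap.mem_ker]
      simp only [LinearMap.smul_apply, LinearMap.add_apply, LinearMap.sub_apply,
        Module.End.one_apply, map_smul, map_add, h1]
      module
    · intro x hx
      rw [LinearMap.mem_ker, LinearMap.sub_apply, Module.End.one_apply, sub_eq_zero] at hx
      simp only [LinearMap.smul_apply, LinearMap.add_apply, Module.End.one_apply, hx]
      module
  have h1 := hproj.trace
  rw [map_smul, map_add, trace_eq_zero_of_anticommute hK h, LinearMap.trace_one, add_zero,
    smul_eq_mul] at h1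
  have h2 : (Module.finrank ℝ V : ℝ) = 2 * Module.finrank ℝ (LinearMap.ker (s - 1)) := by
    rw [← h1]; ring
  exact_mod_cast h2

theorem mem_ker_of_commute {s A : Module.End ℝ V} (h : s * A = A * s) :
    ∀ x ∈ LinearMap.ker (s - 1), A x ∈ LinearMap.ker (s - 1) := by
  intro x hx
  rw [LinearMap.mem_ker, LinearMap.sub_apply, Module.End.one_apply, sub_eq_zero] at hx ⊢
  rw [← Module.End.mul_apply, h, Module.End.mul_apply, hx]

end Divisibility

/-- A family of anticommuting square roots of the signs `ε i`, `i ∈ I`. -/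
structure IsMixedClifford {R : Type*} [Ring R] (I : Finset ℕ) (ε : ℕ → ℤ) (A : ℕ → R) :
    Prop where
  sq : ∀ i ∈ I, A i * A i = (ε i : R)
  anti : ∀ i ∈ I, ∀ j ∈ I, i ≠ j → A i * A j = -(A j * A i)

universe u

/-- A pair of generators of opposite signs splits off: the other generators, multiplied by the
negative one, act on the fixed space of the positive one. -/
theorem IsMixedClifford.exists_half {V : Type u} [AddCommGroup V] [Module ℝ V]
    [FiniteDimensional ℝ V] {I : Finset ℕ} {ε : ℕ → ℤ} {A : ℕ → Module.End ℝ V}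
    (hA : IsMixedClifford I ε A) {j k : ℕ} (hj : j ∈ I) (hk : k ∈ I) (hεj : ε j = -1)
    (hεk : ε k = 1) : ∃ (W : Type u) (_ : AddCommGroup W) (_ : Module ℝ W)
      (_ : FiniteDimensional ℝ W) (B : ℕ → Module.End ℝ W),
      Module.finrank ℝ V = 2 * Module.finrank ℝ W ∧ IsMixedClifford ((I.erase j).erase k) ε B := by
  have hjk : j ≠ k := by
    rintro rfl
    rw [hεj] at hεk
    norm_num at hεk
  have hJ : A j * A j = -1 := by rw [hA.sq j hj, hεj]; simp
  have hs : A k * A k = 1 := by rw [hA.sq k hk, hεk]; simp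
  refine ⟨LinearMap.ker (A k - 1), inferInstance, inferInstance, inferInstance,
    fun i => restr _ (A i * A j),
    finrank_eq_two_mul_of_anticommute hs hJ (hA.anti j hj k hk hjk), ?_⟩
  have hmem : ∀ i ∈ (I.erase j).erase k, i ∈ I ∧ i ≠ j ∧ i ≠ k := by
    intro i hi
    simp only [Finset.mem_erase] at hi
    tauto
  have hinv : ∀ i ∈ (I.erase j).erase k, ∀ x ∈ LinearMap.ker (A k - 1),
      (A i * A j) x ∈ LinearMap.ker (A k - 1) := by
    intro i hi
    obtain ⟨hiI, hij, hik⟩ := hmem i hi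
    exact mem_ker_of_commute (mul_pair_comm (hA.anti k hk i hiI hik.symm)
      (hA.anti k hk j hj hjk.symm))
  have hprod : ∀ m ∈ (I.erase j).erase k, ∀ i, A i * A j * (A m * A j) = A i * A m := by
    intro m hm i
    obtain ⟨hmI, hmj, hmk⟩ := hmem m hm
    rw [show A i * A j * (A m * A j) = A i * (A j * A m) * A j by simp only [mul_assoc],
      hA.anti j hj m hmI hmj.symm, mul_neg, neg_mul,
      show A i * (A m * A j) * A j = A i * A m * (A j * A j) by simp only [mul_assoc], hJ]
    simp
  have hcoe : ∀ i ∈ (I.erase j).erase k, ∀ m ∈ (I.erase j).erase k, ∀ x,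
      (((restr (LinearMap.ker (A k - 1)) (A i * A j) *
        restr (LinearMap.ker (A k - 1)) (A m * A j) :
          Module.End ℝ (LinearMap.ker (A k - 1))) x :) : V) = (A i * A m) x := by
    intro i hi m hm x
    rw [Module.End.mul_apply, coe_restr (hinv i hi), coe_restr (hinv m hm), ← Module.End.mul_apply,
      hprod m hm]
  constructor
  · intro i hi
    ext x
    rw [hcoe i hi i hi, hA.sq i (hmem i hi).1]
    simp
  · intro i hi m hm him
    ext x
    rw [hcoe i hi m hm, LinearMap.neg_apply, Submodule.coe_neg, hcoe m hm i hi,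
      hA.anti i (hmem i hi).1 m (hmem m hm).1 him, LinearMap.neg_apply]

/-- Multiplying each of the first four generators by the product of the four changes the signs of
their squares. -/
theorem IsClifford.isMixedClifford {R : Type*} [Ring R] {l : ℕ} (hl : 4 ≤ l) {J : ℕ → R}
    (hJ : IsClifford l J) : ∃ A : ℕ → R,
      IsMixedClifford (Finset.range l) (fun i => if i < 4 then 1 else -1) A := by
  obtain ⟨w, hw⟩ : ∃ w, w = J 0 * J 1 * (J 2 * J 3) := ⟨_, rfl⟩
  have hw2 : w * w = 1 := by
    have h1 := sq_mul_of_anticommute (hJ.sq 0 (by omega)) (hJ.sq 1 (by omega))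
      (hJ.anti 0 (by omega) 1 (by omega) (by omega))
    have h2 := sq_mul_of_anticommute (hJ.sq 2 (by omega)) (hJ.sq 3 (by omega))
      (hJ.anti 2 (by omega) 3 (by omega) (by omega))
    have h3 : J 2 * J 3 * (J 0 * J 1) = J 0 * J 1 * (J 2 * J 3) := by
      have e2 := mul_pair_comm (hJ.anti 2 (by omega) 0 (by omega) (by omega))
        (hJ.anti 2 (by omega) 1 (by omega) (by omega))
      have e3 := mul_pair_comm (hJ.anti 3 (by omega) 0 (by omega) (by omega))
        (hJ.anti 3 (by omega) 1 (by omega) (by omega))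
      rw [mul_assoc, e3, ← mul_assoc, e2, mul_assoc]
    rw [hw, show J 0 * J 1 * (J 2 * J 3) * (J 0 * J 1 * (J 2 * J 3)) =
      J 0 * J 1 * (J 2 * J 3 * (J 0 * J 1)) * (J 2 * J 3) by simp only [mul_assoc], h3,
      show J 0 * J 1 * (J 0 * J 1 * (J 2 * J 3)) * (J 2 * J 3) =
      J 0 * J 1 * (J 0 * J 1) * (J 2 * J 3 * (J 2 * J 3)) by simp only [mul_assoc], h1, h2]
    simp
  have hcomm : ∀ i < l, 4 ≤ i → J i * w = w * J i := by
    intro i hi hi4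
    have e1 := mul_pair_comm (hJ.anti i hi 0 (by omega) (by omega))
      (hJ.anti i hi 1 (by omega) (by omega))
    have e2 := mul_pair_comm (hJ.anti i hi 2 (by omega) (by omega))
      (hJ.anti i hi 3 (by omega) (by omega))
    rw [hw, ← mul_assoc, e1, mul_assoc, e2, ← mul_assoc]
  have hanti : ∀ i < 4, J i * w = -(w * J i) := by
    have key : ∀ a b : R, ∀ i, J i * a = -(a * J i) → J i * b = b * J i →
        J i * (a * b) = -(a * b * J i) ∧ J i * (b * a) = -(b * a * J i) := by
      intro a b i ha hb
      constructor
      · rw [← mul_assoc, ha, neg_mul, mul_assoc, hb, mul_assoc]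
      · rw [← mul_assoc, hb, mul_assoc, ha, mul_neg, mul_assoc]
    have self : ∀ i < 4, ∀ j < 4, i ≠ j → J i * (J i * J j) = -(J i * J j * J i) ∧
        J i * (J j * J i) = -(J j * J i * J i) := by
      intro i hi j hj hij
      have h := hJ.anti i (by omega) j (by omega) hij
      constructor
      · rw [h, mul_neg, ← mul_assoc, h]
      · rw [← mul_assoc, h, neg_mul]
    have other : ∀ i < 4, ∀ j < 4, ∀ k < 4, i ≠ j → i ≠ k → J i * (J j * J k) = J j * J k * J i :=
      fun i hi j hj k hk hij hik => mul_pair_comm (hJ.anti i (by omega) j (by omega) hij)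
        (hJ.anti i (by omega) k (by omega) hik)
    intro i hi
    rw [hw]
    interval_cases i
    · exact (key _ _ 0 (self 0 (by omega) 1 (by omega) (by omega)).1
        (other 0 (by omega) 2 (by omega) 3 (by omega) (by omega) (by omega))).1
    · exact (key _ _ 1 (self 1 (by omega) 0 (by omega) (by omega)).2
        (other 1 (by omega) 2 (by omega) 3 (by omega) (by omega) (by omega))).1
    · exact (key _ _ 2 (self 2 (by omega) 3 (by omega) (by omega)).1
        (other 2 (by omega) 0 (by omega) 1 (by omega) (by omega) (by omega))).2
    · exact (key _ _ 3 (self 3 (by omega) 2 (by omega) (by omega)).2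
        (other 3 (by omega) 0 (by omega) 1 (by omega) (by omega) (by omega))).2
  have hprod : ∀ i < 4, ∀ a : R, a * w * (J i * w) = -(a * J i) := by
    intro i hi a
    rw [show a * w * (J i * w) = a * (w * (J i * w)) by simp only [mul_assoc], hanti i hi, mul_neg,
      ← mul_assoc w w, hw2, one_mul, mul_neg]
  refine ⟨fun i => if i < 4 then J i * w else J i, ⟨fun i hi => ?_, fun i hi j hj hij => ?_⟩⟩
  · have hil := Finset.mem_range.1 hi
    by_cases h4 : i < 4
    · simp only [if_pos h4]
      rw [hprod i h4, hJ.sq i hil]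
      simp
    · simp only [if_neg h4]
      rw [hJ.sq i hil]
      simp
  · have hil := Finset.mem_range.1 hi
    have hjl := Finset.mem_range.1 hj
    have h := hJ.anti i hil j hjl hij
    by_cases h4 : i < 4 <;> by_cases h4' : j < 4
    · simp only [if_pos h4, if_pos h4']
      rw [hprod j h4', hprod i h4, h]
    · simp only [if_pos h4, if_neg h4']
      rw [mul_assoc, ← hcomm j hjl (by omega), ← mul_assoc, h, neg_mul, mul_assoc]
    · simp only [if_neg h4, if_pos h4']
      rw [← mul_assoc, h, neg_mul, mul_assoc, mul_assoc, hcomm i hil (by omega)]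
    · simp only [if_neg h4, if_neg h4']
      exact h

/-- Eight generators are removed as four pairs of opposite signs; each pair halves the dimension. -/
theorem dvd_finrank_add_eight {l N : ℕ}
    (hN : ∀ (W : Type u) [AddCommGroup W] [Module ℝ W] [FiniteDimensional ℝ W]
      (B : ℕ → Module.End ℝ W), IsClifford l B → N ∣ Module.finrank ℝ W)
    {V : Type u} [AddCommGroup V] [Module ℝ V] [FiniteDimensional ℝ V] {J : ℕ → Module.End ℝ V}
    (hJ : IsClifford (l + 8) J) : 16 * N ∣ Module.finrank ℝ V := by
  obtain ⟨A, hA⟩ := hJ.isMixedClifford (by omega)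
  obtain ⟨W₁, _, _, _, B₁, h₁, hB₁⟩ := hA.exists_half (j := 4) (k := 0) (by simp) (by simp)
    (by simp) (by simp)
  obtain ⟨W₂, _, _, _, B₂, h₂, hB₂⟩ := hB₁.exists_half (j := 5) (k := 1) (by simp) (by simp)
    (by simp) (by simp)
  obtain ⟨W₃, _, _, _, B₃, h₃, hB₃⟩ := hB₂.exists_half (j := 6) (k := 2) (by simp) (by simp)
    (by simp) (by simp)
  obtain ⟨W₄, _, _, _, B₄, h₄, hB₄⟩ := hB₃.exists_half (j := 7) (k := 3) (by simp) (by simp)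
    (by simp) (by simp)
  have h := hN W₄ (fun i => B₄ (i + 8))
    ⟨fun i hi => by
      rw [hB₄.sq (i + 8) (by simp; omega)]
      simp,
    fun i hi j hj hij => hB₄.anti (i + 8) (by simp; omega) (j + 8) (by simp; omega) (by omega)⟩
  obtain ⟨m, hm⟩ := h
  exact ⟨m, by rw [h₁, h₂, h₃, h₄, hm]; ring⟩

/-- The square of the determinant of `J` would be `-1` in an odd dimension. -/
theorem even_finrank_of_sq_eq_neg_one {V : Type*} [AddCommGroup V] [Module ℝ V]
    [FiniteDimensional ℝ V] {J : Module.End ℝ V} (hJ : J * J = -1) : 2 ∣ Module.finrank ℝ V := by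
  rw [← even_iff_two_dvd]
  by_contra hodd
  have h1 : LinearMap.det (J * J) = (-1 : ℝ) ^ Module.finrank ℝ V := by
    rw [hJ, ← neg_one_smul ℝ (1 : Module.End ℝ V), LinearMap.det_smul, map_one, mul_one]
  rw [map_mul, (Nat.not_even_iff_odd.1 hodd).neg_one_pow] at h1
  nlinarith [mul_self_nonneg (LinearMap.det J)]

/-- Two anticommuting square roots of `-1` define a quaternionic structure. -/
theorem four_dvd_finrank {V : Type*} [AddCommGroup V] [Module ℝ V] [FiniteDimensional ℝ V]
    {J : ℕ → Module.End ℝ V} (hJ : IsClifford 2 J) : 4 ∣ Module.finrank ℝ V := by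
  let q : QuaternionAlgebra.Basis (Module.End ℝ V) (-1 : ℝ) 0 (-1) :=
    { i := J 0
      j := J 1
      k := J 0 * J 1
      i_mul_i := by rw [hJ.sq 0 (by omega)]; simp
      j_mul_j := by rw [hJ.sq 1 (by omega)]; simp
      i_mul_j := rfl
      j_mul_i := by rw [hJ.anti 1 (by omega) 0 (by omega) (by omega)]; simp }
  let φ : Quaternion ℝ →ₐ[ℝ] Module.End ℝ V := QuaternionAlgebra.lift q
  let _ : Module (Quaternion ℝ) V := Module.compHom V φ.toRingHom
  have : IsScalarTower ℝ (Quaternion ℝ) V := ⟨fun r x v => by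
    change φ (r • x) v = r • φ x v
    rw [map_smul, LinearMap.smul_apply]⟩
  rw [← Module.finrank_mul_finrank ℝ (Quaternion ℝ) V, Quaternion.finrank_eq_four]
  exact dvd_mul_right _ _

/-- The involution `J 0 * J 1 * J 2` commutes with `J 0` and `J 1`, which act on its fixed space,
and anticommutes with `J 3`, so that this space is one half of the module. -/
theorem eight_dvd_finrank {V : Type*} [AddCommGroup V] [Module ℝ V] [FiniteDimensional ℝ V]
    {J : ℕ → Module.End ℝ V} (hJ : IsClifford 4 J) : 8 ∣ Module.finrank ℝ V := by
  have h01 := hJ.anti 0 (by omega) 1 (by omega) (by omega)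
  have hs : J 0 * J 1 * J 2 * (J 0 * J 1 * J 2) = 1 := by
    have e2 := mul_pair_comm (hJ.anti 2 (by omega) 0 (by omega) (by omega))
      (hJ.anti 2 (by omega) 1 (by omega) (by omega))
    rw [show J 0 * J 1 * J 2 * (J 0 * J 1 * J 2) = J 0 * J 1 * (J 2 * (J 0 * J 1)) * J 2 by
        simp only [mul_assoc], e2,
      show J 0 * J 1 * (J 0 * J 1 * J 2) * J 2 = J 0 * J 1 * (J 0 * J 1) * (J 2 * J 2) by
        simp only [mul_assoc],
      sq_mul_of_anticommute (hJ.sq 0 (by omega)) (hJ.sq 1 (by omega)) h01, hJ.sq 2 (by omega)]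
    simp
  have hK : J 3 * (J 0 * J 1 * J 2) = -(J 0 * J 1 * J 2 * J 3) := by
    rw [← mul_assoc, mul_pair_comm (hJ.anti 3 (by omega) 0 (by omega) (by omega))
      (hJ.anti 3 (by omega) 1 (by omega) (by omega)), mul_assoc,
      hJ.anti 3 (by omega) 2 (by omega) (by omega), mul_neg, ← mul_assoc]
  have hcomm : ∀ i < 2, J 0 * J 1 * J 2 * J i = J i * (J 0 * J 1 * J 2) := by
    intro i hi
    interval_cases i
    · have h := mul_pair_comm h01 (hJ.anti 0 (by omega) 2 (by omega) (by omega))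
      rw [mul_assoc (J 0), mul_assoc (J 0), h]
    · have h12 := hJ.anti 2 (by omega) 1 (by omega) (by omega)
      have h10 := hJ.anti 1 (by omega) 0 (by omega) (by omega)
      rw [mul_assoc, h12, ← mul_assoc, ← mul_assoc, h10]
      simp only [mul_neg, neg_mul, mul_assoc]
  obtain ⟨m, hm⟩ := four_dvd_finrank ((hJ.mono (by omega : 2 ≤ 4)).restr
    fun i hi => mem_ker_of_commute (hcomm i hi))
  exact ⟨m, by rw [finrank_eq_two_mul_of_anticommute hs (hJ.sq 3 (by omega)) hK, hm]; ring⟩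

theorem n₀_add_eight (l : ℕ) : n₀ (l + 8) = 16 * n₀ l := by
  unfold n₀
  rw [Nat.add_mod_right, Nat.add_div_right _ (by norm_num),
    show 4 * (l / 8).succ = 4 + 4 * (l / 8) by omega, add_assoc, pow_add]
  norm_num

/-- The dimension of a Clifford module is a multiple of `n₀`. -/
theorem n₀_dvd_finrank (l : ℕ) : ∀ (V : Type u) [AddCommGroup V] [Module ℝ V]
    [FiniteDimensional ℝ V] (J : ℕ → Module.End ℝ V), IsClifford l J →
    n₀ l ∣ Module.finrank ℝ V := by
  induction l using Nat.strong_induction_on with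
  | _ l ih =>
  intro V _ _ _ J hJ
  by_cases hl : 8 ≤ l
  · obtain ⟨m, rfl⟩ := Nat.exists_eq_add_of_le' hl
    rw [n₀_add_eight]
    exact dvd_finrank_add_eight (ih m (by omega)) hJ
  have h2 : 2 ≤ l → 4 ∣ Module.finrank ℝ V := fun h => four_dvd_finrank (hJ.mono h)
  have h4 : 4 ≤ l → 8 ∣ Module.finrank ℝ V := fun h => eight_dvd_finrank (hJ.mono h)
  have h1 : 1 ≤ l → 2 ∣ Module.finrank ℝ V := fun h =>
    even_finrank_of_sq_eq_neg_one (hJ.sq 0 (by omega))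
  push Not at hl
  interval_cases l <;> simp [n₀] at * <;> assumption

/-! ### Models of the least dimension -/

section

open scoped Kronecker

section Models

variable {ι κ : Type*} [Fintype ι] [DecidableEq ι] [Fintype κ] [DecidableEq κ]

/-- A Clifford family of skew-symmetric real matrices. -/
structure IsMatrixClifford (l : ℕ) (J : ℕ → Matrix ι ι ℝ) : Prop extends IsClifford l J where
  transpose : ∀ i < l, (J i).transpose = -J i

theorem IsMatrixClifford.mono {l m : ℕ} {J : ℕ → Matrix ι ι ℝ} (hJ : IsMatrixClifford l J)
    (h : m ≤ l) : IsMatrixClifford m J :=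
  ⟨hJ.toIsClifford.mono h, fun i hi => hJ.transpose i (by omega)⟩

theorem neg_kronecker' {ι κ : Type*} (A : Matrix ι ι ℝ) (B : Matrix κ κ ℝ) :
    (-A) ⊗ₖ B = -(A ⊗ₖ B) := by
  ext; simp

theorem kronecker_neg' {ι κ : Type*} (A : Matrix ι ι ℝ) (B : Matrix κ κ ℝ) :
    A ⊗ₖ (-B) = -(A ⊗ₖ B) := by
  ext; simp

theorem transpose_kronecker' {ι κ : Type*} (A : Matrix ι ι ℝ) (B : Matrix κ κ ℝ) :
    (A ⊗ₖ B).transpose = A.transpose ⊗ₖ B.transpose := by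
  ext; simp

/-- The graded tensor product of a Clifford family `J` and a Clifford family `E` with a grading
operator `η`. -/
theorem IsMatrixClifford.tensor {l m : ℕ} {J : ℕ → Matrix ι ι ℝ} (hJ : IsMatrixClifford l J)
    {E : ℕ → Matrix κ κ ℝ} (hE : IsMatrixClifford m E) {η : Matrix κ κ ℝ} (hη : η * η = 1)
    (hηt : η.transpose = η) (hηE : ∀ i < m, η * E i = -(E i * η)) :
    IsMatrixClifford (l + m) (fun i => if i < l then J i ⊗ₖ η else 1 ⊗ₖ E (i - l)) := by
  refine ⟨⟨fun i hi => ?_, fun i hi j hj hij => ?_⟩, fun i hi => ?_⟩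
  · by_cases h : i < l
    · simp only [if_pos h, ← Matrix.mul_kronecker_mul, hJ.sq i h, hη, neg_kronecker',
        Matrix.one_kronecker_one]
    · simp only [if_neg h, ← Matrix.mul_kronecker_mul, hE.sq (i - l) (by omega), kronecker_neg',
        Matrix.one_kronecker_one, one_mul]
  · by_cases h : i < l <;> by_cases h' : j < l
    · simp only [if_pos h, if_pos h', ← Matrix.mul_kronecker_mul, hJ.anti i h j h' hij,
        neg_kronecker']
    · simp only [if_pos h, if_neg h', ← Matrix.mul_kronecker_mul, hηE (j - l) (by omega), one_mul,
        mul_one, kronecker_neg']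
    · simp only [if_neg h, if_pos h', ← Matrix.mul_kronecker_mul, hηE (i - l) (by omega), one_mul,
        mul_one, kronecker_neg', neg_neg]
    · simp only [if_neg h, if_neg h', ← Matrix.mul_kronecker_mul,
        hE.anti (i - l) (by omega) (j - l) (by omega) (by omega), one_mul, kronecker_neg']
  · by_cases h : i < l
    · simp only [if_pos h, transpose_kronecker', hJ.transpose i h, hηt, neg_kronecker']
    · simp only [if_neg h, transpose_kronecker', hE.transpose (i - l) (by omega), kronecker_neg',
        Matrix.transpose_one]

/-- The rotation by a right angle of the plane. -/
def matE : Matrix (Fin 2) (Fin 2) ℝ := !![0, -1; 1, 0]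

/-- The reflection of the plane that exchanges the coordinates. -/
def matB : Matrix (Fin 2) (Fin 2) ℝ := !![0, 1; 1, 0]

/-- The reflection of the plane in the first axis. -/
def matC : Matrix (Fin 2) (Fin 2) ℝ := !![1, 0; 0, -1]

theorem matE_sq : matE * matE = -1 := by ext i j; fin_cases i <;> fin_cases j <;> simp [matE]
theorem matB_sq : matB * matB = 1 := by ext i j; fin_cases i <;> fin_cases j <;> simp [matB]
theorem matC_sq : matC * matC = 1 := by ext i j; fin_cases i <;> fin_cases j <;> simp [matC]
theorem matB_mul_matE : matB * matE = -(matE * matB) := by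
  ext i j; fin_cases i <;> fin_cases j <;> simp [matB, matE]
theorem matC_mul_matE : matC * matE = -(matE * matC) := by
  ext i j; fin_cases i <;> fin_cases j <;> simp [matC, matE]
theorem matB_mul_matC : matB * matC = -(matC * matB) := by
  ext i j; fin_cases i <;> fin_cases j <;> simp [matC, matB]
theorem matE_transpose : matE.transpose = -matE := by
  ext i j; fin_cases i <;> fin_cases j <;> simp [matE]
theorem matB_transpose : matB.transpose = matB := by
  ext i j; fin_cases i <;> fin_cases j <;> simp [matB]
theorem matC_transpose : matC.transpose = matC := by
  ext i j; fin_cases i <;> fin_cases j <;> simp [matC]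

theorem isMatrixClifford_matE : IsMatrixClifford 1 (fun _ => matE) :=
  ⟨⟨fun _ _ => matE_sq, fun i hi j hj hij => by omega⟩, fun _ _ => matE_transpose⟩

/-- Two commuting Clifford families combine into one. -/
theorem IsMatrixClifford.combine {l m : ℕ} {J K : ℕ → Matrix ι ι ℝ} (hJ : IsMatrixClifford l J)
    (hK : IsMatrixClifford m K) (hJK : ∀ i < l, ∀ j < m, J i * K j = K j * J i) :
    IsMatrixClifford (l + m + 1) (fun i => if i < l then J i ⊗ₖ matB else
      if i < l + m then K (i - l) ⊗ₖ matC else 1 ⊗ₖ matE) := by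
  refine ⟨⟨fun i hi => ?_, fun i hi j hj hij => ?_⟩, fun i hi => ?_⟩
  · by_cases h : i < l
    · simp only [if_pos h, ← Matrix.mul_kronecker_mul, hJ.sq i h, matB_sq, neg_kronecker',
        Matrix.one_kronecker_one]
    by_cases h2 : i < l + m
    · simp only [if_neg h, if_pos h2, ← Matrix.mul_kronecker_mul, hK.sq (i - l) (by omega), matC_sq,
        neg_kronecker', Matrix.one_kronecker_one]
    · simp only [if_neg h, if_neg h2, ← Matrix.mul_kronecker_mul, matE_sq, kronecker_neg',
        Matrix.one_kronecker_one, one_mul]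
  · wlog hlt : i < j generalizing i j
    · rw [this j hj i hi hij.symm (by omega), neg_neg]
    by_cases h : i < l
    · by_cases h' : j < l
      · simp only [if_pos h, if_pos h', ← Matrix.mul_kronecker_mul, hJ.anti i h j h' hij,
          neg_kronecker']
      by_cases h2' : j < l + m
      · simp only [if_pos h, if_neg h', if_pos h2', ← Matrix.mul_kronecker_mul,
          hJK i h (j - l) (by omega), matB_mul_matC, kronecker_neg']
      · simp only [if_pos h, if_neg h', if_neg h2', ← Matrix.mul_kronecker_mul, matB_mul_matE,
          kronecker_neg', one_mul, mul_one]
    · have h' : ¬ j < l := by omega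
      have h2 : i < l + m := by omega
      by_cases h2' : j < l + m
      · simp only [if_neg h, if_pos h2, if_neg h', if_pos h2', ← Matrix.mul_kronecker_mul,
          hK.anti (i - l) (by omega) (j - l) (by omega) (by omega), neg_kronecker']
      · simp only [if_neg h, if_pos h2, if_neg h', if_neg h2', ← Matrix.mul_kronecker_mul,
          matC_mul_matE, kronecker_neg', one_mul, mul_one]
  · by_cases h : i < l
    · simp only [if_pos h, transpose_kronecker', hJ.transpose i h, matB_transpose, neg_kronecker']
    by_cases h2 : i < l + m
    · simp only [if_neg h, if_pos h2, transpose_kronecker', hK.transpose (i - l) (by omega),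
        matC_transpose, neg_kronecker']
    · simp only [if_neg h, if_neg h2, transpose_kronecker', matE_transpose, kronecker_neg',
        Matrix.transpose_one]

/-- Left multiplications by the imaginary quaternion units. The entries are integers, so that the
relations are decidable. -/
def quatLeft (i : ℕ) : Matrix (Fin 4) (Fin 4) ℤ :=
  if i = 0 then !![0, -1, 0, 0; 1, 0, 0, 0; 0, 0, 0, -1; 0, 0, 1, 0]
  else if i = 1 then !![0, 0, -1, 0; 0, 0, 0, 1; 1, 0, 0, 0; 0, -1, 0, 0]
  else !![0, 0, 0, -1; 0, 0, -1, 0; 0, 1, 0, 0; 1, 0, 0, 0]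

/-- Right multiplications by the imaginary quaternion units. -/
def quatRight (i : ℕ) : Matrix (Fin 4) (Fin 4) ℤ :=
  if i = 0 then !![0, -1, 0, 0; 1, 0, 0, 0; 0, 0, 0, 1; 0, 0, -1, 0]
  else if i = 1 then !![0, 0, -1, 0; 0, 0, 0, -1; 1, 0, 0, 0; 0, 1, 0, 0]
  else !![0, 0, 0, -1; 0, 0, 1, 0; 0, -1, 0, 0; 1, 0, 0, 0]

theorem isMatrixClifford_of_int {l : ℕ} {J : ℕ → Matrix ι ι ℤ} (hJ : IsClifford l J)
    (ht : ∀ i < l, (J i).transpose = -J i) :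
    IsMatrixClifford l (fun i => (Int.castRingHom ℝ).mapMatrix (J i)) :=
  ⟨hJ.map _, fun i hi => by
    rw [← map_neg, ← ht i hi]
    rfl⟩

theorem isMatrixClifford_quatLeft :
    IsMatrixClifford 3 (fun i => (Int.castRingHom ℝ).mapMatrix (quatLeft i)) :=
  isMatrixClifford_of_int ⟨by decide, by decide⟩ (by decide)

theorem isMatrixClifford_quatRight :
    IsMatrixClifford 3 (fun i => (Int.castRingHom ℝ).mapMatrix (quatRight i)) :=
  isMatrixClifford_of_int ⟨by decide, by decide⟩ (by decide)

theorem quatLeft_comm_quatRight : ∀ i < 3, ∀ j < 3,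
    quatLeft i * quatRight j = quatRight j * quatLeft i := by decide

/-- The left and the right multiplications of the quaternions commute and combine into seven
generators on `ℝ^8`. -/
theorem exists_model_seven : ∃ J : ℕ → Matrix (Fin 4 × Fin 2) (Fin 4 × Fin 2) ℝ,
    IsMatrixClifford 7 J :=
  ⟨_, isMatrixClifford_quatLeft.combine isMatrixClifford_quatRight fun i hi j hj => by
    rw [← map_mul, quatLeft_comm_quatRight i hi j hj, map_mul]⟩

/-- A skew-symmetric Clifford family on `ℝ^(n₀ l)`. For `l < 8` it is part of the families of `1`,
`3` and `7` generators given by the complex numbers and the quaternions; eight further generators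
are added by the graded tensor product with a family on `ℝ^16`, for which `η` is a grading. -/
theorem exists_model (l : ℕ) : ∃ (ι : Type) (_ : Fintype ι) (_ : DecidableEq ι),
    Fintype.card ι = n₀ l ∧ ∃ J : ℕ → Matrix ι ι ℝ, IsMatrixClifford l J := by
  obtain ⟨J7, hJ7⟩ := exists_model_seven
  induction l using Nat.strong_induction_on with
  | _ l ih =>
  by_cases hl : 8 ≤ l
  · obtain ⟨m, rfl⟩ := Nat.exists_eq_add_of_le' hl
    obtain ⟨ι, _, _, hι, J, hJ⟩ := ih m (by omega)
    have h8 := hJ7.tensor isMatrixClifford_matE matB_sq matB_transpose fun _ _ => matB_mul_matE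
    refine ⟨ι × ((Fin 4 × Fin 2) × Fin 2), inferInstance, inferInstance, ?_, _,
      hJ.tensor h8 (η := 1 ⊗ₖ matC) ?_ ?_ ?_⟩
    · rw [n₀_add_eight, Fintype.card_prod, hι]
      simp [mul_comm]
    · rw [← Matrix.mul_kronecker_mul, matC_sq, one_mul, Matrix.one_kronecker_one]
    · rw [transpose_kronecker', matC_transpose, Matrix.transpose_one]
    · intro i hi
      by_cases h : i < 7
      · simp only [if_pos h, ← Matrix.mul_kronecker_mul, one_mul, mul_one, matB_mul_matC,
          kronecker_neg', neg_neg]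
      · simp only [if_neg h, ← Matrix.mul_kronecker_mul, one_mul, matC_mul_matE, kronecker_neg']
  push Not at hl
  have h0 : l = 0 → n₀ l = 1 := by rintro rfl; rfl
  have h1 : l = 1 → n₀ l = 2 := by rintro rfl; rfl
  have h3 : l = 2 ∨ l = 3 → n₀ l = 4 := by rintro (rfl | rfl) <;> rfl
  have h7 : 4 ≤ l → n₀ l = 8 := fun h => by interval_cases l <;> rfl
  rcases Nat.lt_or_ge l 4 with h4 | h4
  · rcases Nat.lt_or_ge l 2 with h2 | h2
    · rcases Nat.eq_zero_or_pos l with rfl | hpos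
      · exact ⟨Unit, inferInstance, inferInstance, rfl, 0, ⟨by simp, by simp⟩, by simp⟩
      · exact ⟨Fin 2, inferInstance, inferInstance, (h1 (by omega)).symm, _,
          isMatrixClifford_matE.mono (by omega)⟩
    · exact ⟨Fin 4, inferInstance, inferInstance, (h3 (by omega)).symm, _,
        isMatrixClifford_quatLeft.mono (by omega)⟩
  · exact ⟨Fin 4 × Fin 2, inferInstance, inferInstance, by rw [h7 h4]; rfl, _,
      hJ7.mono (by omega)⟩

end Models

end

/-! ### The volume element -/

section Volume

variable {R : Type*} [Ring R] {l : ℕ} {J : ℕ → R}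

/-- The square of the volume element, the product of all the generators. -/
theorem IsClifford.volume_sq (hJ : IsClifford l J) :
    word J (Finset.range l) * word J (Finset.range l)
      = (-1 : ℤ) ^ (∑ i ∈ Finset.range (l + 1), i) • (1 : R) := by
  induction l with
  | zero => simp [word_empty]
  | succ l ih =>
    have h := hJ.mul_word (S := Finset.range l) (Finset.range_subset_range.2 l.le_succ) (i := l)
      (by omega)
    rw [Finset.erase_eq_of_notMem Finset.notMem_range_self, Finset.card_range] at h
    have h' : word J (Finset.range l) * J l = (-1 : ℤ) ^ l • (J l * word J (Finset.range l)) := by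
      rw [h, smul_smul, ← mul_pow]
      simp
    rw [Finset.range_add_one, word_insert _ fun b hb => Finset.mem_range.1 hb,
      Finset.sum_range_succ _ (l + 1),
      show J l * word J (Finset.range l) * (J l * word J (Finset.range l))
        = J l * (word J (Finset.range l) * J l) * word J (Finset.range l) by simp only [mul_assoc],
      h', mul_smul_comm, smul_mul_assoc, ← mul_assoc, hJ.sq l (by omega), mul_assoc,
      ih (hJ.mono l.le_succ), pow_add, pow_succ]
    simp [mul_comm]

theorem IsClifford.volume_sq_of_three (hJ : IsClifford l J) (hl : l % 4 = 3) :
    word J (Finset.range l) * word J (Finset.range l) = 1 := by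
  obtain ⟨k, rfl⟩ : ∃ k, l = 4 * k + 3 := ⟨l / 4, by omega⟩
  have h : Even (∑ i ∈ Finset.range (4 * k + 3 + 1), i) := by
    rw [Finset.sum_range_id, show (4 * k + 3 + 1) * (4 * k + 3 + 1 - 1)
      = 2 * (2 * ((k + 1) * (4 * k + 3))) by rw [Nat.add_sub_cancel]; ring,
      Nat.mul_div_cancel_left _ two_pos]
    exact even_two_mul _
  rw [hJ.volume_sq, h.neg_one_pow, one_smul]

theorem IsClifford.volume_sq_of_one (hJ : IsClifford l J) (hl : l % 4 = 1) :
    word J (Finset.range l) * word J (Finset.range l) = -1 := by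
  obtain ⟨k, rfl⟩ : ∃ k, l = 4 * k + 1 := ⟨l / 4, by omega⟩
  have h : Odd (∑ i ∈ Finset.range (4 * k + 1 + 1), i) := by
    rw [Finset.sum_range_id, show (4 * k + 1 + 1) * (4 * k + 1 + 1 - 1)
      = 2 * ((2 * k + 1) * (4 * k + 1)) by rw [Nat.add_sub_cancel]; ring,
      Nat.mul_div_cancel_left _ two_pos]
    exact Odd.mul ⟨k, rfl⟩ ⟨2 * k, by ring⟩
  rw [hJ.volume_sq, h.neg_one_pow, neg_one_smul]

/-- If `l` is odd, the product of all the generators is central. -/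
theorem IsClifford.mul_volume (hJ : IsClifford l J) (hl : Odd l) {i : ℕ} (hi : i < l) :
    J i * word J (Finset.range l) = word J (Finset.range l) * J i := by
  have h : Even ((Finset.range l).erase i).card := by
    rw [Finset.card_erase_of_mem (Finset.mem_range.2 hi), Finset.card_range]
    exact hl.tsub_odd odd_one
  rw [hJ.mul_word subset_rfl hi, h.neg_one_pow, one_smul]

end Volume

section VolumeTrace

variable {l : ℕ}

/-- For `l ≡ 1` modulo `4` the product of the generators is a skew-adjoint square root of `-1`. -/
theorem IsSkewClifford.trace_volume_of_one {V : Type*} [NormedAddCommGroup V]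
    [InnerProductSpace ℝ V] [FiniteDimensional ℝ V] {J : ℕ → Module.End ℝ V}
    (hJ : IsSkewClifford l J) (hl : l % 4 = 1) :
    LinearMap.trace ℝ V (word J (Finset.range l)) = 0 := by
  have h1 := hJ.volume_sq_of_one hl
  have h2 : wordInv J (Finset.range l) = -word J (Finset.range l) := by
    have h3 := hJ.toIsClifford.word_mul_wordInv (S := Finset.range l) subset_rfl
    calc wordInv J (Finset.range l)
        = -(word J (Finset.range l) * word J (Finset.range l)) * wordInv J (Finset.range l) := by
          rw [h1, neg_neg, one_mul]
      _ = -word J (Finset.range l) := by rw [neg_mul, mul_assoc, h3, mul_one]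
  have h3 := hJ.trace_wordInv (S := Finset.range l) subset_rfl
  rw [h2, map_neg] at h3
  linarith

/-- For `l ≡ 3` modulo `4` a Clifford module splits into the eigenspaces, for the eigenvalues `1`
and `-1`, of the product of the generators. -/
theorem IsClifford.exists_trace_volume {V : Type*} [AddCommGroup V] [Module ℝ V]
    [FiniteDimensional ℝ V] {J : ℕ → Module.End ℝ V} (hJ : IsClifford l J) (hl : l % 4 = 3) :
    ∃ p q : ℕ, Module.finrank ℝ V = n₀ l * (p + q) ∧
      LinearMap.trace ℝ V (word J (Finset.range l)) = n₀ l * ((p : ℝ) - q) := by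
  obtain ⟨w, hw⟩ : ∃ w, w = word J (Finset.range l) := ⟨_, rfl⟩
  have hsq : ∀ x, w (w x) = x := fun x => by
    rw [hw]
    exact DFunLike.congr_fun (hJ.volume_sq_of_three hl) x
  have hcomm : ∀ i < l, ∀ x, w (J i x) = J i (w x) := fun i hi x => by
    rw [hw]
    exact (DFunLike.congr_fun (hJ.mul_volume (Nat.odd_iff.2 (by omega)) hi) x).symm
  let W : Submodule ℝ V := LinearMap.ker (w - 1)
  let W' : Submodule ℝ V := LinearMap.ker (w + 1)
  have mW : ∀ x, x ∈ W ↔ w x = x := fun x => by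
    rw [LinearMap.mem_ker, LinearMap.sub_apply, Module.End.one_apply, sub_eq_zero]
  have mW' : ∀ x, x ∈ W' ↔ w x = -x := fun x => by
    rw [LinearMap.mem_ker, LinearMap.add_apply, Module.End.one_apply, add_eq_zero_iff_eq_neg]
  have hW : ∀ i < l, ∀ x ∈ W, J i x ∈ W := fun i hi x hx => by
    rw [mW] at hx ⊢
    rw [hcomm i hi, hx]
  have hW' : ∀ i < l, ∀ x ∈ W', J i x ∈ W' := fun i hi x hx => by
    rw [mW'] at hx ⊢
    rw [hcomm i hi, hx, map_neg]
  have hc : IsCompl W W' := by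
    refine IsCompl.of_eq ?_ ?_
    · rw [Submodule.eq_bot_iff]
      rintro x ⟨h1, h2⟩
      have h3 : x = -x := ((mW x).1 h1).symm.trans ((mW' x).1 h2)
      have h4 : (2 : ℝ) • x = 0 := by rw [two_smul]; nth_rw 2 [h3]; exact add_neg_cancel x
      exact (smul_eq_zero.1 h4).resolve_left two_ne_zero
    · rw [Submodule.eq_top_iff']
      intro x
      refine Submodule.mem_sup.2 ⟨(2 : ℝ)⁻¹ • (x + w x), ?_, (2 : ℝ)⁻¹ • (x - w x), ?_, by module⟩
      · rw [mW, map_smul, map_add, hsq, add_comm]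
      · rw [mW', map_smul, map_sub, hsq]
        module
  obtain ⟨p, hp⟩ := n₀_dvd_finrank l W _ (hJ.restr hW)
  obtain ⟨q, hq⟩ := n₀_dvd_finrank l W' _ (hJ.restr hW')
  refine ⟨p, q, ?_, ?_⟩
  · rw [← Submodule.finrank_add_eq_of_isCompl hc, hp, hq, mul_add]
  · rw [trace_eq_add_of_isCompl hc (B := (1 : Module.End ℝ W)) (B' := (-1 : Module.End ℝ W')),
      map_neg, LinearMap.trace_one, LinearMap.trace_one, hp, hq]
    · push_cast
      ring
    · intro x
      rw [← hw, (mW x).1 x.2]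
      rfl
    · intro x
      rw [← hw, (mW' x).1 x.2]
      rfl

/-- Only the empty word and, for odd `l`, the full word contribute to the dimension of a space of
intertwining operators. -/
theorem IsClifford.finrank_intertwiners_eq {V V' : Type*} [AddCommGroup V] [Module ℝ V]
    [AddCommGroup V'] [Module ℝ V'] [FiniteDimensional ℝ V] [FiniteDimensional ℝ V']
    {J : ℕ → Module.End ℝ V} {J' : ℕ → Module.End ℝ V'} (hJ : IsClifford l J)
    (hJ' : IsClifford l J') :
    (2 : ℝ) ^ l * Module.finrank ℝ (intertwiners l J' J)
      = Module.finrank ℝ V' * Module.finrank ℝ V + if Odd l then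
        LinearMap.trace ℝ V' (word J' (Finset.range l))
          * LinearMap.trace ℝ V (wordInv J (Finset.range l)) else 0 := by
  rw [finrank_intertwiners hJ hJ', ← Finset.add_sum_erase _ _ (Finset.empty_mem_powerset _),
    word_empty, wordInv_empty, LinearMap.trace_one, LinearMap.trace_one]
  congr 1
  split_ifs with h
  · have h0 : Finset.range l ≠ ∅ := by
      rw [Ne, Finset.range_eq_empty_iff]
      rintro rfl
      simp at h
    refine Finset.sum_eq_single_of_mem _
      (Finset.mem_erase.2 ⟨h0, Finset.mem_powerset.2 subset_rfl⟩) fun S hS hne => ?_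
    rw [Finset.mem_erase, Finset.mem_powerset] at hS
    rw [hJ'.trace_word hS.2 hS.1 fun h => hne h.2, zero_mul]
  · refine Finset.sum_eq_zero fun S hS => ?_
    rw [Finset.mem_erase, Finset.mem_powerset] at hS
    rw [hJ'.trace_word hS.2 hS.1 fun h' => h h'.1, zero_mul]

/-- A skew-adjoint Clifford family is determined, up to orthogonal equivalence, by the dimension
and by the trace of the product of all its members. -/
theorem IsSkewClifford.exists_linearIsometry {V V' : Type} [NormedAddCommGroup V]
    [InnerProductSpace ℝ V] [FiniteDimensional ℝ V] [NormedAddCommGroup V']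
    [InnerProductSpace ℝ V'] [FiniteDimensional ℝ V'] {J : ℕ → Module.End ℝ V}
    {J' : ℕ → Module.End ℝ V'} (hJ : IsSkewClifford l J) (hJ' : IsSkewClifford l J')
    (hdim : Module.finrank ℝ V = Module.finrank ℝ V')
    (h : l % 4 = 3 → LinearMap.trace ℝ V (word J (Finset.range l))
      = LinearMap.trace ℝ V' (word J' (Finset.range l))) :
    ∃ f : V →ₗᵢ[ℝ] V', ∀ i < l, ∀ x, f (J i x) = J' i (f x) := by
  refine exists_linearIsometry_of_trace_eq _ rfl hJ hJ' fun S hS => ?_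
  by_cases h0 : S = ∅
  · subst h0
    rw [word_empty, word_empty, LinearMap.trace_one, LinearMap.trace_one, hdim]
  by_cases h1 : Odd l ∧ S = Finset.range l
  · obtain ⟨ho, rfl⟩ := h1
    rw [Nat.odd_iff] at ho
    rcases (by omega : l % 4 = 1 ∨ l % 4 = 3) with h4 | h4
    · rw [hJ.trace_volume_of_one h4, hJ'.trace_volume_of_one h4]
    · exact h h4
  · rw [hJ.toIsClifford.trace_word hS h0 h1, hJ'.toIsClifford.trace_word hS h0 h1]

end VolumeTrace

/-! ### Spaces spanned by Clifford families -/

section Spaces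

variable {E : Type*} [NormedAddCommGroup E] [InnerProductSpace ℝ E] {l : ℕ}
  {J J' : ℕ → Module.End ℝ E}

/-- The space of operators spanned by a family `J 0, …, J (l - 1)`. -/
def famSpace (l : ℕ) (J : ℕ → Module.End ℝ E) : Submodule ℝ (Module.End ℝ E) :=
  Submodule.span ℝ (Set.range fun i : Fin l => J i)

theorem mem_famSpace {i : ℕ} (hi : i < l) : J i ∈ famSpace l J :=
  Submodule.subset_span ⟨⟨i, hi⟩, rfl⟩

theorem famSpace_le {U : Submodule ℝ (Module.End ℝ E)} (h : ∀ i < l, J i ∈ U) :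
    famSpace l J ≤ U :=
  Submodule.span_le.2 (by rintro _ ⟨i, rfl⟩; exact h i i.2)

theorem famSpace_neg : famSpace l (fun i => -J i) = famSpace l J :=
  le_antisymm (famSpace_le fun _ hi => neg_mem (mem_famSpace hi))
    (famSpace_le fun i hi => by simpa using neg_mem (mem_famSpace (J := fun i => -J i) hi))

theorem IsSkewClifford.neg (hJ : IsSkewClifford l J) : IsSkewClifford l (fun i => -J i) :=
  ⟨hJ.toIsClifford.neg, fun i hi x y => by
    rw [LinearMap.neg_apply, LinearMap.neg_apply, inner_neg_left, inner_neg_right, hJ.skew i hi]⟩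

theorem IsSkewClifford.inner_apply_self (hJ : IsSkewClifford l J) {i : ℕ} (hi : i < l) (x : E) :
    inner ℝ (J i x) (J i x) = inner ℝ x x := by
  have h : J i (J i x) = -x := DFunLike.congr_fun (hJ.sq i hi) x
  rw [hJ.skew i hi, h, inner_neg_right, neg_neg]

theorem IsSkewClifford.inner_apply_of_ne (hJ : IsSkewClifford l J) {i j : ℕ} (hi : i < l)
    (hj : j < l) (hij : i ≠ j) (x : E) : inner ℝ (J i x) (J j x) = 0 := by
  have h : J i (J j x) = -J j (J i x) := DFunLike.congr_fun (hJ.anti i hi j hj hij) x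
  have h1 := hJ.skew i hi x (J j x)
  have h2 := hJ.skew j hj x (J i x)
  rw [h, inner_neg_right, neg_neg] at h1
  rw [real_inner_comm] at h2
  linarith

/-- The span of a skew-adjoint Clifford family consists of multiples of isometries. -/
theorem IsSkewClifford.isCliffordSpace [Nontrivial E] (hJ : IsSkewClifford l J) :
    IsCliffordSpace l (famSpace l J) := by
  -- For each `x` the vectors `J i x` are orthogonal and as long as `x`.
  have hnorm : ∀ (a : Fin l → ℝ) (x : E), ‖(∑ i, a i • J i) x‖ ^ 2 = (∑ i, a i ^ 2) * ‖x‖ ^ 2 := by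
    intro a x
    rw [LinearMap.sum_apply, ← real_inner_self_eq_norm_sq, sum_inner, Finset.sum_mul]
    refine Finset.sum_congr rfl fun i _ => ?_
    rw [inner_sum, Finset.sum_eq_single i]
    · rw [LinearMap.smul_apply, real_inner_smul_left, real_inner_smul_right,
        hJ.inner_apply_self i.2, real_inner_self_eq_norm_sq]
      ring
    · intro j _ hj
      rw [LinearMap.smul_apply, LinearMap.smul_apply, real_inner_smul_left, real_inner_smul_right,
        hJ.inner_apply_of_ne i.2 j.2 fun h => hj (Fin.ext h.symm)]
      simp
    · simp
  refine ⟨?_, fun A hA => ⟨?_, ?_⟩⟩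
  · have hli : LinearIndependent ℝ fun i : Fin l => J i := by
      rw [Fintype.linearIndependent_iff]
      intro a ha i
      obtain ⟨x, hx⟩ := exists_ne (0 : E)
      have h := hnorm a x
      rw [ha, LinearMap.zero_apply, norm_zero, zero_pow two_ne_zero, eq_comm, mul_eq_zero,
        or_iff_left (by simpa using hx),
        Finset.sum_eq_zero_iff_of_nonneg fun i _ => sq_nonneg _] at h
      exact pow_eq_zero_iff two_ne_zero |>.1 (h i (Finset.mem_univ i))
    rw [famSpace, finrank_span_eq_card hli, Fintype.card_fin]
  · refine Submodule.span_induction (p := fun A _ => IsSkew A) ?_ ?_ ?_ ?_ hA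
    · rintro _ ⟨i, rfl⟩
      exact hJ.skew i i.2
    · intro x y
      simp
    · intro A B _ _ h h' x y
      rw [LinearMap.add_apply, LinearMap.add_apply, inner_add_left, inner_add_right, h, h', neg_add]
    · intro c A _ h x y
      rw [LinearMap.smul_apply, LinearMap.smul_apply, real_inner_smul_left, real_inner_smul_right,
        h, mul_neg]
  · obtain ⟨a, rfl⟩ := Submodule.mem_span_range_iff_exists_fun ℝ |>.1 hA
    refine ⟨Real.sqrt (∑ i, a i ^ 2), fun x => ?_⟩
    rw [← Real.sqrt_sq (norm_nonneg x), ← Real.sqrt_mul (Finset.sum_nonneg fun i _ => sq_nonneg _),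
      ← hnorm, Real.sqrt_sq (norm_nonneg _)]

/-- A skew-adjoint multiple of an isometry by `c` squares to `-c ^ 2`. -/
theorem IsSkew.mul_self_of_norm {A : Module.End ℝ E} (hA : IsSkew A) {c : ℝ}
    (hc : ∀ x, ‖A x‖ = c * ‖x‖) : A * A = -(c ^ 2) • 1 := by
  have hpol : ∀ x y, inner ℝ (A x) (A y) = c ^ 2 * inner ℝ x y := by
    intro x y
    have h1 := norm_add_sq_real (A x) (A y)
    rw [← map_add, hc, hc, hc] at h1
    have h2 := norm_add_sq_real x y
    rw [mul_pow, h2] at h1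
    linarith
  ext x
  refine ext_inner_right ℝ fun y => ?_
  rw [Module.End.mul_apply, hA, hpol, LinearMap.smul_apply, Module.End.one_apply,
    real_inner_smul_left, neg_mul]

/-- A space of skew-adjoint multiples of isometries has a basis that is a Clifford family: the
operators that carry a fixed unit vector to the members of an orthonormal basis. -/
theorem IsCliffordSpace.exists_isSkewClifford [Nontrivial E] [FiniteDimensional ℝ E]
    {U : Submodule ℝ (Module.End ℝ E)} (hU : IsCliffordSpace l U) :
    ∃ J : ℕ → Module.End ℝ E, IsSkewClifford l J ∧ famSpace l J = U := by
  obtain ⟨x₀, hx₀⟩ := exists_norm_eq E zero_le_one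
  let ev : U →ₗ[ℝ] E := LinearMap.applyₗ x₀ ∘ₗ U.subtype
  have hsq : ∀ A ∈ U, A * A = -(‖A x₀‖ ^ 2) • 1 := by
    intro A hA
    obtain ⟨hs, c, hc⟩ := hU.2 A hA
    rw [hs.mul_self_of_norm hc, hc x₀, hx₀, mul_one]
  have hinj : Function.Injective ev := by
    rw [← LinearMap.ker_eq_bot, LinearMap.ker_eq_bot']
    intro A hA
    obtain ⟨hs, c, hc⟩ := hU.2 A A.2
    have h0 : (A : Module.End ℝ E) x₀ = 0 := hA
    have hc0 : c = 0 := by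
      have := hc x₀
      rw [h0, hx₀, norm_zero, mul_one] at this
      exact this.symm
    ext x
    have := hc x
    rw [hc0, zero_mul, norm_eq_zero] at this
    exact this
  let e : U ≃ₗ[ℝ] LinearMap.range ev := LinearEquiv.ofInjective ev hinj
  have hdim : Module.finrank ℝ (LinearMap.range ev) = l := by rw [← e.finrank_eq, hU.1]
  let b : OrthonormalBasis (Fin l) ℝ (LinearMap.range ev) :=
    (stdOrthonormalBasis ℝ _).reindex (finCongr hdim)
  let B : Fin l → Module.End ℝ E := fun i => (e.symm (b i) : U)
  have hBU : ∀ i, B i ∈ U := fun i => (e.symm (b i)).2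
  have hBx : ∀ i, B i x₀ = b i := fun i => congrArg Subtype.val (e.apply_symm_apply (b i))
  have hon : ∀ i j, inner ℝ (B i x₀) (B j x₀) = if i = j then (1 : ℝ) else 0 := fun i j => by
    rw [hBx, hBx, ← Submodule.coe_inner]
    exact orthonormal_iff_ite.1 b.orthonormal i j
  have hsq1 : ∀ i, B i * B i = -1 := fun i => by
    rw [hsq _ (hBU i), ← real_inner_self_eq_norm_sq, hon, if_pos rfl, neg_one_smul]
  refine ⟨fun i => if h : i < l then B ⟨i, h⟩ else 0, ⟨⟨fun i hi => ?_, fun i hi j hj hij => ?_⟩,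
    fun i hi => ?_⟩, ?_⟩
  · simp only [dif_pos hi, hsq1]
  · -- The relation is the polarization of the formula for the square of a member of `U`.
    simp only [dif_pos hi, dif_pos hj]
    have h := hsq _ (add_mem (hBU ⟨i, hi⟩) (hBU ⟨j, hj⟩))
    rw [LinearMap.add_apply, norm_add_sq_real, ← real_inner_self_eq_norm_sq,
      ← real_inner_self_eq_norm_sq, hon, hon, hon, if_pos rfl, if_pos rfl,
      if_neg fun h => hij (Fin.mk.inj_iff.1 h), add_mul, mul_add, mul_add, hsq1, hsq1] at h
    have h2 : B ⟨i, hi⟩ * B ⟨j, hj⟩ + B ⟨j, hj⟩ * B ⟨i, hi⟩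
        = (-1 + B ⟨i, hi⟩ * B ⟨j, hj⟩ + (B ⟨j, hj⟩ * B ⟨i, hi⟩ + -1)) + (2 : ℝ) • 1 := by
      rw [two_smul]; abel
    rw [h, ← add_smul] at h2
    norm_num at h2
    exact eq_neg_of_add_eq_zero_left h2
  · simp only [dif_pos hi]
    exact (hU.2 _ (hBU _)).1
  · have h1 : (fun i : Fin l => if h : (i : ℕ) < l then B ⟨i, h⟩ else 0)
        = U.subtype ∘ (b.toBasis.map e.symm) := by
      funext i
      simp [B]
    rw [famSpace, h1, Set.range_comp, ← Submodule.map_span, Module.Basis.span_eq,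
      Submodule.map_subtype_top]

theorem IsSkewClifford.conj (hJ : IsSkewClifford l J) (A : E ≃ₗᵢ[ℝ] E) :
    IsSkewClifford l (fun i => A.toLinearEquiv.conj (J i)) := by
  refine ⟨hJ.toIsClifford.map (A.toLinearEquiv.conjRingEquiv).toRingHom, fun i hi x y => ?_⟩
  have h := hJ.skew i hi (A.symm x) (A.symm y)
  rw [← A.inner_map_map, ← A.inner_map_map (A.symm x), A.apply_symm_apply,
    A.apply_symm_apply] at h
  exact h

theorem famSpace_conj (A : E ≃ₗᵢ[ℝ] E) :
    famSpace l (fun i => A.toLinearEquiv.conj (J i))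
      = (famSpace l J).map (A.toLinearEquiv.conj : Module.End ℝ E →ₗ[ℝ] Module.End ℝ E) := by
  rw [famSpace, famSpace, Submodule.map_span, ← Set.range_comp]
  rfl

theorem isOrthConj_iff_map {U U' : Submodule ℝ (Module.End ℝ E)} :
    IsOrthConj U U' ↔ ∃ A : E ≃ₗᵢ[ℝ] E,
      U' = U.map (A.toLinearEquiv.conj : Module.End ℝ E →ₗ[ℝ] Module.End ℝ E) := by
  refine exists_congr fun A => ?_
  rw [Submodule.ext_iff]
  refine forall_congr' fun B => iff_congr Iff.rfl ?_
  rw [Submodule.mem_map_equiv]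
  rfl

theorem isOrthConj_of_linearIsometry [FiniteDimensional ℝ E] (f : E →ₗᵢ[ℝ] E)
    (h : ∀ i < l, ∀ x, f (J i x) = J' i (f x)) : IsOrthConj (famSpace l J) (famSpace l J') := by
  let A : E ≃ₗᵢ[ℝ] E := f.toLinearIsometryEquiv rfl
  have hA : ∀ i < l, A.toLinearEquiv.conj (J i) = J' i := by
    intro i hi
    ext x
    have h1 := h i hi (A.symm x)
    have h2 : f (A.symm x) = x := A.apply_symm_apply x
    rw [h2] at h1
    exact h1
  refine isOrthConj_iff_map.2 ⟨A, ?_⟩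
  rw [← famSpace_conj]
  refine le_antisymm (famSpace_le fun i hi => ?_) (famSpace_le fun i hi => ?_)
  · rw [← hA i hi]
    exact mem_famSpace (J := fun i => A.toLinearEquiv.conj (J i)) hi
  · rw [hA i hi]
    exact mem_famSpace hi

theorem mem_intertwiners_iff {L : Module.End ℝ E} :
    L ∈ intertwiners l J J ↔ ∀ B ∈ famSpace l J, B * L = L * B := by
  constructor
  · intro h B hB
    refine Submodule.span_induction (p := fun B _ => B * L = L * B) ?_ (by simp) ?_ ?_ hB
    · rintro _ ⟨i, rfl⟩
      exact h i i.2
    · intro B C _ _ hB hC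
      rw [add_mul, mul_add, hB, hC]
    · intro c B _ hB
      rw [smul_mul_assoc, mul_smul_comm, hB]
  · exact fun h i hi => h (J i) (mem_famSpace hi)

/-- The dimension of the commutant determines the trace of the product of the generators up to
sign, so that this trace depends, up to sign, only on the space that the generators span. -/
theorem IsSkewClifford.sq_trace_volume_eq [FiniteDimensional ℝ E] (hJ : IsSkewClifford l J)
    (hJ' : IsSkewClifford l J') (hl : Odd l) (h : famSpace l J = famSpace l J') :
    LinearMap.trace ℝ E (word J (Finset.range l)) ^ 2
      = LinearMap.trace ℝ E (word J' (Finset.range l)) ^ 2 := by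
  have h0 : intertwiners l J J = intertwiners l J' J' := by
    ext L
    rw [mem_intertwiners_iff, mem_intertwiners_iff, h]
  have h1 := hJ.toIsClifford.finrank_intertwiners_eq hJ.toIsClifford
  have h2 := hJ'.toIsClifford.finrank_intertwiners_eq hJ'.toIsClifford
  rw [if_pos hl, hJ.trace_wordInv subset_rfl, h0] at h1
  rw [if_pos hl, hJ'.trace_wordInv subset_rfl, h1] at h2
  rw [sq, sq]
  linarith

theorem trace_word_conj (A : E ≃ₗᵢ[ℝ] E) (S : Finset ℕ) :
    LinearMap.trace ℝ E (word (fun i => A.toLinearEquiv.conj (J i)) S)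
      = LinearMap.trace ℝ E (word J S) := by
  rw [← LinearMap.trace_conj' (word J S) A.toLinearEquiv]
  congr 1
  exact (map_word (A.toLinearEquiv.conjRingEquiv : Module.End ℝ E →* Module.End ℝ E) J S).symm

end Spaces

/-- Two spaces spanned by skew-adjoint Clifford families are orthogonally conjugate, except that
for `l ≡ 3` modulo `4` the absolute value of the trace of the volume element is an invariant. -/
theorem IsSkewClifford.isOrthConj_iff {E : Type} [NormedAddCommGroup E] [InnerProductSpace ℝ E]
    [FiniteDimensional ℝ E] {l : ℕ} {J J' : ℕ → Module.End ℝ E} (hJ : IsSkewClifford l J)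
    (hJ' : IsSkewClifford l J') : IsOrthConj (famSpace l J) (famSpace l J') ↔
      (l % 4 = 3 → LinearMap.trace ℝ E (word J (Finset.range l)) ^ 2
        = LinearMap.trace ℝ E (word J' (Finset.range l)) ^ 2) := by
  constructor
  · intro h hl
    obtain ⟨A, hA⟩ := isOrthConj_iff_map.1 h
    rw [← famSpace_conj] at hA
    rw [hJ'.sq_trace_volume_eq (hJ.conj A) (Nat.odd_iff.2 (by omega)) hA, trace_word_conj]
  · intro h
    by_cases hl : l % 4 = 3
    · rcases sq_eq_sq_iff_eq_or_eq_neg.1 (h hl) with h1 | h1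
      · obtain ⟨f, hf⟩ := hJ.exists_linearIsometry hJ' rfl fun _ => h1
        exact isOrthConj_of_linearIsometry f hf
      · -- The family `-J'` spans the same space, and the trace of its volume element has the
        -- opposite sign, since `l` is odd.
        have hodd : Odd (Finset.range l).card := by
          rw [Finset.card_range]
          exact Nat.odd_iff.2 (by omega)
        obtain ⟨f, hf⟩ := hJ.exists_linearIsometry hJ'.neg rfl fun _ => by
          rw [word_neg, hodd.neg_one_pow, neg_one_smul, map_neg, h1]
        rw [← famSpace_neg (J := J')]
        exact isOrthConj_of_linearIsometry f hf
    · obtain ⟨f, hf⟩ := hJ.exists_linearIsometry hJ' rfl fun h => absurd h hl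
      exact isOrthConj_of_linearIsometry f hf

/-! ### Multiples of a model -/

section

open scoped Kronecker

section MatrixFamilies

variable {ι κ : Type*} [Fintype ι] [DecidableEq ι] [Fintype κ] [DecidableEq κ] {l : ℕ}

theorem IsMatrixClifford.isSkewClifford {J : ℕ → Matrix ι ι ℝ} (hJ : IsMatrixClifford l J)
    {E : Type*} [NormedAddCommGroup E] [InnerProductSpace ℝ E] [FiniteDimensional ℝ E]
    (b : OrthonormalBasis ι ℝ E) :
    IsSkewClifford l (fun i => Matrix.toLinAlgEquiv b.toBasis (J i)) := by
  refine ⟨hJ.toIsClifford.map (Matrix.toLinAlgEquiv b.toBasis : _ ≃ₐ[ℝ] _).toRingEquiv.toRingHom,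
    fun i hi x y => ?_⟩
  have h := Matrix.toLin_conjTranspose b b (J i)
  rw [Matrix.conjTranspose_eq_transpose_of_trivial, hJ.transpose i hi, map_neg] at h
  have h1 := LinearMap.adjoint_inner_left (Matrix.toLin b.toBasis b.toBasis (J i)) y x
  rw [← h, LinearMap.neg_apply, inner_neg_left] at h1
  exact neg_eq_iff_eq_neg.1 h1

theorem trace_word_toLin {J : ℕ → Matrix ι ι ℝ} {E : Type*} [AddCommGroup E] [Module ℝ E]
    (b : Module.Basis ι ℝ E) (S : Finset ℕ) :
    LinearMap.trace ℝ E (word (fun i => Matrix.toLinAlgEquiv b (J i)) S)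
      = (word J S).trace := by
  rw [← Matrix.trace_toLin_eq _ b]
  congr 1
  exact (map_word ((Matrix.toLinAlgEquiv b : _ ≃ₐ[ℝ] _) : Matrix ι ι ℝ →* Module.End ℝ E) J S).symm

/-- Multiplying the generators by a symmetric involution that commutes with them. -/
theorem IsMatrixClifford.kronecker {J : ℕ → Matrix ι ι ℝ} (hJ : IsMatrixClifford l J)
    {D : Matrix κ κ ℝ} (hD : D * D = 1) (hDt : D.transpose = D) :
    IsMatrixClifford l (fun i => D ⊗ₖ J i) := by
  refine ⟨⟨fun i hi => ?_, fun i hi j hj hij => ?_⟩, fun i hi => ?_⟩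
  · rw [← Matrix.mul_kronecker_mul, hD, hJ.sq i hi, kronecker_neg', Matrix.one_kronecker_one]
  · rw [← Matrix.mul_kronecker_mul, hJ.anti i hi j hj hij, kronecker_neg',
      ← Matrix.mul_kronecker_mul]
  · rw [transpose_kronecker', hDt, hJ.transpose i hi, kronecker_neg']

theorem word_kronecker (D : Matrix κ κ ℝ) (J : ℕ → Matrix ι ι ℝ) (S : Finset ℕ) :
    word (fun i => D ⊗ₖ J i) S = (D ^ S.card) ⊗ₖ word J S := by
  induction S using Finset.induction_on_max with
  | empty => simp [word_empty]
  | insert k S hk ih =>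
    rw [word_insert _ hk, word_insert _ hk, ih,
      Finset.card_insert_of_notMem fun h => lt_irrefl _ (hk k h), pow_succ',
      Matrix.mul_kronecker_mul]

/-- The diagonal matrix of size `k` with `j` entries `1` and the others `-1`. -/
def signMatrix (k j : ℕ) : Matrix (Fin k) (Fin k) ℝ :=
  Matrix.diagonal fun a => if (a : ℕ) < j then 1 else -1

theorem signMatrix_sq (k j : ℕ) : signMatrix k j * signMatrix k j = 1 := by
  rw [signMatrix, Matrix.diagonal_mul_diagonal, ← Matrix.diagonal_one]
  congr 1
  funext a
  split_ifs <;> norm_num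

theorem trace_signMatrix {k j : ℕ} (h : j ≤ k) : (signMatrix k j).trace = 2 * j - k := by
  rw [signMatrix, Matrix.trace_diagonal, Fin.sum_univ_eq_sum_range
    (fun a => if a < j then (1 : ℝ) else -1) k, ← Finset.sum_range_add_sum_Ico _ h,
    Finset.sum_congr rfl fun a ha => if_pos (Finset.mem_range.1 ha),
    Finset.sum_congr rfl fun a ha => if_neg (Finset.mem_Ico.1 ha).1.not_gt]
  simp only [Finset.sum_const, Finset.card_range, Nat.card_Ico, nsmul_eq_mul, Nat.cast_sub h]
  ring

end MatrixFamilies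

theorem n₀_pos (l : ℕ) : 0 < n₀ l := by
  unfold n₀
  positivity

/-- The Clifford modules of dimension `k * n₀ l`: a sum of `j` copies of a module of dimension
`n₀ l` and `k - j` copies of the module with the opposite generators. -/
theorem exists_isSkewClifford {E : Type*} [NormedAddCommGroup E] [InnerProductSpace ℝ E]
    [FiniteDimensional ℝ E] {l k j : ℕ} (hjk : j ≤ k) (hk : Module.finrank ℝ E = k * n₀ l) :
    ∃ J : ℕ → Module.End ℝ E, IsSkewClifford l J ∧
      (l % 4 = 3 → LinearMap.trace ℝ E (word J (Finset.range l)) ^ 2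
        = ((n₀ l : ℝ) * (2 * j - k)) ^ 2) := by
  obtain ⟨ι, _, _, hι, J, hJ⟩ := exists_model l
  have hcard : Fintype.card (Fin (Module.finrank ℝ E)) = Fintype.card (Fin k × ι) := by
    rw [Fintype.card_prod, Fintype.card_fin, Fintype.card_fin, hι, hk]
  let b : OrthonormalBasis (Fin k × ι) ℝ E :=
    (stdOrthonormalBasis ℝ E).reindex (Fintype.equivOfCardEq hcard)
  refine ⟨_, (hJ.kronecker (signMatrix_sq k j) (Matrix.diagonal_transpose _)).isSkewClifford b,
    fun hl => ?_⟩
  have hpow : signMatrix k j ^ l = signMatrix k j := by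
    obtain ⟨m, hm⟩ := Nat.odd_iff.2 (by omega : l % 2 = 1)
    rw [hm, pow_succ, pow_mul, sq, signMatrix_sq, one_pow, one_mul]
  -- The volume element of a module of dimension `n₀ l` is `1` or `-1`.
  obtain ⟨p, q, h1, h2⟩ := (hJ.isSkewClifford (EuclideanSpace.basisFun ι ℝ)).exists_trace_volume hl
  rw [trace_word_toLin] at h2
  rw [finrank_euclideanSpace, hι, eq_comm, Nat.mul_eq_left (n₀_pos l).ne'] at h1
  have h3 : ((p : ℝ) - q) ^ 2 = 1 := by
    rcases (by omega : p = 1 ∧ q = 0 ∨ p = 0 ∧ q = 1) with ⟨rfl, rfl⟩ | ⟨rfl, rfl⟩ <;> norm_num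
  rw [trace_word_toLin, word_kronecker, Finset.card_range, hpow, Matrix.trace_kronecker,
    trace_signMatrix hjk, h2, mul_pow, mul_pow, mul_pow, h3]
  ring

end

/-! ### Classification of Clifford-Killing spaces -/

section

section Numerics

/-- Both conditions say that the exponent of the power `n₀ l` of `2` is at most the exponent of `2`
in `m`. -/
theorem n₀_dvd_iff {l m : ℕ} (hm : m ≠ 0) : n₀ l ∣ m ↔ l ≤ radonHurwitz m - 1 := by
  rw [n₀, padicValNat_dvd_iff_le hm, radonHurwitz]
  obtain ⟨v, hv⟩ : ∃ v, v = padicValNat 2 m := ⟨_, rfl⟩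
  rw [← hv]
  rcases (by omega : v % 4 = 0 ∨ v % 4 = 1 ∨ v % 4 = 2 ∨ v % 4 = 3) with h | h | h | h <;>
    rw [h] <;> split_ifs <;> omega

theorem radonHurwitz_eq {m α β m' : ℕ} (hβ : β ≤ 3) (hm' : Odd m')
    (hm : m = 2 ^ (4 * α + β) * m') : radonHurwitz m = 8 * α + 2 ^ β := by
  have hv : padicValNat 2 m = 4 * α + β := by
    rw [hm, padicValNat.mul (by positivity) hm'.pos.ne', padicValNat.prime_pow,
      padicValNat.eq_zero_of_not_dvd fun h => (Nat.not_even_iff_odd.2 hm') (even_iff_two_dvd.2 h),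
      add_zero]
  rw [radonHurwitz, hv, show (4 * α + β) / 4 = α by omega, show (4 * α + β) % 4 = β by omega]

/-- `8 * α + 2 ^ β - 1` is the largest `l` with `n₀ l = 2 ^ (4 * α + β)`. -/
theorem n₀_eq {α β : ℕ} (hβ : β ≤ 3) : n₀ (8 * α + 2 ^ β - 1) = 2 ^ (4 * α + β) := by
  unfold n₀
  congr 1
  interval_cases β <;> norm_num <;> omega

end Numerics

variable {d l : ℕ}

theorem finrank_amb (d : ℕ) : Module.finrank ℝ (Amb d) = d + 1 := by simp

theorem IsCK.exists_isSkewClifford {V : Submodule ℝ (Field d)} (hV : IsCK d l V) :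
    ∃ J : ℕ → Module.End ℝ (Amb d), IsSkewClifford l J ∧ famSpace l J = opSpace V :=
  hV.isCliffordSpace.exists_isSkewClifford

theorem IsSkewClifford.isCK (hl : 1 ≤ l) {J : ℕ → Module.End ℝ (Amb d)}
    (hJ : IsSkewClifford l J) : IsCK d l (fieldSpace (famSpace l J)) :=
  hJ.isCliffordSpace.isCK hl

theorem IsSkewClifford.opSpace_fieldSpace {J : ℕ → Module.End ℝ (Amb d)}
    (hJ : IsSkewClifford l J) : opSpace (fieldSpace (famSpace l J)) = famSpace l J :=
  CliffordKilling.opSpace_fieldSpace fun A hA => (hJ.isCliffordSpace.2 A hA).1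

/-- Clifford-Killing spaces exist exactly in the dimensions of the Clifford modules. -/
theorem exists_isCK_iff : (∃ V : Submodule ℝ (Field d), IsCK d l V) ↔ 1 ≤ l ∧ n₀ l ∣ d + 1 := by
  constructor
  · rintro ⟨V, hV⟩
    obtain ⟨J, hJ, -⟩ := hV.exists_isSkewClifford
    refine ⟨hV.1, ?_⟩
    rw [← finrank_amb d]
    exact n₀_dvd_finrank l _ J hJ.toIsClifford
  · rintro ⟨hl, k, hk⟩
    obtain ⟨J, hJ, -⟩ := CliffordKilling.exists_isSkewClifford (E := Amb d) (l := l) (k := k)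
      (Nat.zero_le k) (by rw [finrank_amb, hk, mul_comm])
    exact ⟨_, hJ.isCK hl⟩

theorem allEquivalent_of_ne_three (hl : l % 4 ≠ 3) : AllEquivalent d l := by
  intro V W hV hW
  obtain ⟨J, hJ, hJV⟩ := hV.exists_isSkewClifford
  obtain ⟨J', hJ', hJW⟩ := hW.exists_isSkewClifford
  rw [hV.equivalent_iff hW, ← hJV, ← hJW, hJ.isOrthConj_iff hJ']
  exact fun h => absurd h hl

/-- For `l ≡ 3` modulo `4` the equivalence classes correspond to the unordered pairs of
multiplicities of the two irreducible modules. -/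
theorem card_ckClasses (hl : l % 4 = 3) {k : ℕ} (hk : d + 1 = k * n₀ l) :
    Nat.card (CKClasses d l) = k / 2 + 1 := by
  have hpos : (0 : ℝ) < n₀ l := Nat.cast_pos.2 (n₀_pos l)
  choose J hJ ht using fun j : Fin (k / 2 + 1) =>
    CliffordKilling.exists_isSkewClifford (E := Amb d) (l := l) (k := k) (j := j) (by omega)
      (by rw [finrank_amb, hk])
  -- The traces `n₀ l * (2 * j - k)`, `0 ≤ j ≤ k`, have `k / 2 + 1` distinct absolute values,
  -- attained for `2 * j ≤ k`.
  let F : Fin (k / 2 + 1) → CKClasses d l := fun j =>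
    Quotient.mk _ ⟨fieldSpace (famSpace l (J j)), (hJ j).isCK (by omega)⟩
  have hF : Function.Bijective F := by
    constructor
    · intro i j hij
      have h : Equivalent (fieldSpace (famSpace l (J i))) (fieldSpace (famSpace l (J j))) :=
        Quotient.exact hij
      rw [((hJ i).isCK (by omega)).equivalent_iff ((hJ j).isCK (by omega)),
        (hJ i).opSpace_fieldSpace, (hJ j).opSpace_fieldSpace, (hJ i).isOrthConj_iff (hJ j)] at h
      have h := h hl
      rw [ht i hl, ht j hl, mul_pow, mul_pow, mul_right_inj' (by positivity)] at h
      rw [Fin.ext_iff]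
      have hi : 2 * (i : ℕ) ≤ k := by omega
      have hj : 2 * (j : ℕ) ≤ k := by omega
      have hi' : (2 * (i : ℕ) : ℝ) ≤ k := by exact_mod_cast hi
      have hj' : (2 * (j : ℕ) : ℝ) ≤ k := by exact_mod_cast hj
      have hij' : ((i : ℕ) : ℝ) = (j : ℕ) := by
        rcases sq_eq_sq_iff_eq_or_eq_neg.1 h with h | h <;> linarith
      exact_mod_cast hij'
    · intro c
      obtain ⟨⟨V, hV⟩, rfl⟩ := Quotient.exists_rep c
      obtain ⟨K, hK, hKV⟩ := hV.exists_isSkewClifford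
      obtain ⟨p, q, h1, h2⟩ := hK.toIsClifford.exists_trace_volume hl
      rw [finrank_amb, hk, mul_comm] at h1
      have hpq : k = p + q := Nat.eq_of_mul_eq_mul_left (n₀_pos l) h1
      have hmin : min p q < k / 2 + 1 := by omega
      refine ⟨⟨min p q, hmin⟩, Quotient.sound ?_⟩
      change Equivalent _ V
      rw [((hJ _).isCK (by omega)).equivalent_iff hV, (hJ _).opSpace_fieldSpace, ← hKV,
        (hJ _).isOrthConj_iff hK]
      intro _
      have hpq' : (k : ℝ) = p + q := by rw [hpq, Nat.cast_add]
      rw [ht _ hl, h2, mul_pow, mul_pow, hpq']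
      congr 1
      rcases le_total p q with h | h
      · rw [Fin.val_mk, min_eq_left h]
        ring
      · rw [Fin.val_mk, min_eq_right h]
        ring
  rw [← Nat.card_congr (Equiv.ofBijective F hF), Nat.card_fin]

theorem allEquivalent_iff {k : ℕ} (hl : 1 ≤ l) (hk : d + 1 = k * n₀ l) :
    AllEquivalent d l ↔ l % 4 ≠ 3 ∨ k = 1 := by
  by_cases h3 : l % 4 = 3
  · have h : AllEquivalent d l ↔ Nat.card (CKClasses d l) = 1 := by
      obtain ⟨V, hV⟩ := exists_isCK_iff.2 ⟨hl, Dvd.intro_left k hk.symm⟩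
      rw [Nat.card_eq_one_iff_unique, and_iff_left ⟨Quotient.mk _ ⟨V, hV⟩⟩]
      constructor
      · refine fun h => ⟨fun a b => ?_⟩
        induction a using Quotient.inductionOn with | _ a
        induction b using Quotient.inductionOn with | _ b
        exact Quotient.sound (h a.1 b.1 a.2 b.2)
      · intro h V W hV hW
        have e : (Quotient.mk _ ⟨V, hV⟩ : CKClasses d l) = Quotient.mk _ ⟨W, hW⟩ :=
          Subsingleton.elim _ _
        exact Quotient.exact e
    have hk0 : k ≠ 0 := by
      rintro rfl
      omega
    rw [h, card_ckClasses h3 hk]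
    omega
  · exact iff_of_true (allEquivalent_of_ne_three h3) (Or.inl h3)

end

/-! ### Simple modules over the Clifford algebra -/

section SimpleModules

variable {l : ℕ}

/-- Each vector lies in a finite-dimensional subspace that is invariant under the family. -/
theorem IsClifford.exists_invariant {M : Type*} [AddCommGroup M] [Module ℝ M]
    {A : ℕ → Module.End ℝ M} (hA : IsClifford l A) (m : M) :
    ∃ W : Submodule ℝ M, m ∈ W ∧ FiniteDimensional ℝ W ∧ ∀ i < l, ∀ x ∈ W, A i x ∈ W := by
  induction l with
  | zero =>
    exact ⟨Submodule.span ℝ {m}, Submodule.mem_span_singleton_self m, inferInstance, by simp⟩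
  | succ l ih =>
    obtain ⟨W, hm, hfin, hW⟩ := ih (hA.mono l.le_succ)
    refine ⟨W ⊔ W.map (A l), Submodule.mem_sup_left hm, inferInstance, fun i hi x hx => ?_⟩
    obtain ⟨y, hy, _, ⟨z, hz, rfl⟩, rfl⟩ := Submodule.mem_sup.1 hx
    rw [map_add]
    rcases Nat.lt_succ_iff_lt_or_eq.1 hi with h | rfl
    · have h1 : A i (A l z) = -A l (A i z) :=
        DFunLike.congr_fun (hA.anti i hi l (by omega) h.ne) z
      rw [h1]
      exact add_mem (Submodule.mem_sup_left (hW i h y hy))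
        (neg_mem (Submodule.mem_sup_right (Submodule.mem_map_of_mem (hW i h z hz))))
    · have h1 : A i (A i z) = -z := DFunLike.congr_fun (hA.sq i hi) z
      rw [h1]
      exact add_mem (Submodule.mem_sup_right (Submodule.mem_map_of_mem hy))
        (neg_mem (Submodule.mem_sup_left hz))

/-- The standard generators, indexed by `i < l`, of the Clifford algebra `Cl l`. -/
def clGen (l i : ℕ) : Cl l :=
  CliffordAlgebra.ι _ fun a : Fin l => if (a : ℕ) = i then (1 : ℝ) else 0

theorem isClifford_clGen : IsClifford l (clGen l) := by
  have hQ : ∀ v : Fin l → ℝ,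
      QuadraticMap.weightedSumSquares ℝ (fun _ : Fin l => (-1 : ℝ)) v = -∑ a, v a * v a := by
    intro v
    simp [QuadraticMap.weightedSumSquares_apply]
  have h1 : ∀ i < l, clGen l i * clGen l i = -1 := by
    intro i hi
    rw [clGen, CliffordAlgebra.ι_sq_scalar, hQ, Finset.sum_eq_single ⟨i, hi⟩]
    · simp
    · intro b _ hb
      simp [show (b : ℕ) ≠ i from fun h => hb (Fin.ext h)]
    · simp
  refine ⟨h1, fun i hi j hj hij => ?_⟩
  rw [clGen, clGen]
  refine eq_neg_of_add_eq_zero_left ?_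
  rw [CliffordAlgebra.ι_mul_ι_add_swap, QuadraticMap.polar, hQ, hQ, hQ]
  have h : ∑ a : Fin l, (((if (a : ℕ) = i then (1 : ℝ) else 0) + if (a : ℕ) = j then 1 else 0)
      * ((if (a : ℕ) = i then 1 else 0) + if (a : ℕ) = j then 1 else 0))
      = ∑ a : Fin l, ((if (a : ℕ) = i then (1 : ℝ) else 0) * if (a : ℕ) = i then 1 else 0)
        + ∑ a : Fin l, ((if (a : ℕ) = j then (1 : ℝ) else 0) * if (a : ℕ) = j then 1 else 0) := by
    rw [← Finset.sum_add_distrib]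
    refine Finset.sum_congr rfl fun a _ => ?_
    by_cases hai : (a : ℕ) = i
    · simp [hai, hij]
    · simp [hai]
  simp only [Pi.add_apply]
  rw [h, neg_add, add_sub_cancel_left, sub_self, map_zero]

variable {M : Type*} [AddCommGroup M] [Module ℝ M] [Module (Cl l) M]
  [IsScalarTower ℝ (Cl l) M]

theorem smul_mem_of_clGen_smul_mem {W : Submodule ℝ M} (hW : ∀ i < l, ∀ x ∈ W, clGen l i • x ∈ W)
    (a : Cl l) : ∀ x ∈ W, a • x ∈ W := by
  induction a using CliffordAlgebra.induction with
  | algebraMap r =>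
    intro x hx
    rw [algebraMap_smul]
    exact W.smul_mem r hx
  | ι v =>
    intro x hx
    have hv : v = ∑ b : Fin l, v b • fun a : Fin l => if (a : ℕ) = b then (1 : ℝ) else 0 := by
      funext a
      simp [Finset.sum_apply, ← Fin.ext_iff]
    rw [hv, map_sum, Finset.sum_smul]
    refine Submodule.sum_mem _ fun b _ => ?_
    rw [map_smul, smul_assoc]
    exact W.smul_mem _ (hW b b.2 x hx)
  | mul a b ha hb =>
    intro x hx
    rw [mul_smul]
    exact ha _ (hb x hx)
  | add a b ha hb =>
    intro x hx
    rw [add_smul]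
    exact add_mem (ha x hx) (hb x hx)

theorem eq_bot_or_eq_top_of_clGen_smul_mem [IsSimpleModule (Cl l) M] {W : Submodule ℝ M}
    (hW : ∀ i < l, ∀ x ∈ W, clGen l i • x ∈ W) : W = ⊥ ∨ W = ⊤ := by
  let N : Submodule (Cl l) M :=
    { W with smul_mem' := fun a x hx => smul_mem_of_clGen_smul_mem hW a x hx }
  have hN : ∀ x, x ∈ N ↔ x ∈ W := fun x => Iff.rfl
  rcases eq_bot_or_eq_top N with h | h
  · left
    rw [Submodule.eq_bot_iff]
    intro x hx
    rwa [← hN, h, Submodule.mem_bot] at hx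
  · right
    rw [Submodule.eq_top_iff']
    intro x
    rw [← hN, h]
    trivial

/-- A simple module `M` admits a nonzero intertwining operator from a model on `ℝ^(n₀ l)`. It is
surjective since `M` is simple, and injective since no Clifford module has a positive dimension
less than `n₀ l`. -/
theorem finrank_eq_of_isSimpleModule [IsSimpleModule (Cl l) M] :
    Module.finrank ℝ M = n₀ l := by
  let φ : Cl l →ₐ[ℝ] Module.End ℝ M := Algebra.lsmul ℝ ℝ M
  let A : ℕ → Module.End ℝ M := fun i => φ (clGen l i)
  have hA : IsClifford l A := isClifford_clGen.map φ.toRingHom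
  have hsimple : ∀ W : Submodule ℝ M, (∀ i < l, ∀ x ∈ W, A i x ∈ W) → W = ⊥ ∨ W = ⊤ :=
    fun W hW => eq_bot_or_eq_top_of_clGen_smul_mem hW
  have : Nontrivial M := IsSimpleModule.nontrivial (Cl l) M
  have : FiniteDimensional ℝ M := by
    obtain ⟨m, hm⟩ := exists_ne (0 : M)
    obtain ⟨W, hmW, hfin, hW⟩ := hA.exists_invariant m
    rcases hsimple W hW with rfl | rfl
    · exact absurd ((Submodule.mem_bot ℝ).1 hmW) hm
    · exact Module.Finite.equiv (Submodule.topEquiv : (⊤ : Submodule ℝ M) ≃ₗ[ℝ] M)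
  obtain ⟨J, hJ, T, hT, hT0⟩ : ∃ J : ℕ → Module.End ℝ (EuclideanSpace ℝ (Fin (n₀ l))),
      IsClifford l J ∧ ∃ T ∈ intertwiners l A J, T ≠ 0 := by
    obtain ⟨J, hJ, -⟩ := exists_isSkewClifford (E := EuclideanSpace ℝ (Fin (n₀ l))) (l := l)
      (k := 1) (zero_le_one) (by simp)
    have key : ∀ K : ℕ → Module.End ℝ (EuclideanSpace ℝ (Fin (n₀ l))), IsClifford l K →
        (Odd l → 0 ≤ LinearMap.trace ℝ M (word A (Finset.range l))
          * LinearMap.trace ℝ _ (wordInv K (Finset.range l))) →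
        ∃ T ∈ intertwiners l A K, T ≠ 0 := by
      intro K hK hpos
      refine (Submodule.ne_bot_iff _).1 fun h => ?_
      have h1 := hK.finrank_intertwiners_eq hA
      rw [h, finrank_bot, Nat.cast_zero, mul_zero, finrank_euclideanSpace_fin] at h1
      have h2 : (0 : ℝ) < Module.finrank ℝ M * n₀ l :=
        mul_pos (Nat.cast_pos.2 Module.finrank_pos) (Nat.cast_pos.2 (n₀_pos l))
      split_ifs at h1 with ho
      · linarith [hpos ho]
      · linarith
    -- Changing the signs of the generators changes the sign of the contribution of the full word.
    by_cases hpos : Odd l → 0 ≤ LinearMap.trace ℝ M (word A (Finset.range l))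
        * LinearMap.trace ℝ _ (wordInv J (Finset.range l))
    · exact ⟨J, hJ.toIsClifford, key J hJ.toIsClifford hpos⟩
    · push Not at hpos
      refine ⟨_, hJ.toIsClifford.neg, key _ hJ.toIsClifford.neg fun ho => ?_⟩
      rw [hJ.neg.trace_wordInv subset_rfl, word_neg, Finset.card_range, ho.neg_one_pow,
        neg_one_smul, map_neg, ← hJ.trace_wordInv subset_rfl]
      linarith [hpos.2]
  have hTi : ∀ i < l, ∀ x, A i (T x) = T (J i x) := fun i hi x => DFunLike.congr_fun (hT i hi) x
  have hrange : LinearMap.range T = ⊤ := by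
    refine (hsimple _ ?_).resolve_left fun h => hT0 (LinearMap.range_eq_bot.1 h)
    rintro i hi _ ⟨x, rfl⟩
    exact ⟨J i x, (hTi i hi x).symm⟩
  have hker : ∀ i < l, ∀ x ∈ LinearMap.ker T, J i x ∈ LinearMap.ker T := by
    intro i hi x hx
    rw [LinearMap.mem_ker] at hx ⊢
    rw [← hTi i hi, hx, map_zero]
  -- The dimension of the kernel is a multiple of `n₀ l` and smaller than `n₀ l`.
  have hdvd := n₀_dvd_finrank l _ _ (hJ.restr hker)
  have hsum := LinearMap.finrank_range_add_finrank_ker T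
  rw [hrange, finrank_top, finrank_euclideanSpace_fin] at hsum
  have hMpos : 0 < Module.finrank ℝ M := Module.finrank_pos
  have h0 := Nat.eq_zero_of_dvd_of_lt hdvd (by omega)
  omega

end SimpleModules

end CliffordKilling

end

theorem theorem16 (n d : ℕ) (hd : d + 1 = 2 * n) :
    -- existence
    (∀ l : ℕ, (∃ V : Submodule ℝ (CliffordKilling.Field d), CliffordKilling.IsCK d l V) ↔
      1 ≤ l ∧ l ≤ CliffordKilling.radonHurwitz (2 * n) - 1) ∧
    -- `n₀ l` is the dimension of the irreducible modules over the Clifford algebra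
    (∀ l : ℕ, 1 ≤ l → ∀ (M : Type) [AddCommGroup M] [Module ℝ M] [Module (CliffordKilling.Cl l) M]
      [IsScalarTower ℝ (CliffordKilling.Cl l) M] [IsSimpleModule (CliffordKilling.Cl l) M],
      Module.finrank ℝ M = CliffordKilling.n₀ l) ∧
    -- equivalence is equivalence with respect to `O(2n)`
    (∀ (l : ℕ) (V W : Submodule ℝ (CliffordKilling.Field d)),
      CliffordKilling.IsCK d l V → CliffordKilling.IsCK d l W →
      (CliffordKilling.Equivalent V W ↔ CliffordKilling.OrthogonallyEquivalent V W)) ∧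
    -- divisibility and the number of classes
    (∀ l : ℕ, 1 ≤ l → l ≤ CliffordKilling.radonHurwitz (2 * n) - 1 →
      CliffordKilling.n₀ l ∣ 2 * n ∧
      (CliffordKilling.AllEquivalent d l ↔ l % 4 ≠ 3 ∨ CliffordKilling.n₀ l = 2 * n) ∧
      (l % 4 = 3 →
        Nat.card (CliffordKilling.CKClasses d l) = n / CliffordKilling.n₀ l + 1)) ∧
    -- the maximal dimension
    (∀ α β n' : ℕ, β ≤ 3 → Odd n' → 2 * n = 2 ^ (4 * α + β) * n' →
      (CliffordKilling.AllEquivalent d (CliffordKilling.radonHurwitz (2 * n) - 1) ↔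
        β = 0 ∨ β = 1 ∨ n' = 1) ∧
      (β = 2 ∨ β = 3 →
        Nat.card (CliffordKilling.CKClasses d (CliffordKilling.radonHurwitz (2 * n) - 1))
          = n' / 2 + 1)) := by
  have hn : 2 * n ≠ 0 := by omega
  refine ⟨fun l => ?_, fun l _ M _ _ _ _ _ => CliffordKilling.finrank_eq_of_isSimpleModule,
    fun l V W _ _ => CliffordKilling.equivalent_iff_orthogonallyEquivalent V W, fun l hl hl' => ?_,
    fun α β n' hβ hn' h => ?_⟩
  · rw [CliffordKilling.exists_isCK_iff, hd, CliffordKilling.n₀_dvd_iff hn]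
  · have hdvd := (CliffordKilling.n₀_dvd_iff hn).2 hl'
    obtain ⟨k, hk⟩ := hdvd
    have hk' : d + 1 = k * CliffordKilling.n₀ l := by rw [hd, hk, mul_comm]
    refine ⟨⟨k, hk⟩, ?_, fun h3 => ?_⟩
    · rw [CliffordKilling.allEquivalent_iff hl hk', hk, eq_comm (b := _ * k),
        Nat.mul_eq_left (CliffordKilling.n₀_pos l).ne']
    · rw [CliffordKilling.card_ckClasses h3 hk', ← Nat.mul_div_mul_left n _ two_pos, hk,
        mul_comm 2, Nat.mul_div_mul_left _ _ (CliffordKilling.n₀_pos l)]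
  · have hρ := CliffordKilling.radonHurwitz_eq hβ hn' h
    have hk : d + 1 = n' * CliffordKilling.n₀ (8 * α + 2 ^ β - 1) := by
      rw [CliffordKilling.n₀_eq hβ, hd, h, mul_comm]
    have hpos : α ≠ 0 ∨ β ≠ 0 := by
      by_contra! h0
      rw [h0.1, h0.2, mul_zero, pow_zero, one_mul] at h
      exact (Nat.not_even_iff_odd.2 hn') ⟨n, by omega⟩
    rw [hρ]
    constructor
    · rw [CliffordKilling.allEquivalent_iff (by interval_cases β <;> omega) hk]
      interval_cases β <;> omega
    · intro hβ'
      refine CliffordKilling.card_ckClasses ?_ hk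
      rcases hβ' with rfl | rfl <;> omega
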